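/- **Lemma (cohomological descent for hypercovers).** Manifolds are finite-dimensional, smooth, without boundary, Hausdorff and second countable. A *simplicial manifold* $X_\bullet$ is a contravariant functor from the simplex category to manifolds and smooth maps, with faces $d_i$ and degeneracies $s_i$; for a simplicial set $K$, $\mathrm{Hom}(K,X_\bullet)$ is the set of simplicial maps $K\to X_\bullet$. This set, and fibre products of such sets, carry (when it exists) the manifold structure for which the smooth maps into them are exactly the componentwise smooth ones. "Surjective submersion onto" and "diffeomorphism onto" such a set include the existence of this manifold structure. For $n\ge 0$, a *Lie $n$-groupoid* is a simplicial manifold $X_\bullet$ such that the horn projection $X_m=\mathrm{Hom}(\Delta^m,X_\bullet)\to\mathrm{Hom}(\Lambda^m_j,X_\bullet)$ is a surjective submersion for all $m\ge1$, $0\le j\le m$, and a diffeomorphism for all $m\ge n+1$, $0\le j\le m$. A simplicial map $f:X_\bullet\to Y_\bullet$ of Lie $n$-groupoids is a *hypercover* if $$q_m=((d_0,\dots,d_m),f_m):X_m\to \mathrm{Hom}(\partial\Delta^m,X_\bullet)\times_{\mathrm{Hom}(\partial\Delta^m,Y_\bullet)}Y_m$$ is a surjective submersion for $0\le m\le n-1$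 and a diffeomorphism for $m=n$. Let $\widehat\Omega^q(X_p)\subseteq\Omega^q(X_p)$ be the space of smooth differential $q$-forms $\alpha$ on $X_p$ with $s_i^*\alpha=0$ for all degeneracies $s_i:X_{p-1}\to X_p$, and for $k\ge0$ let $F^k\widehat\Omega^q(X_p)$ be $0$ if $q<k$ and $\widehat\Omega^q(X_p)$ if $q\ge k$. Let $F^k\widehat\Omega^\bullet(X_\bullet)$ be the ($k$-truncated, normalised Bott–Shulman–Stasheff) total complex $$F^k\widehat\Omega^N(X_\bullet)=\bigoplus_{p+q=N}F^k\widehat\Omega^q(X_p),\qquad D=\delta+(-1)^p d,\qquad \delta=\sum_i(-1)^i d_i^*,$$ where $d$ is the de Rham differential. Then for every $n\ge 0$, every hypercover $f:X_\bullet\to Y_\bullet$ of Lie $n$-groupoids and every $k\ge0$, the pullback $$f^*:F^k\widehat\Omega^\bullet(Y_\bullet)\to F^k\widehat\Omega^\bullet(X_\bullet)$$ is a quasi-isomorphism, i.e. it induces an isomorphism on the cohomology groups in every degree. -/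

import Mathlib

universe u

noncomputable section

section

open scoped Manifold ContDiff Topology


namespace DiffForm

section Normed
variable {E F G : Type*} [NormedAddCommGroup E] [NormedSpace ℝ E] [NormedAddCommGroup F]
  [NormedSpace ℝ F] [NormedAddCommGroup G] [NormedSpace ℝ G] {q : ℕ}

/-- Alternatization of continuous multilinear forms, as a continuous linear map. -/
def alternatizationCLM (E : Type*) [NormedAddCommGroup E] [NormedSpace ℝ E] (q : ℕ) :
    ContinuousMultilinearMap ℝ (fun _ : Fin q => E) ℝ →L[ℝ] (E [⋀^Fin q]→L[ℝ] ℝ) :=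
  LinearMap.mkContinuous
    { toFun := ContinuousMultilinearMap.alternatization
      map_add' := map_add _
      map_smul' := fun c f => by
        ext v
        have h : ∀ g : ContinuousMultilinearMap ℝ (fun _ : Fin q => E) ℝ,
            g.alternatization v = ∑ σ : Equiv.Perm (Fin q), Equiv.Perm.sign σ • g (v ∘ σ) :=
          fun g => ContinuousMultilinearMap.alternatization_apply_apply g v
        change (c • f).alternatization v = c • f.alternatization v
        rw [h, h, Finset.smul_sum]
        exact Finset.sum_congr rfl fun σ _ => smul_comm (Equiv.Perm.sign σ) c (f (v ∘ σ)) }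
    (Fintype.card (Equiv.Perm (Fin q))) fun f => by
      refine ContinuousAlternatingMap.opNorm_le_bound _
        (mul_nonneg (Nat.cast_nonneg _) (norm_nonneg _)) fun v => ?_
      simp only [LinearMap.coe_mk, AddHom.coe_mk,
        ContinuousMultilinearMap.alternatization_apply_apply]
      refine (norm_sum_le _ _).trans ?_
      rw [mul_assoc, ← nsmul_eq_mul]
      refine Finset.sum_le_card_nsmul _ _ _ fun σ _ => ?_
      have h1 : ‖Equiv.Perm.sign σ • f (v ∘ σ)‖ = ‖f (v ∘ σ)‖ := by
        rcases Int.units_eq_one_or (Equiv.Perm.sign σ) with h | h <;> simp [h]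
      rw [h1]
      refine (f.le_opNorm _).trans_eq ?_
      congr 1
      exact Equiv.prod_comp σ fun i => ‖v i‖

theorem minSmoothness_two_le : minSmoothness ℝ 2 ≤ ∞ := by
  rw [minSmoothness_of_isRCLikeNormedField]
  exact WithTop.coe_le_coe.2 le_top

theorem contDiff_compContinuousLinearMap :
    ContDiff ℝ ∞ (fun p : (F [⋀^Fin q]→L[ℝ] ℝ) × (E →L[ℝ] F) =>
      p.1.compContinuousLinearMap p.2) := by
  have h1 : ContDiff ℝ ∞ (fun p : (F [⋀^Fin q]→L[ℝ] ℝ) × (E →L[ℝ] F) =>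
      (p.1.toContinuousMultilinearMap).compContinuousLinearMap (fun _ : Fin q => p.2)) := by
    have h2 : ContDiff ℝ ∞ (fun p : (Π _ : Fin q, E →L[ℝ] F) ×
        (ContinuousMultilinearMap ℝ (fun _ : Fin q => F) ℝ) => p.2.compContinuousLinearMap p.1) :=
      contDiff_iff_contDiffAt.2 fun p =>
        (ContinuousMultilinearMap.analyticAt_uncurry_compContinuousLinearMap (q := p)).contDiffAt
    refine h2.comp (ContDiff.prodMk (contDiff_pi.2 fun _ => contDiff_snd) ?_)
    exact (ContinuousAlternatingMap.toContinuousMultilinearMapLI (𝕜 := ℝ) (E := F) (F := ℝ)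
      (ι := Fin q)).contDiff.comp contDiff_fst
  have h3 := (((Nat.factorial q : ℝ)⁻¹ • alternatizationCLM E q).contDiff (n := ∞)).comp h1
  convert! h3 using 1
  funext p
  ext v
  have hq : (Nat.factorial q : ℝ) ≠ 0 := Nat.cast_ne_zero.2 (Nat.factorial_ne_zero q)
  have h4 : ∀ σ : Equiv.Perm (Fin q), Equiv.Perm.sign σ • p.1 (fun i => p.2 ((v ∘ σ) i)) =
      p.1 (p.2 ∘ v) := fun σ => by
    have h5 : p.1 (fun i => p.2 ((v ∘ σ) i)) = Equiv.Perm.sign σ • p.1 (p.2 ∘ v) :=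
      p.1.toAlternatingMap.map_perm (p.2 ∘ v) σ
    rw [h5, smul_smul, ← sq, Int.units_sq, one_smul]
  have h6 : (ContinuousMultilinearMap.alternatization
      ((p.1.toContinuousMultilinearMap).compContinuousLinearMap fun _ : Fin q => p.2)) v =
      ∑ σ : Equiv.Perm (Fin q), Equiv.Perm.sign σ • p.1 (fun i => p.2 ((v ∘ σ) i)) :=
    ContinuousMultilinearMap.alternatization_apply_apply _ v
  rw [Finset.sum_congr rfl fun σ _ => h4 σ, Finset.sum_const, Finset.card_univ,
    Fintype.card_perm, Fintype.card_fin, nsmul_eq_mul] at h6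
  change p.1 (p.2 ∘ v) = (Nat.factorial q : ℝ)⁻¹ * (ContinuousMultilinearMap.alternatization
      ((p.1.toContinuousMultilinearMap).compContinuousLinearMap fun _ : Fin q => p.2)) v
  rw [h6, inv_mul_cancel_left₀ hq]
end Normed

section Mfd
variable {E E' E'' : Type*} [NormedAddCommGroup E] [NormedSpace ℝ E] [NormedAddCommGroup E']
  [NormedSpace ℝ E'] [NormedAddCommGroup E''] [NormedSpace ℝ E'']
  {M : Type*} [TopologicalSpace M] [ChartedSpace E M]
  {N : Type*} [TopologicalSpace N] [ChartedSpace E' N]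
  {P : Type*} [TopologicalSpace P] [ChartedSpace E'' P] {q : ℕ}

/-- The coordinate expression `(e⁻¹)^* a` of a field of alternating forms in a chart `e`. -/
def localRep (a : ∀ x : M, TangentSpace 𝓘(ℝ, E) x [⋀^Fin q]→L[ℝ] ℝ)
    (e : OpenPartialHomeomorph M E) (y : E) : E [⋀^Fin q]→L[ℝ] ℝ :=
  (a (e.symm y)).compContinuousLinearMap (mfderiv 𝓘(ℝ, E) 𝓘(ℝ, E) e.symm y)

/-- Pullback of a field of alternating forms: `(f^* a)_x = a_{f x} ∘ (T_x f)^q`. -/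
def pull (f : M → N) (a : ∀ x : N, TangentSpace 𝓘(ℝ, E') x [⋀^Fin q]→L[ℝ] ℝ) (x : M) :
    TangentSpace 𝓘(ℝ, E) x [⋀^Fin q]→L[ℝ] ℝ :=
  (a (f x)).compContinuousLinearMap (mfderiv 𝓘(ℝ, E) 𝓘(ℝ, E') f x)

/-- Exterior derivative of a field of alternating forms, computed at each `x` in the preferred
chart around `x`. -/
def extD (a : ∀ x : M, TangentSpace 𝓘(ℝ, E) x [⋀^Fin q]→L[ℝ] ℝ) (x : M) :
    TangentSpace 𝓘(ℝ, E) x [⋀^Fin (q + 1)]→L[ℝ] ℝ :=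
  (extDeriv (localRep a (chartAt E x)) (chartAt E x x)).compContinuousLinearMap
    (mfderiv 𝓘(ℝ, E) 𝓘(ℝ, E) (chartAt E x) x)

theorem contMDiffOn_chart [IsManifold 𝓘(ℝ, E) ∞ M] {e : OpenPartialHomeomorph M E}
    (he : e ∈ atlas E M) : ContMDiffOn 𝓘(ℝ, E) 𝓘(ℝ, E) ∞ e e.source :=
  contMDiffOn_of_mem_maximalAtlas (IsManifold.subset_maximalAtlas he)

theorem contMDiffOn_chart_symm [IsManifold 𝓘(ℝ, E) ∞ M] {e : OpenPartialHomeomorph M E}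
    (he : e ∈ atlas E M) : ContMDiffOn 𝓘(ℝ, E) 𝓘(ℝ, E) ∞ e.symm e.target :=
  contMDiffOn_symm_of_mem_maximalAtlas (IsManifold.subset_maximalAtlas he)

theorem contDiffAt_coord [IsManifold 𝓘(ℝ, E) ∞ M] [IsManifold 𝓘(ℝ, E') ∞ N] {f : M → N}
    (hf : ContMDiff 𝓘(ℝ, E) 𝓘(ℝ, E') ∞ f)
    {e : OpenPartialHomeomorph M E} (he : e ∈ atlas E M)
    {e' : OpenPartialHomeomorph N E'} (he' : e' ∈ atlas E' N) {y : E} (hy : y ∈ e.target)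
    (hfy : f (e.symm y) ∈ e'.source) :
    ContDiffAt ℝ ∞ (e' ∘ f ∘ e.symm) y := by
  rw [← contMDiffAt_iff_contDiffAt]
  have h1 := (contMDiffOn_chart_symm he).contMDiffAt (e.open_target.mem_nhds hy)
  have h2 := (contMDiffOn_chart he').contMDiffAt (e'.open_source.mem_nhds hfy)
  exact h2.comp y ((hf _).comp y h1)

theorem eventually_mem_source [IsManifold 𝓘(ℝ, E) ∞ M] [IsManifold 𝓘(ℝ, E') ∞ N] {f : M → N}
    (hf : ContMDiff 𝓘(ℝ, E) 𝓘(ℝ, E') ∞ f)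
    {e : OpenPartialHomeomorph M E} {e' : OpenPartialHomeomorph N E'} {y : E} (hy : y ∈ e.target)
    (hfy : f (e.symm y) ∈ e'.source) :
    ∀ᶠ z in 𝓝 y, z ∈ e.target ∧ f (e.symm z) ∈ e'.source := by
  refine Filter.Eventually.and (e.open_target.mem_nhds hy) ?_
  exact (hf.continuous.continuousAt.comp (e.continuousAt_symm hy)).preimage_mem_nhds
    (e'.open_source.mem_nhds hfy)

theorem localRep_pull [IsManifold 𝓘(ℝ, E) ∞ M] [IsManifold 𝓘(ℝ, E') ∞ N] {f : M → N}
    (hf : ContMDiff 𝓘(ℝ, E) 𝓘(ℝ, E') ∞ f)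
    (a : ∀ x : N, TangentSpace 𝓘(ℝ, E') x [⋀^Fin q]→L[ℝ] ℝ)
    {e : OpenPartialHomeomorph M E} (he : e ∈ atlas E M)
    {e' : OpenPartialHomeomorph N E'} (he' : e' ∈ atlas E' N) {y : E} (hy : y ∈ e.target)
    (hfy : f (e.symm y) ∈ e'.source) :
    localRep (pull f a) e y =
      (localRep a e' ((e' ∘ f ∘ e.symm) y)).compContinuousLinearMap
        (fderiv ℝ (e' ∘ f ∘ e.symm) y) := by
  have hn : (∞ : WithTop ℕ∞) ≠ 0 := by simp
  set g := e' ∘ f ∘ e.symm with hg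
  have h1 : MDifferentiableAt 𝓘(ℝ, E) 𝓘(ℝ, E) e.symm y :=
    ((contMDiffOn_chart_symm he).contMDiffAt (e.open_target.mem_nhds hy)).mdifferentiableAt hn
  have hgy : g y ∈ e'.target := e'.map_source hfy
  have h2 : MDifferentiableAt 𝓘(ℝ, E') 𝓘(ℝ, E') e'.symm (g y) :=
    ((contMDiffOn_chart_symm he').contMDiffAt (e'.open_target.mem_nhds hgy)).mdifferentiableAt hn
  have h3 : MDifferentiableAt 𝓘(ℝ, E) 𝓘(ℝ, E') g y :=
    (contDiffAt_coord hf he he' hy hfy).contMDiffAt.mdifferentiableAt hn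
  have h4 : MDifferentiableAt 𝓘(ℝ, E) 𝓘(ℝ, E') f (e.symm y) := (hf _).mdifferentiableAt hn
  have heq : e'.symm ∘ g =ᶠ[𝓝 y] f ∘ e.symm :=
    (eventually_mem_source hf hy hfy).mono fun z hz => e'.left_inv hz.2
  have h5 := (mfderiv_comp y h2 h3).symm.trans (heq.mfderiv_eq.trans (mfderiv_comp y h4 h1))
  have hpt : e'.symm (g y) = f (e.symm y) := e'.left_inv hfy
  rw [mfderiv_eq_fderiv] at h5
  ext v
  have key : ∀ (x x' : N) (w w' : Fin q → E') (_ : x = x') (_ : w = w'),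
      (a x : E' [⋀^Fin q]→L[ℝ] ℝ) w = (a x' : E' [⋀^Fin q]→L[ℝ] ℝ) w' := by
    rintro x _ w _ rfl rfl; rfl
  refine key _ _ _ _ hpt.symm ?_
  funext i
  exact (congrArg (fun L : E →L[ℝ] E' => L (v i)) h5).symm

theorem pull_id (a : ∀ x : M, TangentSpace 𝓘(ℝ, E) x [⋀^Fin q]→L[ℝ] ℝ) :
    pull (id : M → M) a = a := by
  funext x
  ext v
  simp only [pull, mfderiv_id]
  rfl

theorem pull_comp {g : N → P} {f : M → N}
    (hg : ContMDiff 𝓘(ℝ, E') 𝓘(ℝ, E'') ∞ g) (hf : ContMDiff 𝓘(ℝ, E) 𝓘(ℝ, E') ∞ f)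
    (a : ∀ x : P, TangentSpace 𝓘(ℝ, E'') x [⋀^Fin q]→L[ℝ] ℝ) :
    pull (E := E) (g ∘ f) a = pull f (pull (E := E') g a) := by
  have hn : (∞ : WithTop ℕ∞) ≠ 0 := by simp
  funext x
  ext v
  simp only [pull, mfderiv_comp x ((hg _).mdifferentiableAt hn) ((hf _).mdifferentiableAt hn)]
  rfl

theorem eq_zero_of_localRep [IsManifold 𝓘(ℝ, E) ∞ M]
    {a : ∀ x : M, TangentSpace 𝓘(ℝ, E) x [⋀^Fin q]→L[ℝ] ℝ}
    (h : ∀ e ∈ atlas E M, ∀ y ∈ e.target, localRep a e y = 0) : a = 0 := by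
  have hn : (∞ : WithTop ℕ∞) ≠ 0 := by simp
  funext x
  set e := chartAt E x
  have he : e ∈ atlas E M := chart_mem_atlas E x
  have hx : x ∈ e.source := mem_chart_source E x
  have hy : e x ∈ e.target := e.map_source hx
  have h1 : MDifferentiableAt 𝓘(ℝ, E) 𝓘(ℝ, E) e.symm (e x) :=
    ((contMDiffOn_chart_symm he).contMDiffAt (e.open_target.mem_nhds hy)).mdifferentiableAt hn
  have h2 : MDifferentiableAt 𝓘(ℝ, E) 𝓘(ℝ, E) e x :=
    ((contMDiffOn_chart he).contMDiffAt (e.open_source.mem_nhds hx)).mdifferentiableAt hn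
  have heq : e.symm ∘ e =ᶠ[𝓝 x] id :=
    Filter.eventually_of_mem (e.open_source.mem_nhds hx) fun z hz => e.left_inv hz
  have h5 := (mfderiv_comp x h1 h2).symm.trans (heq.mfderiv_eq.trans mfderiv_id)
  ext v
  have key : ∀ (x x' : M) (w w' : Fin q → E) (_ : x = x') (_ : w = w'),
      (a x : E [⋀^Fin q]→L[ℝ] ℝ) w = (a x' : E [⋀^Fin q]→L[ℝ] ℝ) w' := by
    rintro x _ w _ rfl rfl; rfl
  have h6 := congrArg (fun L : E [⋀^Fin q]→L[ℝ] ℝ =>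
    L fun i => (mfderiv 𝓘(ℝ, E) 𝓘(ℝ, E) e x : E →L[ℝ] E) (v i)) (h e he _ hy)
  refine Eq.trans (key _ _ _ _ (e.left_inv hx).symm ?_) h6
  funext i
  exact (congrArg (fun L : E →L[ℝ] E => L (v i)) h5).symm

variable (E M q) in
/-- The real vector space `Ω^q(M)` of smooth differential `q`-forms on the manifold `M`: fields of
alternating forms on the tangent spaces, all of whose coordinate expressions are smooth. -/
def Form : Submodule ℝ (∀ x : M, TangentSpace 𝓘(ℝ, E) x [⋀^Fin q]→L[ℝ] ℝ) where
  carrier := {a | ∀ e ∈ atlas E M, ContDiffOn ℝ ∞ (localRep a e) e.target}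
  add_mem' ha hb e he := (ha e he).add (hb e he)
  zero_mem' _ _ := contDiffOn_const (c := 0)
  smul_mem' c _ ha e he := (ha e he).const_smul c

theorem contDiffAt_localRep (a : Form E M q) {e : OpenPartialHomeomorph M E} (he : e ∈ atlas E M)
    {y : E} (hy : y ∈ e.target) : ContDiffAt ℝ ∞ (localRep a.1 e) y :=
  (a.2 e he).contDiffAt (e.open_target.mem_nhds hy)

theorem pull_mem [IsManifold 𝓘(ℝ, E) ∞ M] [IsManifold 𝓘(ℝ, E') ∞ N] {f : M → N}
    (hf : ContMDiff 𝓘(ℝ, E) 𝓘(ℝ, E') ∞ f) (a : Form E' N q) : pull f a.1 ∈ Form E M q := by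
  intro e he y hy
  refine ContDiffAt.contDiffWithinAt ?_
  set e' := chartAt E' (f (e.symm y))
  have he' : e' ∈ atlas E' N := chart_mem_atlas _ _
  have hfy : f (e.symm y) ∈ e'.source := mem_chart_source _ _
  have h1 := contDiffAt_coord hf he he' hy hfy
  have h2 : ContDiffAt ℝ ∞ (localRep a.1 e') ((e' ∘ f ∘ e.symm) y) :=
    contDiffAt_localRep a he' (e'.map_source hfy)
  have h3 : ContDiffAt ℝ ∞ (fderiv ℝ (e' ∘ f ∘ e.symm)) y := h1.fderiv_right (by simp)
  refine ((contDiff_compContinuousLinearMap.contDiffAt).comp y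
    ((h2.comp y h1).prodMk h3)).congr_of_eventuallyEq ?_
  exact (eventually_mem_source hf hy hfy).mono fun z hz => localRep_pull hf a.1 he he' hz.1 hz.2

/-- In coordinates, the exterior derivative of a pullback is the pullback of the exterior
derivative. -/
theorem extDeriv_localRep_pull [IsManifold 𝓘(ℝ, E) ∞ M] [IsManifold 𝓘(ℝ, E') ∞ N] {f : M → N}
    (hf : ContMDiff 𝓘(ℝ, E) 𝓘(ℝ, E') ∞ f) (a : Form E' N q)
    {e : OpenPartialHomeomorph M E} (he : e ∈ atlas E M)
    {e' : OpenPartialHomeomorph N E'} (he' : e' ∈ atlas E' N) {y : E} (hy : y ∈ e.target)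
    (hfy : f (e.symm y) ∈ e'.source) :
    extDeriv (localRep (pull f a.1) e) y =
      (extDeriv (localRep a.1 e') ((e' ∘ f ∘ e.symm) y)).compContinuousLinearMap
        (fderiv ℝ (e' ∘ f ∘ e.symm) y) := by
  have hn : (∞ : WithTop ℕ∞) ≠ 0 := by simp
  have h1 := contDiffAt_coord hf he he' hy hfy
  have h2 : ContDiffAt ℝ ∞ (localRep a.1 e') ((e' ∘ f ∘ e.symm) y) :=
    contDiffAt_localRep a he' (e'.map_source hfy)
  have heq := (eventually_mem_source hf hy hfy).mono fun z hz =>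
    localRep_pull hf a.1 he he' hz.1 hz.2
  rw [Filter.EventuallyEq.extDeriv_eq heq]
  exact extDeriv_pullback (h2.differentiableAt hn) h1 minSmoothness_two_le

theorem localRep_extD [IsManifold 𝓘(ℝ, E) ∞ M] (a : Form E M q)
    {e : OpenPartialHomeomorph M E} (he : e ∈ atlas E M) {y : E} (hy : y ∈ e.target) :
    localRep (extD a.1) e y = extDeriv (localRep a.1 e) y := by
  have hn : (∞ : WithTop ℕ∞) ≠ 0 := by simp
  set c := chartAt E (e.symm y) with hc
  have he' : c ∈ atlas E M := chart_mem_atlas _ _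
  have hx : e.symm y ∈ c.source := mem_chart_source _ _
  have h := extDeriv_localRep_pull (f := (id : M → M)) contMDiff_id a he he' hy hx
  rw [pull_id] at h
  rw [h]
  have h1 : MDifferentiableAt 𝓘(ℝ, E) 𝓘(ℝ, E) e.symm y :=
    ((contMDiffOn_chart_symm he).contMDiffAt (e.open_target.mem_nhds hy)).mdifferentiableAt hn
  have h2 : MDifferentiableAt 𝓘(ℝ, E) 𝓘(ℝ, E) c (e.symm y) :=
    ((contMDiffOn_chart he').contMDiffAt (c.open_source.mem_nhds hx)).mdifferentiableAt hn
  have h5 := mfderiv_comp y h2 h1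
  rw [mfderiv_eq_fderiv] at h5
  ext v
  refine congrArg (extDeriv (localRep a.1 c) (c (e.symm y))) ?_
  funext i
  exact (congrArg (fun L : E →L[ℝ] E => L (v i)) h5).symm

theorem extD_mem [IsManifold 𝓘(ℝ, E) ∞ M] (a : Form E M q) : extD a.1 ∈ Form E M (q + 1) := by
  intro e he y hy
  refine ContDiffAt.contDiffWithinAt ?_
  have h3 : ContDiffAt ℝ ∞ (fderiv ℝ (localRep a.1 e)) y :=
    (contDiffAt_localRep a he hy).fderiv_right (by simp)
  have h5 : ContDiff ℝ ∞ fun L : E →L[ℝ] (E [⋀^Fin q]→L[ℝ] ℝ) =>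
      ContinuousAlternatingMap.alternatizeUncurryFin L :=
    (IsLinearMap.with_bound
      ⟨fun L L' => map_add (ContinuousAlternatingMap.alternatizeUncurryFinCLM ℝ E ℝ) L L',
        fun c L => map_smul (ContinuousAlternatingMap.alternatizeUncurryFinCLM ℝ E ℝ) c L⟩ (q + 1)
      fun L => ContinuousAlternatingMap.norm_alternatizeUncurryFin_le L).contDiff
  have h4 : ContDiffAt ℝ ∞ (extDeriv (localRep a.1 e)) y := h5.contDiffAt.comp y h3
  exact h4.congr_of_eventuallyEq
    (Filter.eventually_of_mem (e.open_target.mem_nhds hy) fun z hz => localRep_extD a he hz)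

/-- The pullback `f^* : Ω^q(N) → Ω^q(M)` along a smooth map. -/
def pullback [IsManifold 𝓘(ℝ, E) ∞ M] [IsManifold 𝓘(ℝ, E') ∞ N] (f : M → N)
    (hf : ContMDiff 𝓘(ℝ, E) 𝓘(ℝ, E') ∞ f) (q : ℕ) : Form E' N q →ₗ[ℝ] Form E M q where
  toFun a := ⟨pull f a.1, pull_mem hf a⟩
  map_add' _ _ := rfl
  map_smul' _ _ := rfl

variable (E M q) in
/-- The de Rham differential `d : Ω^q(M) → Ω^{q+1}(M)`. -/
def d [IsManifold 𝓘(ℝ, E) ∞ M] : Form E M q →ₗ[ℝ] Form E M (q + 1) where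
  toFun a := ⟨extD a.1, extD_mem a⟩
  map_add' a b := by
    have hn : (∞ : WithTop ℕ∞) ≠ 0 := by simp
    ext x v
    have hx := (chartAt E x).map_source (mem_chart_source E x)
    have h : extDeriv (localRep (a.1 + b.1) (chartAt E x)) (chartAt E x x) = _ := extDeriv_add
      ((contDiffAt_localRep a (chart_mem_atlas E x) hx).differentiableAt hn)
      ((contDiffAt_localRep b (chart_mem_atlas E x) hx).differentiableAt hn)
    exact congrArg (fun L : E [⋀^Fin (q + 1)]→L[ℝ] ℝ =>
      L fun i => mfderiv 𝓘(ℝ, E) 𝓘(ℝ, E) (chartAt E x) x (v i)) h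
  map_smul' c a := by
    ext x v
    have h : extDeriv (localRep (c • a.1) (chartAt E x)) (chartAt E x x) = _ :=
      extDeriv_smul c (localRep a.1 (chartAt E x))
    exact congrArg (fun L : E [⋀^Fin (q + 1)]→L[ℝ] ℝ =>
      L fun i => mfderiv 𝓘(ℝ, E) 𝓘(ℝ, E) (chartAt E x) x (v i)) h

theorem d_d [IsManifold 𝓘(ℝ, E) ∞ M] (a : Form E M q) : d E M (q + 1) (d E M q a) = 0 := by
  refine Subtype.ext (eq_zero_of_localRep fun e he y hy => ?_)
  refine (localRep_extD (d E M q a) he hy).trans ?_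
  have h : localRep (d E M q a).1 e =ᶠ[𝓝 y] extDeriv (localRep a.1 e) :=
    Filter.eventually_of_mem (e.open_target.mem_nhds hy) fun z hz => localRep_extD a he hz
  rw [h.extDeriv_eq]
  exact extDeriv_extDeriv_apply (contDiffAt_localRep a he hy) minSmoothness_two_le

theorem d_pullback [IsManifold 𝓘(ℝ, E) ∞ M] [IsManifold 𝓘(ℝ, E') ∞ N] (f : M → N)
    (hf : ContMDiff 𝓘(ℝ, E) 𝓘(ℝ, E') ∞ f) (a : Form E' N q) :
    d E M q (pullback f hf q a) = pullback f hf (q + 1) (d E' N q a) := by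
  rw [← sub_eq_zero]
  refine Subtype.ext (eq_zero_of_localRep fun e he y hy => ?_)
  have he' := chart_mem_atlas E' (f (e.symm y))
  have hfy := mem_chart_source E' (f (e.symm y))
  have h1 : localRep (d E M q (pullback f hf q a)).1 e y = _ :=
    (localRep_extD (pullback f hf q a) he hy).trans
      (extDeriv_localRep_pull hf a he he' hy hfy)
  have h2 : localRep (pullback f hf (q + 1) (d E' N q a)).1 e y = _ :=
    localRep_pull hf (extD a.1) he he' hy hfy
  have h3 := localRep_extD a he' ((chartAt E' (f (e.symm y))).map_source hfy)
  refine sub_eq_zero.2 (h1.trans (Eq.trans ?_ h2.symm))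
  exact congrArg (fun L : E' [⋀^Fin (q + 1)]→L[ℝ] ℝ => L.compContinuousLinearMap
    (fderiv ℝ (chartAt E' (f (e.symm y)) ∘ f ∘ e.symm) y)) h3.symm

end Mfd
end DiffForm

end

section

open scoped Manifold ContDiff

/-- A smooth manifold: finite-dimensional, without boundary, Hausdorff and second countable. -/
structure SmoothMfd where
  carrier : Type u
  dim : ℕ
  [top : TopologicalSpace carrier]
  [charted : ChartedSpace (EuclideanSpace ℝ (Fin dim)) carrier]
  [isManifold : IsManifold (𝓡 dim) ∞ carrier]
  [t2 : T2Space carrier]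
  [secondCountable : SecondCountableTopology carrier]

namespace SmoothMfd

instance : CoeSort SmoothMfd.{u} (Type u) := ⟨SmoothMfd.carrier⟩

attribute [instance] top charted isManifold t2 secondCountable

/-- Smooth (`C^∞`) maps between manifolds. -/
def IsSmooth {M N : SmoothMfd.{u}} (f : M → N) : Prop :=
  ContMDiff (𝓡 M.dim) (𝓡 N.dim) ∞ f

/-- Submersions between manifolds. -/
def IsSubmersion {M N : SmoothMfd.{u}} (f : M → N) : Prop :=
  Manifold.IsSubmersion (𝓡 M.dim) (𝓡 N.dim) ∞ f

/-- Diffeomorphisms between manifolds. -/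
abbrev Diffeo (M N : SmoothMfd.{u}) : Type u :=
  M ≃ₘ^∞⟮𝓡 M.dim, 𝓡 N.dim⟯ N

/-- The category of smooth manifolds and smooth maps. -/
instance : CategoryTheory.Category SmoothMfd.{u} where
  Hom M N := C^∞⟮𝓡 M.dim, M; 𝓡 N.dim, N⟯
  id _ := ContMDiffMap.id
  comp f g := ContMDiffMap.comp g f

/-- The real vector space `Ω^q(M)` of smooth differential `q`-forms on a manifold. -/
def Form (M : SmoothMfd.{u}) (q : ℕ) : Type u :=
  DiffForm.Form (EuclideanSpace ℝ (Fin M.dim)) M q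

instance (M : SmoothMfd.{u}) (q : ℕ) : AddCommGroup (M.Form q) :=
  inferInstanceAs (AddCommGroup (DiffForm.Form (EuclideanSpace ℝ (Fin M.dim)) M q))

instance (M : SmoothMfd.{u}) (q : ℕ) : Module ℝ (M.Form q) :=
  inferInstanceAs (Module ℝ (DiffForm.Form (EuclideanSpace ℝ (Fin M.dim)) M q))

/-- The de Rham differential `d : Ω^q(M) → Ω^{q+1}(M)`. -/
def d (M : SmoothMfd.{u}) (q : ℕ) : M.Form q →ₗ[ℝ] M.Form (q + 1) :=
  DiffForm.d (EuclideanSpace ℝ (Fin M.dim)) M q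

end SmoothMfd

end

section

open CategoryTheory Opposite Simplicial

namespace SmoothMfd

/-- The underlying function of a morphism of manifolds. -/
def Hom.fn {M N : SmoothMfd.{u}} (f : M ⟶ N) : M → N := f.1

theorem Hom.smooth {M N : SmoothMfd.{u}} (f : M ⟶ N) : IsSmooth (Hom.fn f) := f.2

/-- The underlying set of a manifold. -/
def forget : SmoothMfd.{u} ⥤ Type u where
  obj M := M
  map f := TypeCat.ofHom (Hom.fn f)

/-- Pullback of differential forms along a smooth map. -/
def pullback {M N : SmoothMfd.{u}} (f : M ⟶ N) (q : ℕ) : N.Form q →ₗ[ℝ] M.Form q :=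
  DiffForm.pullback (Hom.fn f) (Hom.smooth f) q

theorem pullback_id {M : SmoothMfd.{u}} {q : ℕ} (a : M.Form q) : pullback (𝟙 M) q a = a :=
  Subtype.ext (DiffForm.pull_id a.1)

theorem pullback_comp {M N P : SmoothMfd.{u}} (f : M ⟶ N) (g : N ⟶ P) {q : ℕ} (a : P.Form q) :
    pullback (f ≫ g) q a = pullback f q (pullback g q a) :=
  Subtype.ext (DiffForm.pull_comp (Hom.smooth g) (Hom.smooth f) a.1)

theorem d_d {M : SmoothMfd.{u}} {q : ℕ} (a : M.Form q) : M.d (q + 1) (M.d q a) = 0 :=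
  DiffForm.d_d (E := EuclideanSpace ℝ (Fin M.dim)) a

theorem d_pullback {M N : SmoothMfd.{u}} (f : M ⟶ N) {q : ℕ} (a : N.Form q) :
    M.d q (pullback f q a) = pullback f (q + 1) (N.d q a) :=
  DiffForm.d_pullback _ _ a

/-- The functor `M ↦ Ω^q(M)`. -/
def formFunctor (q : ℕ) : SmoothMfd.{u}ᵒᵖ ⥤ ModuleCat.{u} ℝ where
  obj M := ModuleCat.of ℝ (M.unop.Form q)
  map f := ModuleCat.ofHom (pullback f.unop q)
  map_id M := by ext a; exact pullback_id a
  map_comp f g := by ext a; exact pullback_comp _ _ a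

end SmoothMfd

/-- A simplicial manifold. -/
abbrev SimplicialMfd := SimplicialObject SmoothMfd.{u}

namespace SimplicialMfd

open SmoothMfd

/-- The underlying simplicial set of a simplicial manifold. -/
abbrev toSSet (X : SimplicialMfd.{u}) : SSet.{u} :=
  ((SimplicialObject.whiskering _ _).obj SmoothMfd.forget).obj X

/-- The map of underlying simplicial sets. -/
abbrev mapSSet {X Y : SimplicialMfd.{u}} (f : X ⟶ Y) : toSSet X ⟶ toSSet Y :=
  ((SimplicialObject.whiskering _ _).obj SmoothMfd.forget).map f

end SimplicialMfd

/-- Let `S` be a set together with a specification (`plot`) of which functions from manifolds to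
`S` count as smooth. A manifold structure on `S` is a manifold with underlying set (identified
with) `S`, into which the smooth maps are exactly the specified ones. It is unique up to unique
diffeomorphism: it represents the functor of plots on the category of manifolds. -/
structure ManifoldStructure (S : Type u) (plot : ∀ T : SmoothMfd.{u}, (T → S) → Prop) where
  mfd : SmoothMfd.{u}
  equiv : mfd ≃ S
  isSmooth_iff : ∀ (T : SmoothMfd.{u}) (g : T → mfd),
    SmoothMfd.IsSmooth g ↔ plot T (equiv ∘ g)

/-- `S` is a manifold (in the above sense) and `p : M → S` is a surjective submersion. -/
def IsSurjectiveSubmersionOnto {M : SmoothMfd.{u}} {S : Type u}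
    (plot : ∀ T : SmoothMfd.{u}, (T → S) → Prop) (p : M → S) : Prop :=
  ∃ R : ManifoldStructure S plot, Function.Surjective p ∧
    SmoothMfd.IsSubmersion (R.equiv.symm ∘ p)

/-- `S` is a manifold (in the above sense) and `p : M → S` is a diffeomorphism. -/
def IsDiffeomorphismOnto {M : SmoothMfd.{u}} {S : Type u}
    (plot : ∀ T : SmoothMfd.{u}, (T → S) → Prop) (p : M → S) : Prop :=
  ∃ R : ManifoldStructure S plot, ∃ Φ : M.Diffeo R.mfd,
    ∀ x, R.equiv (Φ x) = p x

namespace SimplicialMfd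

open SmoothMfd

/-- A family `φ` of simplicial maps `K → X` parametrised by a manifold `T` is smooth when
`t ↦ φ_t(s)` is smooth for every simplex `s` of `K`, that is, when `φ` comes from a simplicial
map `K → Mfd(T, X_•)`. -/
def homPlot (X : SimplicialMfd.{u}) (K : SSet.{u}) (T : SmoothMfd.{u})
    (φ : T → (K ⟶ toSSet X)) : Prop :=
  ∀ (r : ℕ) (s : K _⦋r⦌),
    IsSmooth (M := T) (N := X _⦋r⦌) fun t => (φ t).app (op ⦋r⦌) s

/-- The simplicial map `Δ^m → X` classifying an element of `X_m`. -/
def simplexMap (X : SimplicialMfd.{u}) {m : ℕ} (x : X _⦋m⦌) : Δ[m] ⟶ toSSet X :=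
  (SSet.yonedaEquiv (X := toSSet X)).symm x

/-- The horn projection `p^m_j : X_m = Hom(Δ^m, X) → Hom(Λ^m_j, X)`. -/
def hornProj (X : SimplicialMfd.{u}) (m : ℕ) (j : Fin (m + 1)) (x : X _⦋m⦌) :
    (Λ[m, j] : SSet.{u}) ⟶ toSSet X :=
  Λ[m, j].ι ≫ simplexMap X x

/-- The condition `Kan(m,j)`: the horn projection is a surjective submersion. -/
def Kan (X : SimplicialMfd.{u}) (m : ℕ) (j : Fin (m + 1)) : Prop :=
  IsSurjectiveSubmersionOnto (homPlot X Λ[m, j]) (hornProj X m j)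

/-- The condition `Kan!(m,j)`: the horn projection is a diffeomorphism. -/
def StrictKan (X : SimplicialMfd.{u}) (m : ℕ) (j : Fin (m + 1)) : Prop :=
  IsDiffeomorphismOnto (homPlot X Λ[m, j]) (hornProj X m j)

/-- Lie `n`-groupoids. -/
structure IsLieGroupoid (n : ℕ) (X : SimplicialMfd.{u}) : Prop where
  kan : ∀ m, 1 ≤ m → ∀ j : Fin (m + 1), Kan X m j
  strictKan : ∀ m, n + 1 ≤ m → ∀ j : Fin (m + 1), StrictKan X m j

/-- The fibre product `Hom(∂Δ^m, X) ×_{Hom(∂Δ^m, Y)} Y_m`. -/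
def RelMatching {X Y : SimplicialMfd.{u}} (f : X ⟶ Y) (m : ℕ) : Type u :=
  {z : ((∂Δ[m] : SSet.{u}) ⟶ toSSet X) × Y _⦋m⦌ //
    z.1 ≫ mapSSet f = ∂Δ[m].ι ≫ simplexMap Y z.2}

/-- A map to the fibre product is smooth when both components are. -/
def relMatchingPlot {X Y : SimplicialMfd.{u}} (f : X ⟶ Y) (m : ℕ) (T : SmoothMfd.{u})
    (φ : T → RelMatching f m) : Prop :=
  homPlot X ∂Δ[m] T (fun t => (φ t).1.1) ∧
    IsSmooth fun t => (φ t).1.2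

/-- The map `q_m = ((d_0, …, d_m), f_m) : X_m → Hom(∂Δ^m, X) ×_{Hom(∂Δ^m, Y)} Y_m`. -/
def relMatchingMap {X Y : SimplicialMfd.{u}} (f : X ⟶ Y) (m : ℕ) (x : X _⦋m⦌) :
    RelMatching f m :=
  ⟨(∂Δ[m].ι ≫ simplexMap X x, SmoothMfd.Hom.fn (f.app (op ⦋m⦌)) x), by
    rw [Category.assoc]
    congr 1
    exact SSet.yonedaEquiv_symm_comp (X := toSSet X) (Y := toSSet Y) x (mapSSet f)⟩

/-- Hypercovers between Lie `n`-groupoids. -/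
structure IsHypercover (n : ℕ) {X Y : SimplicialMfd.{u}} (f : X ⟶ Y) : Prop where
  source : IsLieGroupoid n X
  target : IsLieGroupoid n Y
  submersion : ∀ m < n, IsSurjectiveSubmersionOnto (relMatchingPlot f m) (relMatchingMap f m)
  diffeomorphism : IsDiffeomorphismOnto (relMatchingPlot f n) (relMatchingMap f n)

section BottShulmanStasheff

variable (X Y : SimplicialMfd.{u})

/-- The simplicial differential `δ = ∑ (-1)^i d_i^* : Ω^q(X_p) → Ω^q(X_{p+1})`. -/
def simplicialDiff (p q : ℕ) : (X _⦋p⦌).Form q →ₗ[ℝ] (X _⦋p + 1⦌).Form q :=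
  ∑ i : Fin (p + 2), (-1 : ℤ) ^ (i : ℕ) • SmoothMfd.pullback (X.δ i) q

/-- Normalised forms: those `α ∈ Ω^q(X_p)` with `s_i^* α = 0` for all degeneracies `s_i`. -/
def normalised (p q : ℕ) : Submodule ℝ ((X _⦋p⦌).Form q) :=
  match p with
  | 0 => ⊤
  | p + 1 => ⨅ i : Fin (p + 1), LinearMap.ker (SmoothMfd.pullback (X.σ i) q)

/-- The truncation `F^k Ω̂^q(X_p)`: zero for `q < k`, and `Ω̂^q(X_p)` for `q ≥ k`. -/
def truncated (k p q : ℕ) : Submodule ℝ ((X _⦋p⦌).Form q) :=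
  if q < k then ⊥ else normalised X p q

/-- The total operator `D = δ + (-1)^p d` on families `(α_{p,q})` with `α_{p,q} ∈ Ω^q(X_p)`: the
component of `D α` in `Ω^q(X_p)` is `δ α_{p-1,q} + (-1)^p d α_{p,q-1}`. -/
def totalDiff : (∀ p q : ℕ, (X _⦋p⦌).Form q) →ₗ[ℝ] (∀ p q : ℕ, (X _⦋p⦌).Form q) where
  toFun α p q :=
    (match p with
      | 0 => 0
      | p + 1 => simplicialDiff X p q (α p q)) +
    (-1 : ℤ) ^ p •
      (match q with
      | 0 => 0
      | q + 1 => (X _⦋p⦌).d q (α p q))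
  map_add' α β := by
    funext p q
    rcases p with _ | p <;> rcases q with _ | q <;>
      simp only [Pi.add_apply, map_add, smul_add, add_zero, zero_add, smul_zero] <;> abel
  map_smul' c α := by
    funext p q
    rcases p with _ | p <;> rcases q with _ | q <;>
      simp only [Pi.smul_apply, map_smul, smul_add, add_zero, zero_add, smul_zero,
        RingHom.id_apply, smul_comm c]

/-- The degree `n` part `⨁_{p+q=n} F^k Ω̂^q(X_p)` of the truncated total complex, realised as the
space of families `(α_{p,q})_{p,q}` that are supported on the finite set `p + q = n`. -/
def total (k n : ℕ) : Submodule ℝ (∀ p q : ℕ, (X _⦋p⦌).Form q) where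
  carrier := {α | ∀ p q, α p q ∈ truncated X k p q ∧ (p + q ≠ n → α p q = 0)}
  add_mem' ha hb p q :=
    ⟨add_mem (ha p q).1 (hb p q).1, fun h => by simp [(ha p q).2 h, (hb p q).2 h]⟩
  zero_mem' p q := ⟨zero_mem _, fun _ => rfl⟩
  smul_mem' c a ha p q := ⟨Submodule.smul_mem _ c (ha p q).1, fun h => by simp [(ha p q).2 h]⟩

theorem simplicialDiff_apply {p q : ℕ} (a : (X _⦋p⦌).Form q) : simplicialDiff X p q a =
    ∑ i : Fin (p + 2), (-1 : ℤ) ^ (i : ℕ) • SmoothMfd.pullback (X.δ i) q a := by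
  simp [simplicialDiff]

theorem simplicialDiff_simplicialDiff {p q : ℕ} (a : (X _⦋p⦌).Form q) :
    simplicialDiff X (p + 1) q (simplicialDiff X p q a) = 0 := by
  let C : CosimplicialObject (ModuleCat.{u} ℝ) := Functor.rightOp X ⋙ SmoothMfd.formFunctor q
  have h1 : ∀ p, AlgebraicTopology.AlternatingCofaceMapComplex.objD C p =
      ModuleCat.ofHom (simplicialDiff X p q) := fun p => by
    ext a
    simp only [AlgebraicTopology.AlternatingCofaceMapComplex.objD, ModuleCat.hom_sum,
      ModuleCat.hom_zsmul, simplicialDiff]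
    rfl
  have h2 := AlgebraicTopology.AlternatingCofaceMapComplex.d_squared C p
  rw [h1, h1] at h2
  exact congrArg (fun g => g.hom a) h2

theorem d_simplicialDiff {p q : ℕ} (a : (X _⦋p⦌).Form q) :
    (X _⦋p + 1⦌).d q (simplicialDiff X p q a) = simplicialDiff X p (q + 1) ((X _⦋p⦌).d q a) := by
  simp only [simplicialDiff_apply, map_sum, map_zsmul, SmoothMfd.d_pullback]

theorem totalDiff_zero_zero (α : ∀ p q : ℕ, (X _⦋p⦌).Form q) : totalDiff X α 0 0 = 0 := by
  change (0 : (X _⦋0⦌).Form 0) + (-1 : ℤ) ^ 0 • (0 : (X _⦋0⦌).Form 0) = 0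
  rw [smul_zero, add_zero]

theorem totalDiff_zero_succ (α : ∀ p q : ℕ, (X _⦋p⦌).Form q) (q : ℕ) :
    totalDiff X α 0 (q + 1) = (X _⦋0⦌).d q (α 0 q) := by
  change (0 : (X _⦋0⦌).Form (q + 1)) + (-1 : ℤ) ^ 0 • (X _⦋0⦌).d q (α 0 q) = _
  rw [pow_zero, one_smul, zero_add]

theorem totalDiff_succ_zero (α : ∀ p q : ℕ, (X _⦋p⦌).Form q) (p : ℕ) :
    totalDiff X α (p + 1) 0 = simplicialDiff X p 0 (α p 0) := by
  change simplicialDiff X p 0 (α p 0) + (-1 : ℤ) ^ (p + 1) • (0 : (X _⦋p + 1⦌).Form 0) = _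
  rw [smul_zero, add_zero]

theorem totalDiff_succ_succ (α : ∀ p q : ℕ, (X _⦋p⦌).Form q) (p q : ℕ) :
    totalDiff X α (p + 1) (q + 1) = simplicialDiff X p (q + 1) (α p (q + 1)) +
      (-1 : ℤ) ^ (p + 1) • (X _⦋p + 1⦌).d q (α (p + 1) q) :=
  rfl

theorem totalDiff_totalDiff (α : ∀ p q : ℕ, (X _⦋p⦌).Form q) :
    totalDiff X (totalDiff X α) = 0 := by
  have hδ : ∀ (p q : ℕ) (c : ℤ) (a : (X _⦋p⦌).Form q),
      simplicialDiff X p q (c • a) = c • simplicialDiff X p q a := fun _ _ _ _ => map_zsmul _ _ _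
  have hd : ∀ (p q : ℕ) (c : ℤ) (a : (X _⦋p⦌).Form q),
      (X _⦋p⦌).d q (c • a) = c • (X _⦋p⦌).d q a := fun _ _ _ _ => map_zsmul _ _ _
  have hδn : ∀ (p q : ℕ) (a : (X _⦋p⦌).Form q),
      simplicialDiff X p q (-a) = -simplicialDiff X p q a := fun _ _ _ => map_neg _ _
  have hdn : ∀ (p q : ℕ) (a : (X _⦋p⦌).Form q),
      (X _⦋p⦌).d q (-a) = -(X _⦋p⦌).d q a := fun _ _ _ => map_neg _ _
  have hpow : ∀ p : ℕ, (-1 : ℤ) ^ (p + 1) = -(-1) ^ p := fun p => by rw [pow_succ, mul_neg, mul_one]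
  funext p q
  rcases p with _ | _ | p <;> rcases q with _ | _ | q <;>
    simp only [totalDiff_zero_zero, totalDiff_zero_succ, totalDiff_succ_zero, totalDiff_succ_succ,
      map_add, map_zero, hδ, hd, hδn, hdn, smul_zero, add_zero, zero_add,
      simplicialDiff_simplicialDiff, SmoothMfd.d_d, d_simplicialDiff, hpow, neg_smul, neg_add_cancel,
      add_neg_cancel, pow_zero, one_smul, neg_neg, neg_zero, Pi.zero_apply]

theorem mem_normalised_succ {p q : ℕ} {a : (X _⦋p + 1⦌).Form q} :
    a ∈ normalised X (p + 1) q ↔ ∀ i : Fin (p + 1), SmoothMfd.pullback (X.σ i) q a = 0 := by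
  simp [normalised]

theorem simplicialDiff_mem {p q : ℕ} {a : (X _⦋p⦌).Form q} (ha : a ∈ normalised X p q) :
    simplicialDiff X p q a ∈ normalised X (p + 1) q := by
  rw [mem_normalised_succ]
  intro j
  rw [simplicialDiff_apply, map_sum]
  have hcomp : ∀ i : Fin (p + 2), SmoothMfd.pullback (X.σ j) q
      ((-1 : ℤ) ^ (i : ℕ) • SmoothMfd.pullback (X.δ i) q a) =
      (-1 : ℤ) ^ (i : ℕ) • SmoothMfd.pullback (X.σ j ≫ X.δ i) q a := fun i => by
    rw [map_zsmul, SmoothMfd.pullback_comp]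
  rw [Finset.sum_congr rfl fun i _ => hcomp i]
  rw [Finset.sum_eq_add (Fin.castSucc j) (Fin.succ j) (Fin.castSucc_lt_succ).ne]
  · rw [SimplicialObject.δ_comp_σ_self, SimplicialObject.δ_comp_σ_succ, Fin.val_succ,
      Fin.val_castSucc, pow_succ, mul_neg, mul_one, neg_smul, add_neg_cancel]
  · rintro i - ⟨h1, h2⟩
    rcases p with _ | p
    · exfalso
      have := Fin.val_ne_of_ne h1
      have := Fin.val_ne_of_ne h2
      simp only [Fin.val_castSucc, Fin.val_succ] at *
      lia
    · rw [mem_normalised_succ] at ha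
      rcases lt_or_gt_of_ne h1 with h | h
      · have hj : j ≠ 0 := by
          rintro rfl
          exact absurd h (by simp)
        have hi : i ≠ Fin.last _ := ((h.trans_le (Fin.le_last _)).ne)
        obtain ⟨j, rfl⟩ := Fin.exists_succ_eq.2 hj
        obtain ⟨i, rfl⟩ := Fin.exists_castSucc_eq.2 hi
        rw [SimplicialObject.δ_comp_σ_of_le, SmoothMfd.pullback_comp, ha, map_zero, smul_zero]
        rw [Fin.lt_def] at h
        rw [Fin.le_def]
        simp only [Fin.val_castSucc, Fin.val_succ] at *
        lia
      · have hlt : j.succ < i := lt_of_le_of_ne (Fin.castSucc_lt_iff_succ_le.1 h) (Ne.symm h2)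
        have hi : i ≠ 0 := ((Fin.zero_le _).trans_lt hlt).ne'
        have hj : j ≠ Fin.last _ := by
          rintro rfl
          rw [Fin.lt_def] at hlt
          simp only [Fin.val_last, Fin.val_succ] at hlt
          lia
        obtain ⟨i, rfl⟩ := Fin.exists_succ_eq.2 hi
        obtain ⟨j, rfl⟩ := Fin.exists_castSucc_eq.2 hj
        rw [SimplicialObject.δ_comp_σ_of_gt, SmoothMfd.pullback_comp, ha, map_zero, smul_zero]
        rw [Fin.lt_def] at hlt ⊢
        simp only [Fin.val_castSucc, Fin.val_succ] at *
        lia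
  · simp
  · simp

theorem d_mem {p q : ℕ} {a : (X _⦋p⦌).Form q} (ha : a ∈ normalised X p q) :
    (X _⦋p⦌).d q a ∈ normalised X p (q + 1) := by
  rcases p with _ | p
  · trivial
  · rw [mem_normalised_succ] at ha ⊢
    intro i
    rw [← SmoothMfd.d_pullback, ha i, map_zero]

theorem totalDiff_mem {k n : ℕ} {α : ∀ p q : ℕ, (X _⦋p⦌).Form q} (hα : α ∈ total X k n) :
    totalDiff X α ∈ total X k (n + 1) := by
  have hδ : ∀ p q, simplicialDiff X p q (α p q) ∈ truncated X k (p + 1) q := fun p q => by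
    have h := (hα p q).1
    unfold truncated at h ⊢
    split_ifs at h ⊢
    · rw [(Submodule.mem_bot ℝ).1 h, map_zero]
      exact zero_mem _
    · exact simplicialDiff_mem X h
  have hd : ∀ p q, (X _⦋p⦌).d q (α p q) ∈ truncated X k p (q + 1) := fun p q => by
    have h := (hα p q).1
    unfold truncated at h ⊢
    split_ifs at h ⊢ with h1 h2 h3
    · rw [(Submodule.mem_bot ℝ).1 h, map_zero]
      exact zero_mem _
    · lia
    · rw [(Submodule.mem_bot ℝ).1 h, map_zero]
      exact zero_mem _
    · exact d_mem X h
  intro p q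
  rcases p with _ | p <;> rcases q with _ | q
  · rw [totalDiff_zero_zero]
    exact ⟨zero_mem _, fun _ => rfl⟩
  · rw [totalDiff_zero_succ]
    refine ⟨hd _ _, fun h => ?_⟩
    rw [(hα 0 q).2 (by lia), map_zero]
  · rw [totalDiff_succ_zero]
    refine ⟨hδ _ _, fun h => ?_⟩
    rw [(hα p 0).2 (by lia), map_zero]
  · rw [totalDiff_succ_succ]
    refine ⟨add_mem (hδ _ _) (zsmul_mem (hd _ _) _), fun h => ?_⟩
    rw [(hα p (q + 1)).2 (by lia), (hα (p + 1) q).2 (by lia), map_zero, map_zero, smul_zero,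
      add_zero]

/-- The `k`-truncated, normalised Bott–Shulman–Stasheff total complex `F^k Ω̂^•(X)`. -/
def totalComplex (k : ℕ) : CochainComplex (ModuleCat.{u} ℝ) ℕ :=
  CochainComplex.of (fun n => ModuleCat.of ℝ (total X k n))
    (fun n => ModuleCat.ofHom ((totalDiff X).restrict fun _ h => totalDiff_mem X h))
    (fun n => by
      refine ModuleCat.hom_ext (LinearMap.ext fun α => Subtype.ext ?_)
      exact totalDiff_totalDiff X α.1)

variable {X Y}

/-- The levelwise pullback of families of forms along a simplicial map. -/
def pullbackFamily (f : X ⟶ Y) :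
    (∀ p q : ℕ, (Y _⦋p⦌).Form q) →ₗ[ℝ] (∀ p q : ℕ, (X _⦋p⦌).Form q) where
  toFun α p q := SmoothMfd.pullback (f.app (op ⦋p⦌)) q (α p q)
  map_add' _ _ := by funext p q; exact LinearMap.map_add _ _ _
  map_smul' _ _ := by funext p q; exact LinearMap.map_smul _ _ _

theorem pullback_mem (f : X ⟶ Y) {p q : ℕ} {a : (Y _⦋p⦌).Form q} (ha : a ∈ normalised Y p q) :
    SmoothMfd.pullback (f.app (op ⦋p⦌)) q a ∈ normalised X p q := by
  rcases p with _ | p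
  · trivial
  · rw [mem_normalised_succ] at ha ⊢
    intro i
    rw [← SmoothMfd.pullback_comp, SimplicialObject.σ_naturality, SmoothMfd.pullback_comp, ha i,
      map_zero]

theorem pullbackFamily_apply (f : X ⟶ Y) (α : ∀ p q : ℕ, (Y _⦋p⦌).Form q) (p q : ℕ) :
    pullbackFamily f α p q = SmoothMfd.pullback (f.app (op ⦋p⦌)) q (α p q) :=
  rfl

theorem pullbackFamily_mem (f : X ⟶ Y) {k n : ℕ} {α : ∀ p q : ℕ, (Y _⦋p⦌).Form q}
    (hα : α ∈ total Y k n) : pullbackFamily f α ∈ total X k n := by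
  intro p q
  have h := (hα p q).1
  refine ⟨?_, fun hn => ?_⟩
  · unfold truncated at h ⊢
    split_ifs at h ⊢
    · exact (Submodule.mem_bot ℝ).2 (by
        rw [pullbackFamily_apply, (Submodule.mem_bot ℝ).1 h, map_zero])
    · exact pullback_mem f h
  · rw [pullbackFamily_apply, (hα p q).2 hn, map_zero]

theorem totalDiff_pullbackFamily (f : X ⟶ Y) (α : ∀ p q : ℕ, (Y _⦋p⦌).Form q) :
    totalDiff X (pullbackFamily f α) = pullbackFamily f (totalDiff Y α) := by
  have hδ : ∀ p q, simplicialDiff X p q (pullbackFamily f α p q) =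
      SmoothMfd.pullback (f.app (op ⦋p + 1⦌)) q (simplicialDiff Y p q (α p q)) := fun p q => by
    rw [simplicialDiff_apply, simplicialDiff_apply, map_sum]
    refine Finset.sum_congr rfl fun i _ => ?_
    rw [map_zsmul, pullbackFamily_apply, ← SmoothMfd.pullback_comp, ← SmoothMfd.pullback_comp,
      SimplicialObject.δ_naturality]
  have hd : ∀ p q, (X _⦋p⦌).d q (pullbackFamily f α p q) =
      SmoothMfd.pullback (f.app (op ⦋p⦌)) (q + 1) ((Y _⦋p⦌).d q (α p q)) := fun p q =>
    SmoothMfd.d_pullback _ _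
  funext p q
  rw [pullbackFamily_apply]
  rcases p with _ | p <;> rcases q with _ | q <;>
    simp only [totalDiff_zero_zero, totalDiff_zero_succ, totalDiff_succ_zero, totalDiff_succ_succ,
      map_add, map_zero, map_zsmul, hδ, hd]

/-- The cochain map `f^* : F^k Ω̂^•(Y) → F^k Ω̂^•(X)` given by pullback along a simplicial map. -/
def totalPullback (f : X ⟶ Y) (k : ℕ) : totalComplex Y k ⟶ totalComplex X k :=
  CochainComplex.ofHom
    (fun n => ModuleCat.ofHom ((pullbackFamily f).restrict fun _ h => pullbackFamily_mem f h))
    (fun n => by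
      simp only [totalComplex, CochainComplex.of_d]
      refine ModuleCat.hom_ext (LinearMap.ext fun α => Subtype.ext ?_)
      exact totalDiff_pullbackFamily f α.1)

end BottShulmanStasheff

end SimplicialMfd

end

end

/-! It is enough to work with one form degree `q` at a time and to show that `f^*` is a homotopy
equivalence between the rows `(Ω^q(Y_•), δ)` and `(Ω^q(X_•), δ)`. The truncation keeps or kills
whole rows, and the total complex is rebuilt from its rows by an induction on `q`.

For one row, a hypercover solves families of lifting problems against `∂Δ^m ⊂ Δ^m`, with a solution
smooth near a prescribed parameter (`IsHypercover.hasLocalLifts`). Below level `n` this comes from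
local sections of submersions, at level `n` from the inverse diffeomorphism, and above `n` from
unique horn fillers. Hence the lifts of operators `Y_m → Y_r` form a semi-simplicial set which has,
for each point, a cone contraction onto a vertex preserving smoothness near that point
(`Label.exists_cone`). Smooth global lifts need not exist, but formal linear combinations of local
ones with smooth coefficients can be glued by a partition of unity, because the equations to be
solved are affine. So smooth chains of lifts are acyclic, and acyclic models give a chain map `S` of
augmentation one (`Chain.exists_chainMap`), unique up to homotopy (`Chain.exists_homotopy`).

Pulling forms back along these combinations turns `S` into maps `Ω^q(X_m) → Ω^q(Y_m)` commuting with
`δ`. Uniqueness, applied to lifts of `f` through `f` and of `𝟙 Y` through `𝟙 Y`, makes `S` a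
homotopy inverse of `f^*` (`HasLocalLifts.exists_homotopyInverse`). The Dold–Kan projector commutes
with `δ` and `f^*` and fixes normalised forms, so composing with it gives the same data on
normalised rows.

The coefficients of `S` are functions, so `S` need not commute with `d` and is not used on total
complexes. Instead a relative cocycle `f^* β = D α` is reduced row by row: in its lowest nonzero row
`D` is just `δ`, and the row statement removes that row
(`HasLocalLifts.exists_total_primitive_of_vanishing`). -/

noncomputable section

/-! ### Maps out of the boundary of a simplex. -/

section BoundaryDesc

open CategoryTheory Simplicial Opposite SSet Limits

namespace SSet.boundary

variable {n : ℕ}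

/-- The boundary of a simplex is glued from the codimension one faces along the codimension two
faces. -/
theorem multicoequalizerDiagram (n : ℕ) :
    Subcomplex.MulticoequalizerDiagram (boundary.{u} n)
      (fun j : Fin (n + 1) => stdSimplex.face.{u} {j}ᶜ)
      (fun j k => stdSimplex.face {j, k}ᶜ) where
  iSup_eq := by rw [boundary_eq_iSup]
  eq_inf j k := by
    rw [stdSimplex.face_inter_face]
    congr
    aesop

/-- A compatible family of `n + 3` simplices of dimension `n + 1` is the family of faces of a map
from the boundary. -/
theorem exists_desc {Z : SSet.{u}} (x : Fin (n + 3) → (Δ[n + 1] ⟶ Z))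
    (hx : ∀ (i j : Fin (n + 3)) (hij : i < j),
      stdSimplex.δ (j.pred (Fin.ne_zero_of_lt hij)) ≫ x i =
      stdSimplex.δ (i.castPred (Fin.ne_last_of_lt hij)) ≫ x j) :
    ∃ φ : (∂Δ[n + 2] : SSet.{u}) ⟶ Z, ∀ j, boundary.ι j ≫ φ = x j := by
  let D := (multicoequalizerDiagram.{u} (n + 2))
  let c : Multicofork (D.multispanIndex.toLinearOrder.map Subcomplex.toSSetFunctor) :=
    Multicofork.ofπ _ Z (fun j => (stdSimplex.faceSingletonComplIso j).inv ≫ x j) (by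
      rintro ⟨⟨a, b⟩, hab : a < b⟩
      dsimp
      have h1 := stdSimplex.homOfLE_faceSingletonComplIso_inv_eq_facePairComplIso_inv_δ_pred.{u}
        _ _ hab
      have h2 := stdSimplex.homOfLE_faceSingletonComplIso_inv_eq_facePairComplIso_inv_δ_castPred.{u}
        _ _ hab
      have h1' := congrArg (· ≫ x a) h1
      have h2' := congrArg (· ≫ x b) h2
      simp only [Category.assoc] at h1' h2'
      exact h1'.trans ((congrArg ((stdSimplex.facePairComplIso a b hab).inv ≫ ·)
        (hx a b hab)).trans h2'.symm))
  refine ⟨D.isColimit'.desc c, fun j => ?_⟩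
  rw [← cancel_epi (stdSimplex.faceSingletonComplIso j).inv]
  refine Eq.trans ?_ (D.isColimit'.fac c (.right j))
  exact (Category.assoc _ _ _).symm.trans
    (congrArg (· ≫ D.isColimit'.desc c) (faceSingletonComplIso_inv_ι j))

/-- Any two simplices of dimension `0` are the faces of a map from the boundary of the interval. -/
theorem exists_desc_one {Z : SSet.{u}} (x : Fin 2 → (Δ[0] ⟶ Z)) :
    ∃ φ : (∂Δ[1] : SSet.{u}) ⟶ Z, ∀ j, boundary.ι j ≫ φ = x j := by
  let D := (multicoequalizerDiagram.{u} 1)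
  let c : Multicofork (D.multispanIndex.toLinearOrder.map Subcomplex.toSSetFunctor) :=
    Multicofork.ofπ _ Z (fun j => (stdSimplex.faceSingletonComplIso j).inv ≫ x j) (by
      rintro ⟨⟨a, b⟩, hab : a < b⟩
      -- The two vertices of the interval are disjoint, so the overlap has no simplices and nothing
      -- has to be matched.
      ext ⟨r⟩ ⟨s, hs⟩
      exfalso
      change s ∈ (stdSimplex.face {a, b}ᶜ).obj _ at hs
      rw [stdSimplex.mem_face_iff] at hs
      have := hs 0
      have h2 : ({a, b} : Finset (Fin 2)) = Finset.univ := by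
        clear this hs
        revert a b
        decide
      rw [h2] at this
      simp at this)
  refine ⟨D.isColimit'.desc c, fun j => ?_⟩
  rw [← cancel_epi (stdSimplex.faceSingletonComplIso j).inv]
  refine Eq.trans ?_ (D.isColimit'.fac c (.right j))
  exact (Category.assoc _ _ _).symm.trans
    (congrArg (· ≫ D.isColimit'.desc c) (faceSingletonComplIso_inv_ι j))

/-- Every simplex of the boundary lies in some face. -/
theorem exists_ι_app_eq {r : SimplexCategoryᵒᵖ} (s : (∂Δ[n + 1] : SSet.{u}).obj r) :
    ∃ (i : Fin (n + 2)) (y : (Δ[n] : SSet.{u}).obj r), (boundary.ι i).app r y = s := by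
  obtain ⟨x, hx⟩ := s
  simp only [boundary_eq_iSup, stdSimplex.face_singleton_compl, Subfunctor.iSup_obj,
    Set.mem_iUnion, Subcomplex.mem_ofSimplex_obj_iff, op_unop] at hx
  obtain ⟨i, ⟨y, rfl⟩⟩ := hx
  exact ⟨i, stdSimplex.objEquiv.symm y, rfl⟩

end SSet.boundary

namespace SSet.horn

theorem le_boundary (n : ℕ) (j : Fin (n + 1)) : horn.{u} n j ≤ boundary n := by
  rw [horn_eq_iSup]
  exact iSup_le fun i => face_singleton_compl_le_boundary i.1

end SSet.horn
end BoundaryDesc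

/-! ### Local smoothness, local sections of submersions and local lifts. -/

section Smoothness

open scoped Manifold ContDiff Topology
open Filter

namespace SmoothMfd

/-- A function between manifolds is smooth on a neighbourhood of a point. -/
def SmoothNear {M N : SmoothMfd.{u}} (f : M → N) (x : M) : Prop :=
  ∀ᶠ y in 𝓝 x, ContMDiffAt (𝓡 M.dim) (𝓡 N.dim) ∞ f y

theorem IsSmooth.smoothNear {M N : SmoothMfd.{u}} {f : M → N} (hf : IsSmooth f) (x : M) :
    SmoothNear f x :=
  Eventually.of_forall fun y => hf y

theorem SmoothNear.continuousAt {M N : SmoothMfd.{u}} {f : M → N} {x : M}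
    (hf : SmoothNear f x) : ContinuousAt f x :=
  hf.self_of_nhds.continuousAt

theorem SmoothNear.comp {M N P : SmoothMfd.{u}} {g : N → P} {f : M → N} {x : M}
    (hg : SmoothNear g (f x)) (hf : SmoothNear f x) : SmoothNear (g ∘ f) x := by
  filter_upwards [hf, hf.continuousAt.eventually hg] with y h1 h2
  exact h2.comp y h1

theorem SmoothNear.congr {M N : SmoothMfd.{u}} {f g : M → N} {x : M}
    (hf : SmoothNear f x) (h : g =ᶠ[𝓝 x] f) : SmoothNear g x := by
  filter_upwards [hf, h.eventually_nhds] with y h1 h2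
  exact h1.congr_of_eventuallyEq h2

/-- An open subset of a manifold is a manifold. -/
def ofOpens {M : SmoothMfd.{u}} (U : TopologicalSpace.Opens M) : SmoothMfd.{u} where
  carrier := U
  dim := M.dim

/-- The inclusion of an open subset. -/
def inclusion {M : SmoothMfd.{u}} (U : TopologicalSpace.Opens M) : ofOpens U → M :=
  fun x : U => x.1

theorem isSmooth_comp_inclusion_iff {M N : SmoothMfd.{u}} (U : TopologicalSpace.Opens M)
    (f : M → N) : IsSmooth (f ∘ inclusion U) ↔
      ∀ x ∈ U, ContMDiffAt (𝓡 M.dim) (𝓡 N.dim) ∞ f x :=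
  ⟨fun h x hx => (contMDiffAt_subtype_iff (I := 𝓡 M.dim) (I' := 𝓡 N.dim) (U := U)).1 (h ⟨x, hx⟩),
    fun h x => (contMDiffAt_subtype_iff (I := 𝓡 M.dim) (I' := 𝓡 N.dim) (U := U)).2 (h x.1 x.2)⟩

/-- A submersion has a smooth local section through every point of the source. -/
theorem IsSubmersion.exists_section {M N : SmoothMfd.{u}} {f : M → N} (hf : IsSubmersion f)
    (x : M) : ∃ s : N → M, SmoothNear s (f x) ∧ ∀ᶠ y in 𝓝 (f x), f (s y) = y := by
  have h := hf.isSubmersionAt x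
  set φ := h.domChart
  set ψ := h.codChart
  let e := h.equiv
  -- In the charts `f` is the projection to the first factor. Freezing the fibre coordinate at that
  -- of `x` gives a section through `x`, which therefore stays in the chart near `f x`.
  let v := (e (φ x)).2
  let t : N → EuclideanSpace ℝ (Fin M.dim) := fun y => e.symm ((ψ y, v) : _ × _)
  have hxφ : x ∈ φ.source := h.mem_domChart_source
  have hxψ : f x ∈ ψ.source := h.mem_codChart_source
  have hw : ∀ z ∈ φ.target, ψ (f (φ.symm z)) = (e z).1 := fun z hz => by
    have hz' : z ∈ (φ.extend (𝓡 M.dim)).target := by simpa using hz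
    simpa using h.writtenInCharts hz'
  have ht : ∀ y ∈ ψ.source, ContMDiffAt (𝓡 N.dim) 𝓘(ℝ, EuclideanSpace ℝ (Fin M.dim)) ∞ t y := by
    intro y hy
    have h1 : ContMDiffAt (𝓡 N.dim) 𝓘(ℝ, EuclideanSpace ℝ (Fin N.dim)) ∞ ψ y :=
      (contMDiffOn_of_mem_maximalAtlas h.codChart_mem_maximalAtlas).contMDiffAt
        (ψ.open_source.mem_nhds hy)
    have h2 : ContDiff ℝ ∞ fun w : EuclideanSpace ℝ (Fin N.dim) => e.symm (w, v) :=
      e.symm.contDiff.comp (contDiff_id.prodMk contDiff_const)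
    exact (h2.contMDiff.contMDiffAt (x := ψ y)).comp y h1
  have htx : t (f x) = φ x := by
    have h1 := hw (φ x) (φ.map_source hxφ)
    rw [φ.left_inv hxφ] at h1
    change e.symm (ψ (f x), (e (φ x)).2) = φ x
    rw [h1]
    exact e.symm_apply_apply _
  have htc : ∀ᶠ y in 𝓝 (f x), t y ∈ φ.target := by
    have := (ht _ hxψ).continuousAt
    refine this.eventually (φ.open_target.mem_nhds ?_)
    rw [htx]
    exact φ.map_source hxφ
  refine ⟨fun y => φ.symm (t y), ?_, ?_⟩
  · filter_upwards [htc, ψ.open_source.mem_nhds hxψ] with y h1 h2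
    exact ((contMDiffOn_symm_of_mem_maximalAtlas h.domChart_mem_maximalAtlas).contMDiffAt
      (φ.open_target.mem_nhds h1)).comp y (ht y h2)
  · filter_upwards [htc, ψ.open_source.mem_nhds hxψ] with y h1 h2
    have h3 := hw _ h1
    have h4 : f (φ.symm (t y)) ∈ ψ.source :=
      h.source_subset_preimage_source (φ.map_target h1)
    refine ψ.injOn h4 h2 (h3.trans ?_)
    change (e (e.symm (ψ y, v))).1 = _
    rw [e.apply_symm_apply]

end SmoothMfd

open SmoothMfd

/-- The universal property of the manifold structure is tested on all manifolds, in particular on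
open submanifolds, so it localises. -/
theorem ManifoldStructure.smoothNear {S : Type u} {plot : ∀ T : SmoothMfd.{u}, (T → S) → Prop}
    (R : ManifoldStructure S plot) {T : SmoothMfd.{u}} {φ : T → S} {t₀ : T}
    (h : ∃ U : TopologicalSpace.Opens T, t₀ ∈ U ∧ plot (ofOpens U) (φ ∘ inclusion U)) :
    SmoothNear (R.equiv.symm ∘ φ) t₀ := by
  obtain ⟨U, ht₀, hplot⟩ := h
  have h1 : IsSmooth ((R.equiv.symm ∘ φ) ∘ inclusion U) := by
    refine (R.isSmooth_iff _ _).2 ?_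
    convert! hplot using 1
    funext t
    exact R.equiv.apply_symm_apply _
  exact eventually_of_mem (U.2.mem_nhds ht₀) ((isSmooth_comp_inclusion_iff U _).1 h1)

/-- A surjective submersion onto `S` has lifts of functions to `S` that are smooth near a point at
which the function is smooth. -/
theorem IsSurjectiveSubmersionOnto.exists_lift {M T : SmoothMfd.{u}} {S : Type u}
    {plot : ∀ T : SmoothMfd.{u}, (T → S) → Prop} {p : M → S}
    (h : IsSurjectiveSubmersionOnto plot p) (φ : T → S) (t₀ : T) :
    ∃ σ : T → M, (∀ t, p (σ t) = φ t) ∧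
      ((∃ U : TopologicalSpace.Opens T, t₀ ∈ U ∧ plot (ofOpens U) (φ ∘ inclusion U)) →
        SmoothNear σ t₀) := by
  classical
  obtain ⟨R, hsurj, hsub⟩ := h
  -- An arbitrary set-theoretic lift: it answers the case where `φ` is not smooth near `t₀`, selects
  -- the point of the fibre over `φ t₀` through which the local section passes, and fills in where
  -- that section fails to lift. The resulting lift is thus defined everywhere, though smooth only
  -- near `t₀`.
  choose a ha using fun t => hsurj (φ t)
  by_cases hU : ∃ U : TopologicalSpace.Opens T, t₀ ∈ U ∧ plot (ofOpens U) (φ ∘ inclusion U)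
  swap
  · exact ⟨a, ha, fun h => absurd h hU⟩
  let ψ : T → R.mfd := R.equiv.symm ∘ φ
  have hψ : SmoothNear ψ t₀ := R.smoothNear hU
  obtain ⟨s, hs, hs'⟩ := hsub.exists_section (a t₀)
  have hat : (R.equiv.symm ∘ p) (a t₀) = ψ t₀ := congrArg R.equiv.symm (ha t₀)
  rw [hat] at hs hs'
  have hev : ∀ᶠ t in 𝓝 t₀, p (s (ψ t)) = φ t :=
    (hψ.continuousAt.eventually hs').mono fun t ht => R.equiv.symm.injective ht
  refine ⟨fun t => if p (s (ψ t)) = φ t then s (ψ t) else a t, fun t => ?_, fun _ => ?_⟩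
  · dsimp only
    split_ifs with h1
    exacts [h1, ha t]
  · exact (hs.comp hψ).congr (hev.mono fun t ht => if_pos ht)

/-- The inverse of a diffeomorphism onto `S` provides unique smooth lifts. -/
theorem IsDiffeomorphismOnto.exists_lift {M T : SmoothMfd.{u}} {S : Type u}
    {plot : ∀ T : SmoothMfd.{u}, (T → S) → Prop} {p : M → S}
    (h : IsDiffeomorphismOnto plot p) (φ : T → S) (t₀ : T) :
    ∃ σ : T → M, (∀ t, p (σ t) = φ t) ∧
      ((∃ U : TopologicalSpace.Opens T, t₀ ∈ U ∧ plot (ofOpens U) (φ ∘ inclusion U)) →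
        SmoothNear σ t₀) := by
  obtain ⟨R, Φ, hΦ⟩ := h
  refine ⟨fun t => Φ.symm (R.equiv.symm (φ t)), fun t => ?_, ?_⟩
  · rw [← hΦ, Φ.apply_symm_apply, R.equiv.apply_symm_apply]
  · intro hU
    have hs : IsSmooth (M := R.mfd) (N := M) Φ.symm := Φ.symm.contMDiff
    exact (hs.smoothNear _).comp (R.smoothNear hU)

theorem IsDiffeomorphismOnto.injective {M : SmoothMfd.{u}} {S : Type u}
    {plot : ∀ T : SmoothMfd.{u}, (T → S) → Prop} {p : M → S}
    (h : IsDiffeomorphismOnto plot p) : Function.Injective p := by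
  obtain ⟨R, Φ, hΦ⟩ := h
  intro x y hxy
  rw [← hΦ, ← hΦ] at hxy
  exact Φ.injective (R.equiv.injective hxy)

end Smoothness
end

noncomputable section
-- Hypercovers lift simplices against boundaries, locally smoothly.
section Lifting
open CategoryTheory Simplicial Opposite Filter
open scoped Manifold ContDiff Topology

namespace SimplicialMfd
open SmoothMfd

variable {X Y : SimplicialMfd.{u}}

theorem simplexMap_injective {m : ℕ} : Function.Injective (simplexMap X (m := m)) :=
  (SSet.yonedaEquiv (X := toSSet X)).symm.injective

theorem map_comp_simplexMap {m r : ℕ} (θ : ⦋r⦌ ⟶ ⦋m⦌) (x : X _⦋m⦌) :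
    SSet.stdSimplex.map θ ≫ simplexMap X x = simplexMap X (Hom.fn (X.map θ.op) x) := by
  refine (SSet.yonedaEquiv (X := toSSet X)).injective ?_
  rw [SSet.yonedaEquiv_comp]
  refine Eq.trans ?_ (Equiv.apply_symm_apply (SSet.yonedaEquiv (X := toSSet X)) _).symm
  rw [SSet.yonedaEquiv_map]
  rfl

theorem δ_comp_simplexMap {m : ℕ} (i : Fin (m + 2)) (x : X _⦋m + 1⦌) :
    SSet.stdSimplex.δ i ≫ simplexMap X x = simplexMap X (Hom.fn (X.δ i) x) :=
  map_comp_simplexMap (SimplexCategory.δ i) x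

theorem simplexMap_comp_mapSSet (f : X ⟶ Y) {m : ℕ} (x : X _⦋m⦌) :
    simplexMap X x ≫ mapSSet f = simplexMap Y (Hom.fn (f.app (op ⦋m⦌)) x) :=
  SSet.yonedaEquiv_symm_comp (X := toSSet X) (Y := toSSet Y) x (mapSSet f)

theorem naturality_apply (f : X ⟶ Y) {a b : SimplexCategoryᵒᵖ} (θ : a ⟶ b) (x : X.obj a) :
    Hom.fn (f.app b) (Hom.fn (X.map θ) x) = Hom.fn (Y.map θ) (Hom.fn (f.app a) x) :=
  congrArg (fun g => Hom.fn g x) (f.naturality θ)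

theorem δ_naturality_apply (f : X ⟶ Y) {m : ℕ} (i : Fin (m + 2)) (x : X _⦋m + 1⦌) :
    Hom.fn (f.app (op ⦋m⦌)) (Hom.fn (X.δ i) x) = Hom.fn (Y.δ i) (Hom.fn (f.app (op ⦋m + 1⦌)) x) :=
  naturality_apply f _ x

theorem δ_comp_δ_apply {m : ℕ} {i j : Fin (m + 2)} (h : i ≤ j) (x : X _⦋m + 2⦌) :
    Hom.fn (X.δ i) (Hom.fn (X.δ j.succ) x) = Hom.fn (X.δ j) (Hom.fn (X.δ i.castSucc) x) :=
  congrArg (fun g => Hom.fn g x) (X.δ_comp_δ h)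

/-- The simplicial identities that hold between the faces of a simplex. -/
def FacesCompatible (X : SimplicialMfd.{u}) (m : ℕ) (x : Fin (m + 2) → X _⦋m⦌) : Prop :=
  match m, x with
  | 0, _ => True
  | m + 1, x => ∀ i j : Fin (m + 2), i ≤ j →
      Hom.fn (X.δ i) (x j.succ) = Hom.fn (X.δ j) (x i.castSucc)

theorem FacesCompatible.exists_boundary {m : ℕ} {x : Fin (m + 2) → X _⦋m⦌}
    (hx : FacesCompatible X m x) :
    ∃ φ : (∂Δ[m + 1] : SSet.{u}) ⟶ toSSet X,
      ∀ j, SSet.boundary.ι j ≫ φ = simplexMap X (x j) := by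
  rcases m with _ | m
  · exact SSet.boundary.exists_desc_one _
  · refine SSet.boundary.exists_desc _ fun i j hij => ?_
    rw [δ_comp_simplexMap, δ_comp_simplexMap]
    obtain ⟨j, rfl⟩ := Fin.exists_succ_eq.2 (Fin.ne_zero_of_lt hij)
    obtain ⟨i, rfl⟩ := Fin.exists_castSucc_eq.2 (Fin.ne_last_of_lt hij)
    rw [Fin.pred_succ, Fin.castPred_castSucc,
      ← hx i j (Fin.le_def.2 (Nat.lt_succ_iff.1 (Fin.lt_def.1 hij)))]

/-- Every simplex of the boundary is an iterated operator applied to a face, so evaluation at it is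
a structure map of `X` after some `x i`. -/
theorem homPlot_boundary {T : SmoothMfd.{u}} {m : ℕ} {x : Fin (m + 2) → T → X _⦋m⦌}
    {φ : T → ((∂Δ[m + 1] : SSet.{u}) ⟶ toSSet X)}
    (hφ : ∀ t j, SSet.boundary.ι j ≫ φ t = simplexMap X (x j t))
    (hx : ∀ j, IsSmooth (x j)) : homPlot X ∂Δ[m + 1] T φ := by
  intro r s
  obtain ⟨i, y, rfl⟩ := SSet.boundary.exists_ι_app_eq s
  have h : (fun t => (φ t).app (op ⦋r⦌) ((SSet.boundary.ι i).app (op ⦋r⦌) y)) =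
      Hom.fn (X.map (SSet.stdSimplex.objEquiv y).op) ∘ x i := by
    funext t
    exact congrArg (fun g : (Δ[m] : SSet.{u}) ⟶ toSSet X => g.app (op ⦋r⦌) y) (hφ t i)
  rw [h]
  exact (Hom.smooth _).comp (hx i)

theorem boundary_ι_comp_simplexMap_eq {m : ℕ} {a b : X _⦋m + 1⦌}
    (h : ∀ i : Fin (m + 2), Hom.fn (X.δ i) a = Hom.fn (X.δ i) b) :
    (∂Δ[m + 1] : (Δ[m + 1] : SSet.{u}).Subcomplex).ι ≫ simplexMap X a =
      ∂Δ[m + 1].ι ≫ simplexMap X b := by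
  refine SSet.boundary.hom_ext fun i => ?_
  rw [SSet.boundary.ι_ι_assoc, SSet.boundary.ι_ι_assoc, δ_comp_simplexMap, δ_comp_simplexMap, h]

theorem homOfLE_comp_boundary_ι {m : ℕ} (j : Fin (m + 1)) (x : X _⦋m⦌) :
    SSet.Subcomplex.homOfLE (SSet.horn.le_boundary.{u} m j) ≫ ∂Δ[m].ι ≫ simplexMap X x =
      hornProj X m j x :=
  rfl

theorem δ_eq_of_boundary_ι_comp {m : ℕ} {a : X _⦋m + 1⦌} {φ : (∂Δ[m + 1] : SSet.{u}) ⟶ toSSet X}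
    (h : ∂Δ[m + 1].ι ≫ simplexMap X a = φ) {x : Fin (m + 2) → X _⦋m⦌}
    (hφ : ∀ j, SSet.boundary.ι j ≫ φ = simplexMap X (x j)) (j : Fin (m + 2)) :
    Hom.fn (X.δ j) a = x j := by
  refine simplexMap_injective ?_
  rw [← hφ, ← h, SSet.boundary.ι_ι_assoc, δ_comp_simplexMap]

theorem horn_ι_comp_homOfLE {m : ℕ} (i j : Fin (m + 2)) (hij : j ≠ i) :
    SSet.horn.ι.{u} i j hij ≫ SSet.Subcomplex.homOfLE (SSet.horn.le_boundary (m + 1) i) =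
      SSet.boundary.ι j := by
  rw [← cancel_mono ∂Δ[m + 1].ι, SSet.boundary.ι_ι, Category.assoc, SSet.Subcomplex.homOfLE_ι,
    SSet.horn.ι_ι]

/-- A simplicial map has local lifts when every family of lifting problems against the boundary of
a simplex parametrised by a manifold has a solution which is smooth near a given point, provided
that the data of the lifting problem are. -/
structure HasLocalLifts (f : X ⟶ Y) : Prop where
  zero : ∀ {T : SmoothMfd.{u}} (y : T → Y _⦋0⦌) (t₀ : T), ∃ σ : T → X _⦋0⦌,
    (∀ t, Hom.fn (f.app (op ⦋0⦌)) (σ t) = y t) ∧ (SmoothNear y t₀ → SmoothNear σ t₀)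
  succ : ∀ {T : SmoothMfd.{u}} {m : ℕ} (x : Fin (m + 2) → T → X _⦋m⦌) (y : T → Y _⦋m + 1⦌) (t₀ : T),
    (∀ t, FacesCompatible X m fun i => x i t) →
    (∀ i t, Hom.fn (f.app (op ⦋m⦌)) (x i t) = Hom.fn (Y.δ i) (y t)) →
    ∃ σ : T → X _⦋m + 1⦌, (∀ i t, Hom.fn (X.δ i) (σ t) = x i t) ∧
      (∀ t, Hom.fn (f.app (op ⦋m + 1⦌)) (σ t) = y t) ∧
      ((∀ i, SmoothNear (x i) t₀) → SmoothNear y t₀ → SmoothNear σ t₀)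

/-- Used to compare `S ∘ f^*` with the identity: both come from lifts of `𝟙 Y` through `𝟙 Y`. -/
theorem hasLocalLifts_id (Y : SimplicialMfd.{u}) : HasLocalLifts (𝟙 Y) where
  zero y _ := ⟨y, fun _ => rfl, id⟩
  succ _ y _ _ hxy := ⟨y, fun i t => (hxy i t).symm, fun _ => rfl, fun _ h => h⟩

namespace IsHypercover

variable {n : ℕ} {f : X ⟶ Y}

/-- Above the level of the hypercover, simplices are determined by their boundary and image. -/
theorem eq_of_boundary_eq (hf : IsHypercover n f) {m : ℕ} (hm : n ≤ m) {a b : X _⦋m⦌}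
    (h : ∂Δ[m].ι ≫ simplexMap X a = ∂Δ[m].ι ≫ simplexMap X b)
    (hab : Hom.fn (f.app (op ⦋m⦌)) a = Hom.fn (f.app (op ⦋m⦌)) b) : a = b := by
  obtain rfl | hm := hm.eq_or_lt
  · exact hf.diffeomorphism.injective (Subtype.ext (Prod.ext h hab))
  -- Above level `n` a simplex is already determined by any of its horns, and the boundary contains
  -- the horn.
  · refine (hf.source.strictKan m hm 0).injective ?_
    rw [← homOfLE_comp_boundary_ι, ← homOfLE_comp_boundary_ι, h]

theorem exists_relMatching_lift (hf : IsHypercover n f) {m : ℕ} (hm : m ≤ n) {T : SmoothMfd.{u}}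
    (φ : T → RelMatching f m) (t₀ : T) :
    ∃ σ : T → X _⦋m⦌, (∀ t, relMatchingMap f m (σ t) = φ t) ∧
      ((∃ U : TopologicalSpace.Opens T, t₀ ∈ U ∧
        relMatchingPlot f m (ofOpens U) (φ ∘ inclusion U)) → SmoothNear σ t₀) := by
  obtain rfl | hm := hm.eq_or_lt
  · exact hf.diffeomorphism.exists_lift φ t₀
  · exact (hf.submersion m hm).exists_lift φ t₀

theorem hasLocalLifts (hf : IsHypercover n f) : HasLocalLifts f where
  zero {T} y t₀ := by
    -- The boundary of a point is empty, so `y` is the only datum.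
    let φ : T → RelMatching f 0 := fun t =>
      ⟨(SSet.Subcomplex.homOfLE SSet.boundary_zero.le ≫ SSet.Subcomplex.isInitialBot.to _, y t), SSet.boundary.hom_ext₀⟩
    obtain ⟨σ, h1, h2⟩ := hf.exists_relMatching_lift (Nat.zero_le n) φ t₀
    refine ⟨σ, fun t => congrArg (fun z => z.1.2) (h1 t), fun hy => h2 ?_⟩
    obtain ⟨U, hU, hUo, hU'⟩ := eventually_nhds_iff.1 hy
    refine ⟨⟨U, hUo⟩, hU', fun r s => ?_, ?_⟩
    · exact absurd s.2 (by simp)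
    · exact (isSmooth_comp_inclusion_iff _ y).2 hU
  succ {T m} x y t₀ hx hxy := by
    choose φ hφ using fun t => (hx t).exists_boundary
    have hsmooth : (∀ i, SmoothNear (x i) t₀) → SmoothNear y t₀ →
        ∃ U : TopologicalSpace.Opens T, t₀ ∈ U ∧
          homPlot X ∂Δ[m + 1] (ofOpens U) (φ ∘ inclusion U) ∧ IsSmooth (y ∘ inclusion U) := by
      intro h h'
      obtain ⟨U, hU, hUo, hU'⟩ := eventually_nhds_iff.1 ((eventually_all.2 h).and h')
      refine ⟨⟨U, hUo⟩, hU', homPlot_boundary (fun t j => hφ _ j) fun j => ?_, ?_⟩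
      · exact (isSmooth_comp_inclusion_iff ⟨U, hUo⟩ (x j)).2 fun t ht => (hU t ht).1 j
      · exact (isSmooth_comp_inclusion_iff ⟨U, hUo⟩ y).2 fun t ht => (hU t ht).2
    obtain hm | hm := le_or_gt (m + 1) n
    · let φ' : T → RelMatching f (m + 1) := fun t =>
        ⟨(φ t, y t), by
          refine SSet.boundary.hom_ext fun i => ?_
          rw [← Category.assoc, hφ, simplexMap_comp_mapSSet, hxy, SSet.boundary.ι_ι_assoc,
            δ_comp_simplexMap]⟩
      obtain ⟨σ, h1, h2⟩ := hf.exists_relMatching_lift hm φ' t₀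
      refine ⟨σ, fun i t => δ_eq_of_boundary_ι_comp (congrArg (fun z => z.1.1) (h1 t)) (hφ t) i,
        fun t => congrArg (fun z => z.1.2) (h1 t), fun hxs hys => h2 (hsmooth hxs hys)⟩
    -- Above level `n`, fill the horn that omits the face `0`. The filler lies over `y` since its
    -- image and `y` fill the same horn in `Y`. Its face `0` and `x 0` have the same boundary and
    -- the same image, and `n ≤ m`, so they agree.
    · obtain ⟨σ, h1, h2⟩ := (hf.source.strictKan (m + 1) hm 0).exists_lift
        (fun t => SSet.Subcomplex.homOfLE (SSet.horn.le_boundary (m + 1) 0) ≫ φ t) t₀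
      have hface : ∀ (j : Fin (m + 2)), j ≠ 0 → ∀ t, Hom.fn (X.δ j) (σ t) = x j t := by
        intro j hj t
        refine simplexMap_injective ?_
        rw [← hφ, ← horn_ι_comp_homOfLE 0 j hj, Category.assoc, ← h1 t, hornProj,
          SSet.horn.ι_ι_assoc, δ_comp_simplexMap]
      have hfσ : ∀ t, Hom.fn (f.app (op ⦋m + 1⦌)) (σ t) = y t := by
        intro t
        refine (hf.target.strictKan (m + 1) hm 0).injective ?_
        refine SSet.horn.hom_ext' fun j hj => ?_
        rw [hornProj, hornProj, SSet.horn.ι_ι_assoc, SSet.horn.ι_ι_assoc, δ_comp_simplexMap,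
          δ_comp_simplexMap, ← δ_naturality_apply, hface j hj, hxy]
      refine ⟨σ, fun j t => ?_, hfσ, fun hxs hys => h2 ?_⟩
      · obtain rfl | hj := eq_or_ne j 0
        · refine hf.eq_of_boundary_eq (Nat.lt_succ_iff.1 hm) ?_ ?_
          · rcases m with _ | m
            · exact SSet.boundary.hom_ext₀
            · refine boundary_ι_comp_simplexMap_eq fun i => ?_
              -- `d_i d_0 σ = d_0 d_{i+1} σ` reduces the boundary of the omitted face to faces
              -- already known.
              have h3 := δ_comp_δ_apply (X := X) (Fin.zero_le i) (σ t)
              rw [Fin.castSucc_zero] at h3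
              rw [← h3, hface _ (Fin.succ_ne_zero i)]
              exact hx t 0 i (Fin.zero_le i)
          · rw [δ_naturality_apply, hfσ, hxy]
        · exact hface j hj t
      · obtain ⟨U, h3, h4, -⟩ := hsmooth hxs hys
        exact ⟨U, h3, fun r s => h4 r _⟩

end IsHypercover
end SimplicialMfd
end Lifting
end

noncomputable section

/-! ### Cancellation in double alternating sums. -/

section AlternatingSums

/-- The term at `(i, j)` with `i < j` cancels against the term at `(j - 1, i)`, whose sign is
opposite. -/
theorem sum_sum_alternating_eq_zero {A : Type*} [AddCommGroup A] {n : ℕ}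
    (G : Fin (n + 1) → Fin (n + 2) → A)
    (h : ∀ i j : Fin (n + 1), i ≤ j → G i j.succ = G j i.castSucc) :
    ∑ i : Fin (n + 1), ∑ j : Fin (n + 2), (-1 : ℤ) ^ (i : ℕ) • (-1 : ℤ) ^ (j : ℕ) • G i j = 0 := by
  rw [← Finset.sum_product', Finset.univ_product_univ]
  let S : Finset (Fin (n + 1) × Fin (n + 2)) := {ij | ij.1.castSucc < ij.2}
  rw [← Finset.sum_add_sum_compl S, ← eq_neg_iff_add_eq_zero, ← Finset.sum_neg_distrib]
  have hS : ∀ x, x ∈ S ↔ x.1.castSucc < x.2 := fun x => by simp [S]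
  refine Finset.sum_bij' (fun x hx => (x.2.pred (Fin.ne_zero_of_lt ((hS x).1 hx)), x.1.castSucc))
    (fun x hx => (x.2.castLT ?_, x.1.succ)) ?_ ?_ ?_ ?_ ?_
  · rw [Finset.mem_compl, hS, not_lt, Fin.le_def, Fin.val_castSucc] at hx
    exact hx.trans_lt x.1.2
  · rintro ⟨i, j⟩ hx
    rw [hS, Fin.lt_def, Fin.val_castSucc] at hx
    rw [Finset.mem_compl, hS, not_lt, Fin.le_def]
    simp only [Fin.val_castSucc, Fin.val_pred] at *
    lia
  · rintro ⟨i, j⟩ hx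
    rw [Finset.mem_compl, hS, not_lt, Fin.le_def, Fin.val_castSucc] at hx
    rw [hS, Fin.lt_def]
    simp only [Fin.val_castSucc, Fin.val_succ, Fin.val_castLT] at *
    lia
  · rintro ⟨i, j⟩ hx
    simp
  · rintro ⟨i, j⟩ hx
    simp
  · rintro ⟨i, j⟩ hx
    rw [hS] at hx
    obtain ⟨j, rfl⟩ := Fin.exists_succ_eq.2 (Fin.ne_zero_of_lt hx)
    simp only [Fin.pred_succ, Fin.val_castSucc, Fin.val_succ]
    rw [h i j (Fin.castSucc_lt_succ_iff.1 hx), pow_succ, mul_neg, mul_one, neg_smul, smul_neg,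
      smul_comm]

end AlternatingSums

/-! ### Smooth families of formal combinations of maps, and gluing. -/

section Kernels
open scoped Manifold ContDiff Topology
open Filter

namespace SmoothMfd

variable {T T' M M' : SmoothMfd.{u}} {L L' L'' : Type u}

/-- Needed for the existence of smooth partitions of unity. -/
instance (M : SmoothMfd.{u}) : SigmaCompactSpace M := by
  have : LocallyCompactSpace M := Manifold.locallyCompact_of_finiteDimensional (𝓡 M.dim)
  infer_instance

/-- A real function on a manifold which is smooth on a neighbourhood of a point. -/
def SmoothFunNear (ρ : T → ℝ) (t₀ : T) : Prop :=
  ∀ᶠ t in 𝓝 t₀, ContMDiffAt (𝓡 T.dim) 𝓘(ℝ) ∞ ρ t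

/-- Let `σ` be a family of functions `T → M`, labelled by `L`. A family of formal linear
combinations of labels, parametrised by `T`, is smooth at `t₀` if near `t₀` it is a finite sum
`∑ ρ_j(t) [a_j]`, where both `ρ_j` and the functions labelled by `a_j` are smooth near `t₀`. -/
inductive IsKernelAt (σ : L → T → M) (t₀ : T) : (T → L →₀ ℝ) → Prop
  | zero : IsKernelAt σ t₀ 0
  | add {b b' : T → L →₀ ℝ} (hb : IsKernelAt σ t₀ b) (hb' : IsKernelAt σ t₀ b') :
      IsKernelAt σ t₀ (b + b')
  | single (ρ : T → ℝ) (a : L) (hρ : SmoothFunNear ρ t₀) (ha : SmoothNear (σ a) t₀) :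
      IsKernelAt σ t₀ fun t => Finsupp.single a (ρ t)
  | congr {b b' : T → L →₀ ℝ} (h : b' =ᶠ[𝓝 t₀] b) (hb : IsKernelAt σ t₀ b) : IsKernelAt σ t₀ b'

/-- A smoothly varying locally finite formal linear combination of partially defined smooth maps. -/
def IsKernel (σ : L → T → M) (b : T → L →₀ ℝ) : Prop :=
  ∀ t, IsKernelAt σ t b

variable {σ : L → T → M} {σ' : L' → T' → M'}

namespace IsKernelAt

/-- Makes the locus where `b` is a kernel open, so that such loci can index a partition of unity. -/
theorem eventually {t₀ : T} {b : T → L →₀ ℝ} (hb : IsKernelAt σ t₀ b) :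
    ∀ᶠ t in 𝓝 t₀, IsKernelAt σ t b := by
  induction hb with
  | zero => exact Eventually.of_forall fun _ => zero
  | add _ _ h h' => filter_upwards [h, h'] with t ht ht' using ht.add ht'
  | single ρ a hρ ha =>
    filter_upwards [eventually_eventually_nhds.2 hρ, eventually_eventually_nhds.2 ha] with t h h'
    exact single ρ a h h'
  | congr h _ hb =>
    filter_upwards [eventually_eventually_nhds.2 h, hb] with t h h'
    exact congr h h'

theorem smul {t₀ : T} {b : T → L →₀ ℝ} (hb : IsKernelAt σ t₀ b) {ρ : T → ℝ}
    (hρ : SmoothFunNear ρ t₀) : IsKernelAt σ t₀ fun t => ρ t • b t := by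
  induction hb with
  | zero => exact congr (Eventually.of_forall fun t => smul_zero _) zero
  | add _ _ h h' => exact congr (Eventually.of_forall fun t => smul_add _ _ _) (h.add h')
  | single ρ' a hρ' ha =>
    refine congr (Eventually.of_forall fun t => Finsupp.smul_single _ _ _)
      (single (fun t => ρ t • ρ' t) a ?_ ha)
    filter_upwards [hρ, hρ'] with t h h' using h.smul h'
  | congr h _ hb => exact congr (h.mono fun t ht => congrArg (ρ t • ·) ht) hb

theorem const_smul {t₀ : T} {b : T → L →₀ ℝ} (hb : IsKernelAt σ t₀ b) (r : ℝ) :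
    IsKernelAt σ t₀ (r • b) :=
  hb.smul (ρ := fun _ => r) (Eventually.of_forall fun _ => contMDiffAt_const)

theorem sum {t₀ : T} {ι : Type*} {I : Finset ι} {b : ι → T → L →₀ ℝ}
    (hb : ∀ i ∈ I, IsKernelAt σ t₀ (b i)) : IsKernelAt σ t₀ (∑ i ∈ I, b i) :=
  Finset.sum_induction _ _ (fun _ _ => add) zero hb

end IsKernelAt

/-- Relabelling and pulling back of families of formal linear combinations. -/
def push (Φ : L → L') (u : T' → T) : (T → L →₀ ℝ) →ₗ[ℝ] (T' → L' →₀ ℝ) where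
  toFun b t := Finsupp.mapDomain Φ (b (u t))
  map_add' _ _ := funext fun _ => Finsupp.mapDomain_add
  map_smul' _ _ := funext fun _ => Finsupp.mapDomain_smul _ _

theorem push_apply (Φ : L → L') (u : T' → T) (b : T → L →₀ ℝ) (t : T') :
    push Φ u b t = Finsupp.mapDomain Φ (b (u t)) :=
  rfl

theorem push_push {T'' : SmoothMfd.{u}} (Φ : L → L') (u : T' → T) (Φ' : L' → L'') (u' : T'' → T')
    (b : T → L →₀ ℝ) : push Φ' u' (push Φ u b) = push (Φ' ∘ Φ) (u ∘ u') b :=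
  funext fun _ => Finsupp.mapDomain_comp.symm

/-- A smooth germ is built from labels that are smooth near the point, so `Φ` has to preserve
smoothness of those labels only. -/
theorem IsKernelAt.push {Φ : L → L'} {u : T' → T} {t₀ : T'} (hu : SmoothNear u t₀)
    (hΦ : ∀ a, SmoothNear (σ a) (u t₀) → SmoothNear (σ' (Φ a)) t₀)
    {b : T → L →₀ ℝ} (hb : IsKernelAt σ (u t₀) b) : IsKernelAt σ' t₀ (push Φ u b) := by
  induction hb with
  | zero => exact congr (Eventually.of_forall fun t => Finsupp.mapDomain_zero (f := Φ)) zero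
  | add _ _ h h' => exact congr (Eventually.of_forall fun t => Finsupp.mapDomain_add) (h.add h')
  | single ρ a hρ ha =>
    refine congr (Eventually.of_forall fun t => Finsupp.mapDomain_single)
      (single (ρ ∘ u) (Φ a) ?_ (hΦ a ha))
    filter_upwards [hu, hu.continuousAt.eventually hρ] with t h h' using h'.comp t h
  | congr h _ hb =>
    exact congr ((hu.continuousAt.eventually h).mono fun t ht =>
      congrArg (Finsupp.mapDomain Φ) ht) hb

namespace IsKernel

theorem add {b b' : T → L →₀ ℝ} (hb : IsKernel σ b) (hb' : IsKernel σ b') : IsKernel σ (b + b') :=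
  fun t => (hb t).add (hb' t)

theorem neg {b : T → L →₀ ℝ} (hb : IsKernel σ b) : IsKernel σ (-b) :=
  fun t => neg_one_smul ℝ b ▸ (hb t).const_smul (-1)

theorem sub {b b' : T → L →₀ ℝ} (hb : IsKernel σ b) (hb' : IsKernel σ b') : IsKernel σ (b - b') :=
  sub_eq_add_neg b b' ▸ hb.add hb'.neg

theorem sum {ι : Type*} {I : Finset ι} {b : ι → T → L →₀ ℝ}
    (hb : ∀ i ∈ I, IsKernel σ (b i)) : IsKernel σ (∑ i ∈ I, b i) :=
  fun t => IsKernelAt.sum fun i hi => hb i hi t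

theorem sign_smul {b : T → L →₀ ℝ} (hb : IsKernel σ b) (n : ℕ) : IsKernel σ ((-1 : ℤ) ^ n • b) := by
  rcases neg_one_pow_eq_or ℤ n with h | h
  · rwa [h, one_smul]
  · rw [h, neg_smul, one_smul]
    exact hb.neg

theorem push {Φ : L → L'} {u : T' → T} (hu : IsSmooth u)
    (hΦ : ∀ a t, SmoothNear (σ a) (u t) → SmoothNear (σ' (Φ a)) t)
    {b : T → L →₀ ℝ} (hb : IsKernel σ b) : IsKernel σ' (push Φ u b) :=
  fun t => (hb (u t)).push (hu.smoothNear t) fun a => hΦ a t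

/-- Local kernels can be glued with a partition of unity. -/
theorem exists_glue {b : T → T → L →₀ ℝ} (hb : ∀ t, IsKernelAt σ t (b t)) :
    ∃ c, IsKernel σ c ∧ ∀ t, c t ∈ convexHull ℝ (Set.range fun i => b i t) := by
  -- The points of `T` serve as indices. The `i`-th function is supported where `b i` is a kernel,
  -- and these sets cover because `b t` is a kernel near `t`. The weights being nonnegative with sum
  -- one, the result is a pointwise convex combination, so affine conditions survive gluing.
  obtain ⟨f, hf⟩ := SmoothPartitionOfUnity.exists_isSubordinate (𝓡 T.dim) isClosed_univ
    (fun i : T => interior {t | IsKernelAt σ t (b i)}) (fun _ => isOpen_interior)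
    fun t _ => Set.mem_iUnion_of_mem t (mem_interior_iff_mem_nhds.2 (hb t).eventually)
  refine ⟨fun t => ∑ᶠ i, f i t • b i t, fun t => ?_, fun t =>
    (convex_convexHull ℝ _).finsum_mem (fun i => f.nonneg i t) (f.sum_eq_one (Set.mem_univ t))
      fun i _ => subset_convexHull ℝ _ (Set.mem_range_self i)⟩
  obtain ⟨I, n, hn, hI, hsupp⟩ := f.locallyFinite.exists_finset_nhds_support_subset hf
    (fun _ => isOpen_interior) t
  have hker : IsKernelAt σ t (∑ i ∈ I, fun t => f i t • b i t) := by
    refine IsKernelAt.sum fun i hi => IsKernelAt.smul ?_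
      (Eventually.of_forall fun t => (f i).contMDiff t)
    have h1 := hI (mem_of_mem_nhds hn)
    rw [Set.mem_iInter₂] at h1
    have h2 : t ∈ {t | IsKernelAt σ t (b i)} := interior_subset (h1 i hi)
    exact h2
  refine hker.congr (eventually_of_mem hn fun z hz => ?_)
  rw [Finset.sum_apply]
  refine finsum_eq_sum_of_support_subset _ fun i hi => hsupp z hz fun h => hi ?_
  exact (congrArg (· • b i z) h).trans (zero_smul ℝ _)

end IsKernel
end SmoothMfd
end Kernels
end

noncomputable section
-- Lifts of simplicial operators and their cone contraction.
section Labels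
open CategoryTheory Simplicial Opposite Filter
open scoped Manifold ContDiff Topology

/-- The extension of a monotone map by a new minimal vertex, sent to the minimal vertex. -/
def SimplexCategory.cone {r m : ℕ} (θ : ⦋r⦌ ⟶ ⦋m⦌) : ⦋r + 1⦌ ⟶ ⦋m⦌ :=
  SimplexCategory.mkHom ⟨Fin.cons 0 θ.toOrderHom, by
    intro i j hij
    induction i using Fin.cases with
    | zero => exact Fin.zero_le _
    | succ i =>
      induction j using Fin.cases with
      | zero => exact absurd hij (by simp)
      | succ j => exact θ.toOrderHom.monotone (Fin.succ_le_succ_iff.1 hij)⟩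

theorem SimplexCategory.δ_zero_comp_cone {r m : ℕ} (θ : ⦋r⦌ ⟶ ⦋m⦌) :
    SimplexCategory.δ 0 ≫ SimplexCategory.cone θ = θ := by
  ext i : 3
  rfl

theorem SimplexCategory.δ_succ_comp_cone {r m : ℕ} (θ : ⦋r + 1⦌ ⟶ ⦋m⦌) (i : Fin (r + 2)) :
    SimplexCategory.δ i.succ ≫ SimplexCategory.cone θ =
      SimplexCategory.cone (SimplexCategory.δ i ≫ θ) := by
  ext j : 3
  change (Fin.cons 0 θ.toOrderHom : Fin (r + 3) → Fin (m + 1)) (i.succ.succAbove j) =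
    (Fin.cons 0 (fun j => θ.toOrderHom (i.succAbove j)) : Fin (r + 2) → Fin (m + 1)) j
  induction j using Fin.cases with
  | zero => rw [Fin.succ_succAbove_zero, Fin.cons_zero, Fin.cons_zero]
  | succ j => rw [Fin.succ_succAbove_succ, Fin.cons_succ, Fin.cons_succ]

namespace SimplicialMfd
open SmoothMfd

variable {X Y Z : SimplicialMfd.{u}}

/-- Functions `Z_m → X_r` that lift an operator `Y_m → Y_r`. -/
@[ext]
structure Label (f : X ⟶ Y) (g : Z ⟶ Y) (r m : ℕ) : Type u where
  mor : ⦋r⦌ ⟶ ⦋m⦌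
  fn : Z _⦋m⦌ → X _⦋r⦌
  lift : ∀ z, Hom.fn (f.app (op ⦋r⦌)) (fn z) = Hom.fn (Y.map mor.op) (Hom.fn (g.app (op ⦋m⦌)) z)

namespace Label

variable {f : X ⟶ Y} {g : Z ⟶ Y} {r m : ℕ}

/-- The faces of a label. -/
def face (i : Fin (r + 2)) (a : Label f g (r + 1) m) : Label f g r m where
  mor := SimplexCategory.δ i ≫ a.mor
  fn z := Hom.fn (X.δ i) (a.fn z)
  lift z := by
    rw [δ_naturality_apply, a.lift, op_comp, Y.map_comp]
    rfl

/-- Pullback of labels along the face maps of the parameter space. -/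
def coface (i : Fin (m + 2)) (a : Label f g r m) : Label f g r (m + 1) where
  mor := a.mor ≫ SimplexCategory.δ i
  fn z := a.fn (Hom.fn (Z.δ i) z)
  lift z := by
    rw [a.lift, δ_naturality_apply, op_comp, Y.map_comp]
    rfl

theorem face_face {i j : Fin (r + 2)} (h : i ≤ j) (a : Label f g (r + 2) m) :
    face i (face j.succ a) = face j (face i.castSucc a) := by
  refine Label.ext ?_ (funext fun z => δ_comp_δ_apply h _)
  change SimplexCategory.δ i ≫ SimplexCategory.δ j.succ ≫ a.mor =
    SimplexCategory.δ j ≫ SimplexCategory.δ i.castSucc ≫ a.mor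
  rw [← Category.assoc, ← Category.assoc, SimplexCategory.δ_comp_δ h]

theorem coface_coface {i j : Fin (m + 2)} (h : i ≤ j) (a : Label f g r m) :
    coface j.succ (coface i a) = coface i.castSucc (coface j a) := by
  refine Label.ext ?_ (funext fun z => congrArg a.fn (δ_comp_δ_apply h _))
  change (a.mor ≫ SimplexCategory.δ i) ≫ SimplexCategory.δ j.succ =
    (a.mor ≫ SimplexCategory.δ j) ≫ SimplexCategory.δ i.castSucc
  rw [Category.assoc, Category.assoc, SimplexCategory.δ_comp_δ h]

/-- A cone operation in one degree, with local smoothness at a point. -/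
structure IsCone (z₀ : Z _⦋m⦌) (c : Label f g r m → Label f g (r + 1) m) : Prop where
  mor_eq : ∀ a, (c a).mor = SimplexCategory.cone a.mor
  face_zero : ∀ a, face 0 (c a) = a
  face_succ : ∀ (a : Label f g (r + 1) m) (i j : Fin (r + 1)), i ≤ j →
    face i.succ (c (face j.succ a)) = face j.succ (c (face i.castSucc a))
  smoothNear : ∀ a, SmoothNear a.fn z₀ → SmoothNear (c a).fn z₀

/-- The cone over `a` must have faces `a, c (d_0 a), c (d_1 a), …`. The fields `face_zero` and
`face_succ` say precisely that these match along their common faces, so `hf.succ` fills them.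
Stating `face_succ` without the cone operation one degree lower lets degree `0` be treated alike. -/
theorem IsCone.exists_succ (hf : HasLocalLifts f) {z₀ : Z _⦋m⦌}
    {c : Label f g r m → Label f g (r + 1) m} (hc : IsCone z₀ c) :
    ∃ c' : Label f g (r + 1) m → Label f g (r + 2) m, IsCone z₀ c' ∧
      ∀ a i, face i.succ (c' a) = c (face i a) := by
  have key : ∀ a : Label f g (r + 1) m, ∃ a' : Label f g (r + 2) m,
      a'.mor = SimplexCategory.cone a.mor ∧ face 0 a' = a ∧
      (∀ i, face i.succ a' = c (face i a)) ∧ (SmoothNear a.fn z₀ → SmoothNear a'.fn z₀) := by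
    intro a
    let y : Z _⦋m⦌ → Y _⦋r + 2⦌ := fun z =>
      Hom.fn (Y.map (SimplexCategory.cone a.mor).op) (Hom.fn (g.app (op ⦋m⦌)) z)
    -- The base of the lifting problem is smooth everywhere, so smoothness of the filler depends
    -- only on its faces.
    have hy : SmoothNear y z₀ :=
      IsSmooth.smoothNear ((Hom.smooth _).comp (Hom.smooth _)) z₀
    let x : Fin (r + 3) → Label f g (r + 1) m := Fin.cons a fun i => c (face i a)
    have hmor : ∀ i, SimplexCategory.δ i ≫ SimplexCategory.cone a.mor = (x i).mor := by
      intro i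
      induction i using Fin.cases with
      | zero => exact SimplexCategory.δ_zero_comp_cone _
      | succ i => exact (SimplexCategory.δ_succ_comp_cone _ _).trans (hc.mor_eq (face i a)).symm
    have hx : ∀ i j : Fin (r + 2), i ≤ j → face i (x j.succ) = face j (x i.castSucc) := by
      intro i j hij
      induction i using Fin.cases with
      | zero => exact hc.face_zero _
      | succ i =>
        induction j using Fin.cases with
        | zero => exact absurd hij (by simp)
        | succ j => exact hc.face_succ a i j (Fin.succ_le_succ_iff.1 hij)
    obtain ⟨σ, h1, h2, h3⟩ := hf.succ (fun i => (x i).fn) y z₀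
      (fun t i j hij => congrFun (congrArg Label.fn (hx i j hij)) t)
      (fun i z => by rw [(x i).lift, ← hmor, op_comp, Y.map_comp]; rfl)
    have h4 : ∀ i, face i ⟨SimplexCategory.cone a.mor, σ, h2⟩ = x i := fun i =>
      Label.ext (hmor i) (funext fun z => h1 i z)
    refine ⟨⟨SimplexCategory.cone a.mor, σ, h2⟩, rfl, h4 0, fun i => h4 i.succ, fun ha => ?_⟩
    refine h3 (fun i => ?_) hy
    induction i using Fin.cases with
    | zero => exact ha
    | succ i => exact hc.smoothNear _ (IsSmooth.smoothNear (Hom.smooth (X.δ i)) _ |>.comp ha)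
  choose c' h1 h2 h3 h4 using key
  refine ⟨c', ⟨h1, h2, fun a i j hij => ?_, h4⟩, h3⟩
  rw [h3, h3, face_face hij]

/-- Labels admit a cone operation to a vertex, which preserves smoothness near a given point. -/
theorem exists_cone (hf : HasLocalLifts f) (z₀ : Z _⦋m⦌) :
    ∃ (v : Label f g 0 m) (c : ∀ r, Label f g r m → Label f g (r + 1) m),
      SmoothNear v.fn z₀ ∧ (∀ r a, SmoothNear a.fn z₀ → SmoothNear (c r a).fn z₀) ∧
      (∀ r a, face 0 (c r a) = a) ∧ (∀ a, face 1 (c 0 a) = v) ∧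
      ∀ r a i, face i.succ (c (r + 1) a) = c r (face i a) := by
  -- The apex must lie over vertex `0`, the vertex that `SimplexCategory.cone` adjoins.
  let θ₀ : ⦋0⦌ ⟶ ⦋m⦌ := SimplexCategory.const ⦋0⦌ ⦋m⦌ 0
  have hy : ∀ {r : ℕ} (θ : ⦋r⦌ ⟶ ⦋m⦌), SmoothNear (fun z =>
      Hom.fn (Y.map θ.op) (Hom.fn (g.app (op ⦋m⦌)) z)) z₀ := fun θ =>
    IsSmooth.smoothNear ((Hom.smooth _).comp (Hom.smooth _)) z₀
  obtain ⟨σ, hσ, hσ'⟩ := hf.zero (fun z =>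
    Hom.fn (Y.map θ₀.op) (Hom.fn (g.app (op ⦋m⦌)) z)) z₀
  let v : Label f g 0 m := ⟨θ₀, σ, hσ⟩
  have hv : SmoothNear v.fn z₀ := hσ' (hy θ₀)
  have key : ∀ a : Label f g 0 m, ∃ a' : Label f g 1 m,
      a'.mor = SimplexCategory.cone a.mor ∧ face 0 a' = a ∧ face 1 a' = v ∧
        (SmoothNear a.fn z₀ → SmoothNear a'.fn z₀) := by
    intro a
    let x : Fin 2 → Label f g 0 m := ![a, v]
    have hmor : ∀ i, SimplexCategory.δ i ≫ SimplexCategory.cone a.mor = (x i).mor := by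
      intro i
      fin_cases i
      · exact SimplexCategory.δ_zero_comp_cone _
      · ext j : 3
        fin_cases j
        rfl
    obtain ⟨σ, h1, h2, h3⟩ := hf.succ (fun i => (x i).fn) (fun z =>
      Hom.fn (Y.map (SimplexCategory.cone a.mor).op) (Hom.fn (g.app (op ⦋m⦌)) z)) z₀
      (fun t => trivial)
      (fun i z => by rw [(x i).lift, ← hmor, op_comp, Y.map_comp]; rfl)
    have h4 : ∀ i, face i ⟨SimplexCategory.cone a.mor, σ, h2⟩ = x i := fun i =>
      Label.ext (hmor i) (funext fun z => h1 i z)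
    refine ⟨⟨SimplexCategory.cone a.mor, σ, h2⟩, rfl, h4 0, h4 1, fun ha => ?_⟩
    refine h3 (fun i => ?_) (hy _)
    fin_cases i
    exacts [ha, hv]
  choose c₀ h1 h2 h3 h4 using key
  have hc₀ : IsCone z₀ c₀ := ⟨h1, h2, fun a i j _ => by
    obtain rfl : i = 0 := Fin.ext (by lia)
    obtain rfl : j = 0 := Fin.ext (by lia)
    exact (h3 _).trans (h3 _).symm, h4⟩
  -- Each cone operation is chosen to extend the previous one, so the recursion carries the proof of
  -- `IsCone` along.
  let c : ∀ r, {c : Label f g r m → Label f g (r + 1) m // IsCone z₀ c} := fun r =>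
    Nat.rec ⟨c₀, hc₀⟩ (fun _ c => ⟨(c.2.exists_succ hf).choose, (c.2.exists_succ hf).choose_spec.1⟩) r
  exact ⟨v, fun r => (c r).1, hv, fun r => (c r).2.smoothNear, fun r => (c r).2.face_zero, h3,
    fun r => ((c r).2.exists_succ hf).choose_spec.2⟩

end Label
end SimplicialMfd
end Labels
end

noncomputable section
-- Dependent choice: `P` records what makes the next step solvable, `R` the relation between
-- consecutive terms.
theorem exists_seq_of_step {A : ℕ → Type*} (P : ∀ m, A m → Prop) (R : ∀ m, A m → A (m + 1) → Prop)
    (a₀ : A 0) (h₀ : P 0 a₀) (step : ∀ m a, P m a → ∃ a', P (m + 1) a' ∧ R m a a') :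
    ∃ s : ∀ m, A m, s 0 = a₀ ∧ (∀ m, P m (s m)) ∧ ∀ m, R m (s m) (s (m + 1)) := by
  let s : ∀ m, {a : A m // P m a} := fun m => Nat.rec ⟨a₀, h₀⟩
    (fun m a => ⟨(step m a.1 a.2).choose, (step m a.1 a.2).choose_spec.1⟩) m
  exact ⟨fun m => (s m).1, rfl, fun m => (s m).2, fun m =>
    (step m (s m).1 (s m).2).choose_spec.2⟩

/-! ### Acyclic models for smooth chains of lifts. -/

section Chains
open CategoryTheory Simplicial Opposite Filter
open scoped Manifold ContDiff Topology

namespace SimplicialMfd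
open SmoothMfd

variable {X Y Z : SimplicialMfd.{u}}

/-- Families, parametrised by `Z_m`, of formal linear combinations of lifts of dimension `r`. -/
abbrev Chain (f : X ⟶ Y) (g : Z ⟶ Y) (r m : ℕ) : Type u :=
  Z _⦋m⦌ → Label f g r m →₀ ℝ

namespace Chain

variable {f : X ⟶ Y} {g : Z ⟶ Y} {r m : ℕ}

/-- Smooth families of formal linear combinations of lifts. -/
def IsSmooth (b : Chain f g r m) : Prop :=
  IsKernel Label.fn b

/-- The boundary of a formal linear combination of lifts. -/
def formalBoundary (f : X ⟶ Y) (g : Z ⟶ Y) (r m : ℕ) :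
    (Label f g (r + 1) m →₀ ℝ) →ₗ[ℝ] (Label f g r m →₀ ℝ) :=
  ∑ i : Fin (r + 2), (-1 : ℤ) ^ (i : ℕ) • Finsupp.lmapDomain ℝ ℝ (Label.face i)

/-- The sum of the coefficients. -/
def formalAug (f : X ⟶ Y) (g : Z ⟶ Y) (r m : ℕ) : (Label f g r m →₀ ℝ) →ₗ[ℝ] ℝ :=
  Finsupp.linearCombination ℝ fun _ => 1

/-- The alternating sum of the faces. -/
def boundary (b : Chain f g (r + 1) m) : Chain f g r m :=
  ∑ i : Fin (r + 2), (-1 : ℤ) ^ (i : ℕ) • push (Label.face i) id b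

/-- The alternating sum of the pullbacks along the face maps of the parameter space. -/
def coboundary (b : Chain f g r m) : Chain f g r (m + 1) :=
  ∑ i : Fin (m + 2), (-1 : ℤ) ^ (i : ℕ) • push (Label.coface i) (Hom.fn (Z.δ i)) b

theorem boundary_apply (b : Chain f g (r + 1) m) (z : Z _⦋m⦌) :
    boundary b z = formalBoundary f g r m (b z) := by
  simp only [boundary, formalBoundary, Finset.sum_apply, LinearMap.sum_apply]
  rfl

theorem boundary_sub (b b' : Chain f g (r + 1) m) :
    boundary (b - b') = boundary b - boundary b' := by
  funext z
  rw [Pi.sub_apply, boundary_apply, boundary_apply, boundary_apply, Pi.sub_apply, map_sub]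

theorem coboundary_sub (b b' : Chain f g r m) :
    coboundary (b - b') = coboundary b - coboundary b' := by
  simp only [coboundary, map_sub, smul_sub, Finset.sum_sub_distrib]

theorem coboundary_coboundary (b : Chain f g r m) : coboundary (coboundary b) = 0 := by
  simp only [coboundary, map_sum, map_zsmul, Finset.smul_sum]
  rw [Finset.sum_comm]
  simp only [smul_comm ((-1 : ℤ) ^ _) ((-1 : ℤ) ^ _)]
  refine sum_sum_alternating_eq_zero (fun i j => push (Label.coface j) (Hom.fn (Z.δ j))
    (push (Label.coface i) (Hom.fn (Z.δ i)) b)) fun i j h => ?_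
  rw [push_push, push_push]
  have h1 : Label.coface j.succ ∘ Label.coface i =
      Label.coface i.castSucc ∘ (Label.coface j : Label f g r m → _) :=
    funext fun a => Label.coface_coface h a
  have h2 : Hom.fn (Z.δ i) ∘ Hom.fn (Z.δ j.succ) = Hom.fn (Z.δ j) ∘ Hom.fn (Z.δ i.castSucc) :=
    funext fun z => δ_comp_δ_apply h z
  rw [h1, h2]

theorem boundary_coboundary (b : Chain f g (r + 1) m) :
    boundary (coboundary b) = coboundary (boundary b) := by
  simp only [boundary, coboundary, map_sum, map_zsmul, Finset.smul_sum]
  rw [Finset.sum_comm]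
  refine Finset.sum_congr rfl fun j _ => Finset.sum_congr rfl fun i _ => ?_
  rw [smul_comm, push_push, push_push]
  rfl

theorem formalAug_coboundary (b : Chain f g r 0) (z : Z _⦋1⦌) :
    formalAug f g r 1 (coboundary b z) = formalAug f g r 0 (b (Hom.fn (Z.δ 0) z)) -
      formalAug f g r 0 (b (Hom.fn (Z.δ 1) z)) := by
  have h : ∀ i : Fin 2, formalAug f g r 1 (push (Label.coface i) (Hom.fn (Z.δ i)) b z) =
      formalAug f g r 0 (b (Hom.fn (Z.δ i) z)) := fun i =>
    Finsupp.linearCombination_mapDomain ℝ _ _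
  rw [coboundary, Fin.sum_univ_two]
  simp only [Fin.val_zero, pow_zero, one_smul, Fin.val_one, pow_one, neg_smul, Pi.add_apply,
    Pi.neg_apply, map_add, map_neg, h]
  rw [sub_eq_add_neg]

namespace IsSmooth

theorem boundary {b : Chain f g (r + 1) m} (hb : IsSmooth b) : IsSmooth (boundary b) :=
  IsKernel.sum fun i _ => IsKernel.sign_smul (IsKernel.push (σ := Label.fn) (σ' := Label.fn)
    (Hom.smooth (𝟙 (Z _⦋m⦌))) (fun _ _ ha => ((Hom.smooth (X.δ i)).smoothNear _).comp ha) hb) _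

theorem coboundary {b : Chain f g r m} (hb : IsSmooth b) : IsSmooth (coboundary b) :=
  IsKernel.sum fun i _ => IsKernel.sign_smul (IsKernel.push (σ := Label.fn) (σ' := Label.fn)
    (Hom.smooth (Z.δ i)) (fun _ t ha => ha.comp ((Hom.smooth (Z.δ i)).smoothNear t)) hb) _

end IsSmooth

/-- The contracting homotopy at the bottom of the augmented complex: `c` gives primitives of chains
of augmentation zero. -/
theorem formalBoundary_lmapDomain_cone_zero {v : Label f g 0 m}
    {c : Label f g 0 m → Label f g 1 m} (h0 : ∀ a, Label.face 0 (c a) = a)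
    (h1 : ∀ a, Label.face 1 (c a) = v) (x : Label f g 0 m →₀ ℝ) :
    formalBoundary f g 0 m (Finsupp.mapDomain c x) =
      x - formalAug f g 0 m x • Finsupp.single v 1 := by
  induction x using Finsupp.induction_linear with
  | zero => simp
  | add x y hx hy => rw [Finsupp.mapDomain_add, map_add, hx, hy, map_add, add_smul]; abel
  | single a ρ =>
    simp [formalBoundary, formalAug, Fin.sum_univ_two, Finsupp.mapDomain_single, h0, h1,
      sub_eq_add_neg]

/-- The summand `i = 0` of the boundary is the identity; the others are the cone over the boundary
with a shifted sign. On cycles the cone is therefore a primitive. -/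
theorem formalBoundary_lmapDomain_cone_succ {c : Label f g r m → Label f g (r + 1) m}
    {c' : Label f g (r + 1) m → Label f g (r + 2) m} (h0 : ∀ a, Label.face 0 (c' a) = a)
    (h1 : ∀ a i, Label.face i.succ (c' a) = c (Label.face i a)) (x : Label f g (r + 1) m →₀ ℝ) :
    formalBoundary f g (r + 1) m (Finsupp.mapDomain c' x) =
      x - Finsupp.mapDomain c (formalBoundary f g r m x) := by
  have h2 : Finsupp.mapDomain c (formalBoundary f g r m x) = Finsupp.lmapDomain ℝ ℝ c
    (formalBoundary f g r m x) := rfl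
  rw [h2, formalBoundary, formalBoundary, LinearMap.sum_apply, LinearMap.sum_apply,
    Fin.sum_univ_succ, map_sum, sub_eq_add_neg, ← Finset.sum_neg_distrib]
  congr 1
  · rw [Fin.val_zero, pow_zero, one_smul, Finsupp.lmapDomain_apply, ← Finsupp.mapDomain_comp]
    convert! Finsupp.mapDomain_id using 2
    exact funext h0
  · refine Finset.sum_congr rfl fun i _ => ?_
    rw [Fin.val_succ, pow_succ, mul_neg, mul_one, neg_smul, LinearMap.neg_apply,
      LinearMap.smul_apply, LinearMap.smul_apply, map_zsmul, Finsupp.lmapDomain_apply,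
      Finsupp.lmapDomain_apply, Finsupp.lmapDomain_apply, ← Finsupp.mapDomain_comp,
      ← Finsupp.mapDomain_comp]
    congr 3
    exact funext fun a => h1 a i

/-- The solutions of a linear equation at a given `z` form an affine, hence convex, set, so local
solutions glue. -/
theorem exists_glue_of_linear {W : Type*} [AddCommGroup W] [Module ℝ W] {b : Z _⦋m⦌ → Chain f g r m}
    (hb : ∀ z, IsKernelAt Label.fn z (b z)) (ℓ : (Label f g r m →₀ ℝ) →ₗ[ℝ] W) {w : Z _⦋m⦌ → W}
    (hw : ∀ z₀ z, ℓ (b z₀ z) = w z) : ∃ c : Chain f g r m, IsSmooth c ∧ ∀ z, ℓ (c z) = w z := by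
  obtain ⟨c, hc, hc'⟩ := IsKernel.exists_glue hb
  refine ⟨c, hc, fun z => ?_⟩
  have h : convexHull ℝ (Set.range fun i => b i z) ⊆ ℓ ⁻¹' {w z} := by
    refine convexHull_min ?_ ((convex_singleton (w z)).linear_preimage ℓ)
    rintro _ ⟨i, rfl⟩
    exact hw i z
  exact h (hc' z)

theorem exists_formalAug_eq_one (hf : HasLocalLifts f) :
    ∃ c : Chain f g 0 m, IsSmooth c ∧ ∀ z, formalAug f g 0 m (c z) = 1 := by
  choose v _ hv _ using fun z₀ : Z _⦋m⦌ => Label.exists_cone (g := g) hf z₀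
  refine exists_glue_of_linear (b := fun z₀ _ => Finsupp.single (v z₀) 1)
    (fun z₀ => IsKernelAt.single (fun _ => 1) _ (Eventually.of_forall fun _ => contMDiffAt_const)
      (hv z₀)) _ fun z₀ z => ?_
  simp [formalAug]

theorem exists_boundary_eq_zero (hf : HasLocalLifts f) {b : Chain f g 0 m} (hb : IsSmooth b)
    (h : ∀ z, formalAug f g 0 m (b z) = 0) : ∃ c, IsSmooth c ∧ boundary c = b := by
  choose v c _ hc h0 h1 _ using fun z₀ : Z _⦋m⦌ => Label.exists_cone (g := g) hf z₀
  obtain ⟨c, hc, hc'⟩ := exists_glue_of_linear (b := fun z₀ => push (c z₀ 0) id b)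
    (fun z₀ => (hb z₀).push ((Hom.smooth (𝟙 (Z _⦋m⦌))).smoothNear z₀) (hc z₀ 0))
    (formalBoundary f g 0 m) (w := b) fun z₀ z => by
      rw [push_apply, id, formalBoundary_lmapDomain_cone_zero (h0 z₀ 0) (h1 z₀), h, zero_smul,
        sub_zero]
  exact ⟨c, hc, funext fun z => (boundary_apply c z).trans (hc' z)⟩

/-- Near each `z₀` the cone over `b` is a smooth primitive. As its labels are defined everywhere,
the equation holds at every `z`, and gluing applies. -/
theorem exists_boundary_eq_succ (hf : HasLocalLifts f) {b : Chain f g (r + 1) m} (hb : IsSmooth b)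
    (h : boundary b = 0) : ∃ c, IsSmooth c ∧ boundary c = b := by
  choose v c _ hc h0 _ h1 using fun z₀ : Z _⦋m⦌ => Label.exists_cone (g := g) hf z₀
  obtain ⟨c, hc, hc'⟩ := exists_glue_of_linear (b := fun z₀ => push (c z₀ (r + 1)) id b)
    (fun z₀ => (hb z₀).push ((Hom.smooth (𝟙 (Z _⦋m⦌))).smoothNear z₀) (hc z₀ (r + 1)))
    (formalBoundary f g (r + 1) m) (w := b) fun z₀ z => by
      rw [push_apply, id, formalBoundary_lmapDomain_cone_succ (h0 z₀ (r + 1)) (h1 z₀ r),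
        ← boundary_apply, h, Pi.zero_apply, Finsupp.mapDomain_zero, sub_zero]
  exact ⟨c, hc, funext fun z => (boundary_apply c z).trans (hc' z)⟩

/-- There is a chain map of families of lifts which is augmentation preserving. -/
theorem exists_chainMap (hf : HasLocalLifts f) (g : Z ⟶ Y) :
    ∃ S : ∀ m, Chain f g m m, (∀ m, IsSmooth (S m)) ∧ (∀ z, formalAug f g 0 0 (S 0 z) = 1) ∧
      ∀ m, boundary (S (m + 1)) = coboundary (S m) := by
  obtain ⟨s₀, h₀, h₀'⟩ := exists_formalAug_eq_one (g := g) (m := 0) hf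
  obtain ⟨S, hS0, hS, hS'⟩ := exists_seq_of_step (A := fun m => Chain f g m m)
    -- The invariant contains the solvability of the next equation. From degree one on it holds
    -- because `coboundary` of a solution `c` is a cycle: `∂δc = δ∂c = δδs = 0`.
    (fun m s => IsSmooth s ∧ ∃ c, IsSmooth c ∧ boundary c = coboundary s)
    (fun m s s' => boundary s' = coboundary s) s₀
    ⟨h₀, exists_boundary_eq_zero hf h₀.coboundary fun z => by
      rw [formalAug_coboundary, h₀', h₀', sub_self]⟩
    (by
      rintro m s ⟨hs, c, hc, hcs⟩
      refine ⟨c, ⟨hc, exists_boundary_eq_succ hf hc.coboundary ?_⟩, hcs⟩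
      rw [boundary_coboundary, hcs, coboundary_coboundary])
  exact ⟨S, fun m => (hS m).1, hS0 ▸ h₀', hS'⟩

/-- Augmentation zero chain maps of families of lifts are null-homotopic. -/
theorem exists_homotopy (hf : HasLocalLifts f) (s : ∀ m, Chain f g m m) (hs : ∀ m, IsSmooth (s m))
    (h0 : ∀ z, formalAug f g 0 0 (s 0 z) = 0)
    (hs' : ∀ m, boundary (s (m + 1)) = coboundary (s m)) :
    ∃ h : ∀ m, Chain f g (m + 1) m, (∀ m, IsSmooth (h m)) ∧ boundary (h 0) = s 0 ∧
      ∀ m, boundary (h (m + 1)) = s (m + 1) - coboundary (h m) := by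
  obtain ⟨h₀, hh₀, hh₀'⟩ := exists_boundary_eq_zero hf (hs 0) h0
  obtain ⟨h, hh0, hh, hh'⟩ := exists_seq_of_step (A := fun m => Chain f g (m + 1) m)
    -- This is what makes `s (m + 1) - coboundary h` a cycle, and it is reproduced by the new
    -- solution since `δδ = 0`.
    (fun m h => IsSmooth h ∧ coboundary (boundary h) = coboundary (s m))
    (fun m h h' => boundary h' = s (m + 1) - coboundary h) h₀ ⟨hh₀, congrArg coboundary hh₀'⟩
    (by
      rintro m h ⟨hh, hh'⟩
      obtain ⟨c, hc, hc'⟩ := exists_boundary_eq_succ hf ((hs (m + 1)).sub hh.coboundary) (by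
        rw [boundary_sub, hs', boundary_coboundary, hh', sub_self])
      refine ⟨c, ⟨hc, ?_⟩, hc'⟩
      rw [hc', coboundary_sub, coboundary_coboundary, sub_zero])
  exact ⟨h, fun m => (hh m).1, hh0 ▸ hh₀', hh'⟩

end Chain
end SimplicialMfd
end Chains
end

noncomputable section

/-! ### Pullback of forms along maps that are smooth only near a point. -/

section LocalPullback
open scoped Manifold ContDiff Topology

namespace DiffForm

section Mfd
variable {E E' E'' : Type*} [NormedAddCommGroup E] [NormedSpace ℝ E] [NormedAddCommGroup E']
  [NormedSpace ℝ E'] [NormedAddCommGroup E''] [NormedSpace ℝ E'']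
  {M : Type*} [TopologicalSpace M] [ChartedSpace E M]
  {N : Type*} [TopologicalSpace N] [ChartedSpace E' N]
  {P : Type*} [TopologicalSpace P] [ChartedSpace E'' P] {q : ℕ}

theorem pull_comp_apply {g : N → P} {f : M → N} {x : M}
    (hg : MDifferentiableAt 𝓘(ℝ, E') 𝓘(ℝ, E'') g (f x))
    (hf : MDifferentiableAt 𝓘(ℝ, E) 𝓘(ℝ, E') f x)
    (a : ∀ x : P, TangentSpace 𝓘(ℝ, E'') x [⋀^Fin q]→L[ℝ] ℝ) :
    pull (E := E) (g ∘ f) a x = pull f (pull (E := E') g a) x := by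
  ext v
  simp only [pull, mfderiv_comp x hg hf]
  rfl

variable [IsManifold 𝓘(ℝ, E) ∞ M] [IsManifold 𝓘(ℝ, E') ∞ N]

theorem contDiffAt_coord_of_contMDiffAt {f : M → N} {e : OpenPartialHomeomorph M E}
    (he : e ∈ atlas E M) {e' : OpenPartialHomeomorph N E'} (he' : e' ∈ atlas E' N) {y : E}
    (hf : ContMDiffAt 𝓘(ℝ, E) 𝓘(ℝ, E') ∞ f (e.symm y)) (hy : y ∈ e.target)
    (hfy : f (e.symm y) ∈ e'.source) : ContDiffAt ℝ ∞ (e' ∘ f ∘ e.symm) y := by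
  rw [← contMDiffAt_iff_contDiffAt]
  have h1 := (contMDiffOn_chart_symm he).contMDiffAt (e.open_target.mem_nhds hy)
  have h2 := (contMDiffOn_chart he').contMDiffAt (e'.open_source.mem_nhds hfy)
  exact h2.comp y (hf.comp y h1)

theorem localRep_pull_of_contMDiffAt {f : M → N}
    (a : ∀ x : N, TangentSpace 𝓘(ℝ, E') x [⋀^Fin q]→L[ℝ] ℝ)
    {e : OpenPartialHomeomorph M E} (he : e ∈ atlas E M)
    {e' : OpenPartialHomeomorph N E'} (he' : e' ∈ atlas E' N) {y : E}
    (hf : ContMDiffAt 𝓘(ℝ, E) 𝓘(ℝ, E') ∞ f (e.symm y)) (hy : y ∈ e.target)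
    (hfy : f (e.symm y) ∈ e'.source) :
    localRep (pull f a) e y =
      (localRep a e' ((e' ∘ f ∘ e.symm) y)).compContinuousLinearMap
        (fderiv ℝ (e' ∘ f ∘ e.symm) y) := by
  have hn : (∞ : WithTop ℕ∞) ≠ 0 := by simp
  set g := e' ∘ f ∘ e.symm with hg
  have h1 : MDifferentiableAt 𝓘(ℝ, E) 𝓘(ℝ, E) e.symm y :=
    ((contMDiffOn_chart_symm he).contMDiffAt (e.open_target.mem_nhds hy)).mdifferentiableAt hn
  have hgy : g y ∈ e'.target := e'.map_source hfy
  have h2 : MDifferentiableAt 𝓘(ℝ, E') 𝓘(ℝ, E') e'.symm (g y) :=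
    ((contMDiffOn_chart_symm he').contMDiffAt (e'.open_target.mem_nhds hgy)).mdifferentiableAt hn
  have h3 : MDifferentiableAt 𝓘(ℝ, E) 𝓘(ℝ, E') g y :=
    (contDiffAt_coord_of_contMDiffAt he he' hf hy hfy).contMDiffAt.mdifferentiableAt hn
  have h4 : MDifferentiableAt 𝓘(ℝ, E) 𝓘(ℝ, E') f (e.symm y) := hf.mdifferentiableAt hn
  have heq : e'.symm ∘ g =ᶠ[𝓝 y] f ∘ e.symm :=
    Filter.eventually_of_mem ((hf.continuousAt.comp (e.continuousAt_symm hy)).preimage_mem_nhds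
      (e'.open_source.mem_nhds hfy)) fun z hz => e'.left_inv hz
  have h5 := (mfderiv_comp y h2 h3).symm.trans (heq.mfderiv_eq.trans (mfderiv_comp y h4 h1))
  have hpt : e'.symm (g y) = f (e.symm y) := e'.left_inv hfy
  rw [mfderiv_eq_fderiv] at h5
  ext v
  have key : ∀ (x x' : N) (w w' : Fin q → E') (_ : x = x') (_ : w = w'),
      (a x : E' [⋀^Fin q]→L[ℝ] ℝ) w = (a x' : E' [⋀^Fin q]→L[ℝ] ℝ) w' := by
    rintro x _ w _ rfl rfl; rfl
  refine key _ _ _ _ hpt.symm ?_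
  funext i
  exact (congrArg (fun L : E →L[ℝ] E' => L (v i)) h5).symm

/-- The pullback of a smooth form along a map is smooth wherever the map is. -/
theorem contDiffAt_localRep_pull {f : M → N} (a : Form E' N q)
    {e : OpenPartialHomeomorph M E} (he : e ∈ atlas E M) {y : E} (hy : y ∈ e.target)
    (hf : ∀ᶠ x in 𝓝 (e.symm y), ContMDiffAt 𝓘(ℝ, E) 𝓘(ℝ, E') ∞ f x) :
    ContDiffAt ℝ ∞ (localRep (pull f a.1) e) y := by
  set e' := chartAt E' (f (e.symm y))
  have he' : e' ∈ atlas E' N := chart_mem_atlas _ _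
  have hfy : f (e.symm y) ∈ e'.source := mem_chart_source _ _
  have h1 := contDiffAt_coord_of_contMDiffAt he he' hf.self_of_nhds hy hfy
  have h2 : ContDiffAt ℝ ∞ (localRep a.1 e') ((e' ∘ f ∘ e.symm) y) :=
    contDiffAt_localRep a he' (e'.map_source hfy)
  have h3 : ContDiffAt ℝ ∞ (fderiv ℝ (e' ∘ f ∘ e.symm)) y := h1.fderiv_right (by simp)
  refine ((contDiff_compContinuousLinearMap.contDiffAt).comp y
    ((h2.comp y h1).prodMk h3)).congr_of_eventuallyEq ?_
  filter_upwards [e.open_target.mem_nhds hy, (e.continuousAt_symm hy).eventually hf,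
    (hf.self_of_nhds.continuousAt.comp (e.continuousAt_symm hy)).preimage_mem_nhds
      (e'.open_source.mem_nhds hfy)] with z h4 h5 h6
  exact localRep_pull_of_contMDiffAt a.1 he he' h5 h4 h6

end Mfd
end DiffForm
end LocalPullback

/-! ### Smooth families of combinations acting on differential forms. -/

section Action
open scoped Manifold ContDiff Topology
open Filter

namespace SmoothMfd

variable {T T' M M' : SmoothMfd.{u}} {L L' : Type u} {q : ℕ}

/-- Fields of alternating forms on the tangent spaces of a manifold. -/
abbrev Field (M : SmoothMfd.{u}) (q : ℕ) : Type u :=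
  ∀ x : M, TangentSpace 𝓘(ℝ, EuclideanSpace ℝ (Fin M.dim)) x [⋀^Fin q]→L[ℝ] ℝ

/-- The underlying field of alternating forms of a smooth form. -/
def Form.toField (M : SmoothMfd.{u}) (q : ℕ) : M.Form q →ₗ[ℝ] M.Field q :=
  (DiffForm.Form (EuclideanSpace ℝ (Fin M.dim)) M q).subtype

theorem Form.toField_injective : Function.Injective (Form.toField M q) :=
  Subtype.val_injective

/-- Pullback of fields of alternating forms. -/
def pullField (f : T → M) (q : ℕ) : M.Field q →ₗ[ℝ] T.Field q where
  toFun a := DiffForm.pull f a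
  map_add' _ _ := rfl
  map_smul' _ _ := rfl

/-- A formal linear combination of maps acts on fields of alternating forms by pullback. -/
def actField (σ : L → T → M) (q : ℕ) : (T → L →₀ ℝ) →ₗ[ℝ] M.Field q →ₗ[ℝ] T.Field q :=
  LinearMap.mk₂ ℝ
    (fun b w t => Finsupp.linearCombination ℝ (fun a => pullField (σ a) q w t) (b t))
    (fun b b' w => funext fun t => map_add _ _ _)
    (fun c b w => funext fun t => (Finsupp.linearCombination ℝ _).map_smul c (b t))
    (fun b w w' => funext fun t => by
      simp only [Finsupp.linearCombination_apply, map_add, Pi.add_apply, smul_add,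
        Finsupp.sum_add])
    (fun c b w => funext fun t => by
      simp only [Finsupp.linearCombination_apply, map_smul, Pi.smul_apply, Finsupp.smul_sum]
      exact Finsupp.sum_congr fun a _ => smul_comm _ _ _)

theorem actField_apply (σ : L → T → M) (b : T → L →₀ ℝ) (w : M.Field q) (t : T) :
    actField σ q b w t = Finsupp.linearCombination ℝ (fun a => pullField (σ a) q w t) (b t) :=
  rfl

theorem actField_single (σ : L → T → M) (a : L) (w : M.Field q) :
    actField σ q (fun _ => Finsupp.single a 1) w = pullField (σ a) q w :=
  funext fun _ => (Finsupp.linearCombination_single ..).trans (one_smul ℝ _)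

/-- Labels are arbitrary functions, for which the chain rule may fail. This confines every
computation at `t` to labels smooth there. -/
theorem IsKernelAt.smoothNear_of_mem_support {σ : L → T → M} {b : T → L →₀ ℝ} {t : T}
    (hb : IsKernelAt σ t b) {a : L} (ha : a ∈ (b t).support) : SmoothNear (σ a) t := by
  classical
  induction hb with
  | zero => simp at ha
  | add _ _ h h' => exact (Finset.mem_union.1 (Finsupp.support_add ha)).elim h h'
  | single ρ a' _ ha' =>
    rw [Finset.mem_singleton.1 (Finsupp.support_single_subset ha)]
    exact ha'
  | congr h _ hb => exact hb (h.self_of_nhds ▸ ha)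

theorem pullField_comp_apply {v : M → M'} {s : T → M} {t : T} (hv : SmoothNear v (s t))
    (hs : SmoothNear s t) (w : M'.Field q) :
    pullField (v ∘ s) q w t = pullField s q (pullField v q w) t :=
  DiffForm.pull_comp_apply (hv.self_of_nhds.mdifferentiableAt (by simp))
    (hs.self_of_nhds.mdifferentiableAt (by simp)) w

/-- Pullback at a point sees only the values of the coefficients, never their derivatives; this is
why the action is compatible with pullbacks. -/
theorem linearCombination_compContinuousLinearMap {E F : Type*} [NormedAddCommGroup E]
    [NormedSpace ℝ E] [NormedAddCommGroup F] [NormedSpace ℝ F] (w : L → F [⋀^Fin q]→L[ℝ] ℝ)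
    (x : L →₀ ℝ) (A : E →L[ℝ] F) :
    (Finsupp.linearCombination ℝ w x).compContinuousLinearMap A =
      Finsupp.linearCombination ℝ (fun a => (w a).compContinuousLinearMap A) x := by
  induction x using Finsupp.induction_linear with
  | zero => simp only [map_zero]; rfl
  | add x y hx hy => rw [map_add, map_add, ← hx, ← hy]; rfl
  | single a r => rw [Finsupp.linearCombination_single, Finsupp.linearCombination_single]; rfl

theorem pullField_actField_apply {σ : L → T → M} (b : T → L →₀ ℝ) (w : M.Field q) (u : T' → T)
    (t : T') : pullField u q (actField σ q b w) t = Finsupp.linearCombination ℝ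
      (fun a => pullField u q (pullField (σ a) q w) t) (b (u t)) :=
  linearCombination_compContinuousLinearMap
    (E := EuclideanSpace ℝ (Fin T'.dim)) (F := EuclideanSpace ℝ (Fin T.dim)) _ _ _

theorem actField_push {σ : L → T → M} {σ' : L' → T' → M'} {b : T → L →₀ ℝ} (hb : IsKernel σ b)
    {Φ : L → L'} {u : T' → T} {v : M → M'} (hu : IsSmooth u) (hv : IsSmooth v)
    (hΦ : ∀ a, σ' (Φ a) = v ∘ σ a ∘ u) (w : M'.Field q) :
    actField σ' q (push Φ u b) w = pullField u q (actField σ q b (pullField v q w)) := by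
  funext t
  rw [pullField_actField_apply, actField_apply, push_apply, Finsupp.linearCombination_mapDomain,
    Finsupp.linearCombination_apply, Finsupp.linearCombination_apply]
  refine Finsupp.sum_congr fun a ha => congrArg _ ?_
  have h1 : SmoothNear (σ a) (u t) := (hb (u t)).smoothNear_of_mem_support ha
  have h2 : SmoothNear u t := hu.smoothNear t
  have h3 : SmoothNear v (σ a (u t)) := hv.smoothNear _
  rw [Function.comp_apply, hΦ, pullField_comp_apply (s := σ a ∘ u) h3 (h1.comp h2),
    pullField_comp_apply h1 h2]

theorem actField_mem {σ : L → T → M} {b : T → L →₀ ℝ} (hb : IsKernel σ b) (w : M.Form q) :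
    actField σ q b (Form.toField M q w) ∈ DiffForm.Form (EuclideanSpace ℝ (Fin T.dim)) T q := by
  intro e he y hy
  refine ContDiffAt.contDiffWithinAt ?_
  have h := hb (e.symm y)
  have hc := e.continuousAt_symm hy
  clear hb
  -- Smoothness at one point suffices, and there it follows the inductive construction of the germ
  -- of `b`.
  generalize ht : e.symm y = t at h
  induction h with
  | zero => rw [map_zero]; exact contDiffAt_const (c := 0)
  | add _ _ h h' => rw [map_add]; exact h.add h'
  | single ρ a hρ ha =>
    subst ht
    have h1 : ContDiffAt ℝ ∞ (ρ ∘ e.symm) y := by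
      rw [← contMDiffAt_iff_contDiffAt]
      exact hρ.self_of_nhds.comp y
        ((DiffForm.contMDiffOn_chart_symm he).contMDiffAt (e.open_target.mem_nhds hy))
    have h2 := DiffForm.contDiffAt_localRep_pull w he hy ha
    refine (h1.smul h2).congr_of_eventuallyEq (Eventually.of_forall fun z => ?_)
    have h3 : actField σ q (fun t => Finsupp.single a (ρ t)) (Form.toField M q w) (e.symm z) =
      ρ (e.symm z) • pullField (σ a) q (Form.toField M q w) (e.symm z) :=
      Finsupp.linearCombination_single ..
    rw [DiffForm.localRep, h3]
    rfl
  | congr h _ hb =>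
    subst ht
    refine hb.congr_of_eventuallyEq ((hc.eventually h).mono fun z hz => ?_)
    rw [DiffForm.localRep, DiffForm.localRep, actField_apply, actField_apply, hz]

/-- A smooth family of formal linear combinations of maps acts on smooth forms by pullback. -/
def act {σ : L → T → M} {b : T → L →₀ ℝ} (hb : IsKernel σ b) (q : ℕ) :
    M.Form q →ₗ[ℝ] T.Form q where
  toFun w := ⟨actField σ q b (Form.toField M q w), actField_mem hb w⟩
  map_add' w w' := Form.toField_injective (by
    exact (congrArg _ (map_add _ w w')).trans (map_add (actField σ q b) _ _))
  map_smul' c w := Form.toField_injective (by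
    exact (congrArg _ (map_smul _ c w)).trans (map_smul (actField σ q b) _ _))

theorem toField_pullback (f : T ⟶ M) (w : M.Form q) :
    Form.toField T q (pullback f q w) = pullField (Hom.fn f) q (Form.toField M q w) :=
  rfl

end SmoothMfd
end Action
end

noncomputable section
-- Homotopy equivalence of the rows of fixed form degree.
section Rows
open CategoryTheory Simplicial Opposite Filter
open scoped Manifold ContDiff Topology

namespace SimplicialMfd
open SmoothMfd

variable {X X' Y Z Z' : SimplicialMfd.{u}} {q : ℕ}

theorem toField_simplicialDiff {p : ℕ} (a : (X _⦋p⦌).Form q) :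
    Form.toField _ q (simplicialDiff X p q a) =
      ∑ i : Fin (p + 2), (-1 : ℤ) ^ (i : ℕ) • pullField (Hom.fn (X.δ i)) q (Form.toField _ q a) := by
  rw [simplicialDiff_apply, map_sum]
  exact Finset.sum_congr rfl fun i _ => map_zsmul _ _ _

namespace Label

variable {f : X ⟶ Y} {f' : X' ⟶ Y} {g : Z ⟶ Y} {g' : Z' ⟶ Y} {r m : ℕ}

/-- Composition of labels with simplicial maps over the base. -/
def transport (v : X ⟶ X') (u : Z' ⟶ Z) (hv : v ≫ f' = f) (hu : u ≫ g = g')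
    (a : Label f g r m) : Label f' g' r m where
  mor := a.mor
  fn z := Hom.fn (v.app (op ⦋r⦌)) (a.fn (Hom.fn (u.app (op ⦋m⦌)) z))
  lift z := by
    subst hv hu
    exact a.lift _

variable (v : X ⟶ X') (u : Z' ⟶ Z) (hv : v ≫ f' = f) (hu : u ≫ g = g')

theorem face_transport (a : Label f g (r + 1) m) (i : Fin (r + 2)) :
    face i (transport v u hv hu a) = transport v u hv hu (face i a) :=
  Label.ext rfl (funext fun _ => (δ_naturality_apply v i _).symm)

theorem coface_transport (a : Label f g r m) (i : Fin (m + 2)) :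
    coface i (transport v u hv hu a) = transport v u hv hu (coface i a) :=
  Label.ext rfl (funext fun _ => congrArg (fun z => Hom.fn (v.app _) (a.fn z))
    (δ_naturality_apply u i _))

/-- The tautological label. -/
def refl (f : X ⟶ Y) (m : ℕ) : Label f f m m where
  mor := 𝟙 _
  fn := id
  lift z := by rw [op_id, Y.map_id]; rfl

theorem face_refl (f : X ⟶ Y) (m : ℕ) (i : Fin (m + 2)) :
    face i (refl f (m + 1)) = coface i (refl f m) :=
  Label.ext ((Category.comp_id _).trans (Category.id_comp _).symm) rfl

end Label

namespace Chain

variable {f : X ⟶ Y} {f' : X' ⟶ Y} {g : Z ⟶ Y} {g' : Z' ⟶ Y} {r m : ℕ}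

/-- The action of a smooth family of formal linear combinations of lifts on forms. -/
def IsSmooth.act {b : Chain f g r m} (hb : IsSmooth b) (q : ℕ) :
    (X _⦋r⦌).Form q →ₗ[ℝ] (Z _⦋m⦌).Form q :=
  SmoothMfd.act hb q

theorem IsSmooth.toField_act {b : Chain f g r m} (hb : IsSmooth b) (w : (X _⦋r⦌).Form q) :
    Form.toField _ q (hb.act q w) = actField Label.fn q b (Form.toField _ q w) :=
  rfl

/-- A face of a lift is the lift followed by `d_i`, so its pullback applies `d_i^*` first; for
`coboundary` the lift is preceded by `d_i`, and `d_i^*` comes last. -/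
theorem IsSmooth.act_boundary {b : Chain f g (r + 1) m} (hb : IsSmooth b) (w : (X _⦋r⦌).Form q) :
    hb.boundary.act q w = hb.act q (simplicialDiff X r q w) := by
  refine Form.toField_injective ?_
  rw [hb.boundary.toField_act, hb.toField_act, toField_simplicialDiff, Chain.boundary, map_sum,
    map_sum, LinearMap.sum_apply]
  refine Finset.sum_congr rfl fun i _ => ?_
  rw [map_zsmul, map_zsmul, LinearMap.smul_apply]
  refine congrArg _ ?_
  rw [actField_push (σ := Label.fn) (σ' := Label.fn) hb (u := id) (v := Hom.fn (X.δ i))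
    (Hom.smooth (𝟙 (Z _⦋m⦌))) (Hom.smooth _) fun _ => rfl]
  exact DiffForm.pull_id _

theorem IsSmooth.act_coboundary {b : Chain f g r m} (hb : IsSmooth b) (w : (X _⦋r⦌).Form q) :
    hb.coboundary.act q w = simplicialDiff Z m q (hb.act q w) := by
  refine Form.toField_injective ?_
  rw [hb.coboundary.toField_act, toField_simplicialDiff, hb.toField_act, Chain.coboundary, map_sum,
    LinearMap.sum_apply]
  refine Finset.sum_congr rfl fun i _ => ?_
  rw [map_zsmul, LinearMap.smul_apply]
  refine congrArg _ ?_
  rw [actField_push (σ := Label.fn) (σ' := Label.fn) hb (v := id) (Hom.smooth _) (Hom.smooth (𝟙 (X _⦋r⦌))) fun _ => rfl]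
  exact congrArg (fun w => pullField _ q (actField _ q b w)) (DiffForm.pull_id _)

theorem IsSmooth.sub {b b' : Chain f g r m} (hb : IsSmooth b) (hb' : IsSmooth b') :
    IsSmooth (b - b') :=
  IsKernel.sub hb hb'

theorem IsSmooth.act_sub {b b' : Chain f g r m} (hb : IsSmooth b) (hb' : IsSmooth b')
    (w : (X _⦋r⦌).Form q) :
    (hb.sub hb').act q w = hb.act q w - hb'.act q w := by
  refine Form.toField_injective ?_
  rw [map_sub, IsSmooth.toField_act, map_sub, LinearMap.sub_apply, hb.toField_act, hb'.toField_act]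

/-- Families of formal linear combinations of lifts which are compatible with the face maps. -/
structure IsChainMap (S : ∀ m, Chain f g m m) : Prop where
  isSmooth : ∀ m, IsSmooth (S m)
  aug : ∀ z, formalAug f g 0 0 (S 0 z) = 1
  boundary_eq : ∀ m, boundary (S (m + 1)) = coboundary (S m)

theorem IsSmooth.act_congr {b b' : Chain f g r m} (hb : IsSmooth b) (hb' : IsSmooth b')
    (h : b = b') (w : (X _⦋r⦌).Form q) : hb.act q w = hb'.act q w := by
  subst h
  rfl

theorem IsChainMap.simplicialDiff_act {S : ∀ m, Chain f g m m} (hS : IsChainMap S) (m : ℕ)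
    (w : (X _⦋m⦌).Form q) : simplicialDiff Z m q ((hS.isSmooth m).act q w) =
      (hS.isSmooth (m + 1)).act q (simplicialDiff X m q w) := by
  rw [← IsSmooth.act_coboundary, ← IsSmooth.act_boundary]
  exact IsSmooth.act_congr _ _ (hS.boundary_eq m).symm w

/-- The actions on forms of two chain maps of families of lifts are homotopic. -/
theorem IsChainMap.exists_homotopy_act (hf : HasLocalLifts f) {S S' : ∀ m, Chain f g m m}
    (hS : IsChainMap S) (hS' : IsChainMap S') (q : ℕ) :
    ∃ h : ∀ m, (X _⦋m + 1⦌).Form q →ₗ[ℝ] (Z _⦋m⦌).Form q,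
      (∀ w, h 0 (simplicialDiff X 0 q w) =
        (hS.isSmooth 0).act q w - (hS'.isSmooth 0).act q w) ∧
      ∀ m w, h (m + 1) (simplicialDiff X (m + 1) q w) + simplicialDiff Z m q (h m w) =
        (hS.isSmooth (m + 1)).act q w - (hS'.isSmooth (m + 1)).act q w := by
  obtain ⟨h, hh, h0, h1⟩ := exists_homotopy hf (fun m => S m - S' m)
    (fun m => (hS.isSmooth m).sub (hS'.isSmooth m))
    (fun z => by rw [Pi.sub_apply, map_sub, hS.aug, hS'.aug, sub_self])
    (fun m => by rw [boundary_sub, hS.boundary_eq, hS'.boundary_eq, coboundary_sub])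
  refine ⟨fun m => (hh m).act q, fun w => ?_, fun m w => ?_⟩
  · rw [← IsSmooth.act_boundary, ← IsSmooth.act_sub]
    exact IsSmooth.act_congr _ _ h0 w
  · rw [← IsSmooth.act_boundary, ← IsSmooth.act_coboundary, ← IsSmooth.act_sub,
      ← eq_sub_iff_add_eq, ← IsSmooth.act_sub]
    exact IsSmooth.act_congr _ _ (h1 m) w

/-- Composition of families of lifts with simplicial maps over the base. -/
def transport (v : X ⟶ X') (u : Z' ⟶ Z) (hv : v ≫ f' = f) (hu : u ≫ g = g')
    (b : Chain f g r m) : Chain f' g' r m :=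
  push (Label.transport v u hv hu) (Hom.fn (u.app (op ⦋m⦌))) b

theorem IsSmooth.transport (v : X ⟶ X') (u : Z' ⟶ Z) (hv : v ≫ f' = f) (hu : u ≫ g = g')
    {b : Chain f g r m} (hb : IsSmooth b) : IsSmooth (transport v u hv hu b) :=
  IsKernel.push (σ := Label.fn) (σ' := Label.fn) (Hom.smooth _) (fun _ t ha =>
    ((Hom.smooth (v.app (op ⦋r⦌))).smoothNear _).comp
      (ha.comp ((Hom.smooth (u.app (op ⦋m⦌))).smoothNear t))) hb

theorem IsSmooth.act_transport (v : X ⟶ X') (u : Z' ⟶ Z) (hv : v ≫ f' = f) (hu : u ≫ g = g')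
    {b : Chain f g r m} (hb : IsSmooth b) (w : (X' _⦋r⦌).Form q) :
    (hb.transport v u hv hu).act q w =
      pullback (u.app (op ⦋m⦌)) q (hb.act q (pullback (v.app (op ⦋r⦌)) q w)) := by
  refine Form.toField_injective ?_
  rw [IsSmooth.toField_act, toField_pullback, hb.toField_act, toField_pullback, Chain.transport,
    actField_push (σ := Label.fn) (σ' := Label.fn) hb (Hom.smooth _) (Hom.smooth _) fun _ => rfl]

theorem IsChainMap.transport (v : X ⟶ X') (u : Z' ⟶ Z) (hv : v ≫ f' = f) (hu : u ≫ g = g')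
    {S : ∀ m, Chain f g m m} (hS : IsChainMap S) :
    IsChainMap fun m => Chain.transport v u hv hu (S m) where
  isSmooth m := (hS.isSmooth m).transport v u hv hu
  aug z := (Finsupp.linearCombination_mapDomain ℝ _ _).trans (hS.aug _)
  boundary_eq m := by
    have h1 : boundary (Chain.transport v u hv hu (S (m + 1))) =
        Chain.transport v u hv hu (boundary (S (m + 1))) := by
      simp only [boundary, Chain.transport, map_sum, map_zsmul, push_push]
      refine Finset.sum_congr rfl fun i _ => congrArg _ ?_
      exact congrArg (fun Φ => push Φ _ _) (funext fun a => Label.face_transport v u hv hu a i)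
    have h2 : coboundary (Chain.transport v u hv hu (S m)) =
        Chain.transport v u hv hu (coboundary (S m)) := by
      simp only [coboundary, Chain.transport, map_sum, map_zsmul, push_push]
      refine Finset.sum_congr rfl fun i _ => congrArg _ ?_
      have h3 : Label.coface i ∘ Label.transport v u hv hu =
          Label.transport v u hv hu ∘ (Label.coface i : Label f g m m → _) :=
        funext fun a => Label.coface_transport v u hv hu a i
      have h4 : Hom.fn (u.app (op ⦋m⦌)) ∘ Hom.fn (Z'.δ i) =
          Hom.fn (Z.δ i) ∘ Hom.fn (u.app (op ⦋m + 1⦌)) :=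
        funext fun z => δ_naturality_apply u i z
      rw [h3, h4]
    rw [h1, h2, hS.boundary_eq]

/-- The tautological family of lifts. -/
def refl (f : X ⟶ Y) (m : ℕ) : Chain f f m m :=
  fun _ => Finsupp.single (Label.refl f m) 1

theorem isChainMap_refl (f : X ⟶ Y) : IsChainMap (refl f) where
  isSmooth m t := IsKernelAt.single (fun _ => 1) _ (Eventually.of_forall fun _ => contMDiffAt_const)
    ((Hom.smooth (𝟙 (X _⦋m⦌))).smoothNear t)
  aug z := by simp [refl, formalAug]
  boundary_eq m := by
    refine Finset.sum_congr rfl fun i _ => congrArg _ (funext fun z => ?_)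
    rw [push_apply, push_apply, refl, refl, Finsupp.mapDomain_single, Finsupp.mapDomain_single,
      Label.face_refl]

theorem act_refl (f : X ⟶ Y) (m : ℕ) (w : (X _⦋m⦌).Form q) :
    ((isChainMap_refl f).isSmooth m).act q w = w := by
  refine Form.toField_injective ?_
  rw [IsSmooth.toField_act]
  exact (actField_single _ _ _).trans (DiffForm.pull_id _)

end Chain

/-- Pullback along a map with local lifts is a homotopy equivalence between the simplicial
complexes of differential forms of a fixed degree. -/
theorem HasLocalLifts.exists_homotopyInverse {f : X ⟶ Y} (hf : HasLocalLifts f) (q : ℕ) :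
    ∃ (S : ∀ m, (X _⦋m⦌).Form q →ₗ[ℝ] (Y _⦋m⦌).Form q)
      (h : ∀ m, (X _⦋m + 1⦌).Form q →ₗ[ℝ] (X _⦋m⦌).Form q)
      (k : ∀ m, (Y _⦋m + 1⦌).Form q →ₗ[ℝ] (Y _⦋m⦌).Form q),
      (∀ m w, simplicialDiff Y m q (S m w) = S (m + 1) (simplicialDiff X m q w)) ∧
      (∀ w, h 0 (simplicialDiff X 0 q w) = pullback (f.app (op ⦋0⦌)) q (S 0 w) - w) ∧
      (∀ m w, h (m + 1) (simplicialDiff X (m + 1) q w) + simplicialDiff X m q (h m w) =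
        pullback (f.app (op ⦋m + 1⦌)) q (S (m + 1) w) - w) ∧
      (∀ w, k 0 (simplicialDiff Y 0 q w) = S 0 (pullback (f.app (op ⦋0⦌)) q w) - w) ∧
      (∀ m w, k (m + 1) (simplicialDiff Y (m + 1) q w) + simplicialDiff Y m q (k m w) =
        S (m + 1) (pullback (f.app (op ⦋m + 1⦌)) q w) - w) := by
  obtain ⟨S, h1, h2, h3⟩ := Chain.exists_chainMap hf (𝟙 Y)
  have hS : Chain.IsChainMap S := ⟨h1, h2, h3⟩
  -- Precomposing `S` with `f` gives lifts of `f` through `f`, acting as `f^* ∘ S`; postcomposing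
  -- gives lifts of `𝟙 Y` through itself, acting as `S ∘ f^*`. Each is compared with the
  -- tautological chain map, which acts as the identity.
  have hSX := hS.transport (f' := f) (g' := f) (𝟙 X) f (Category.id_comp _) (Category.comp_id _)
  have hSY := hS.transport (f' := 𝟙 Y) (g' := 𝟙 Y) f (𝟙 Y) (Category.comp_id _) (Category.comp_id _)
  have hX : ∀ m w, (hSX.isSmooth m).act q w =
      pullback (f.app (op ⦋m⦌)) q ((hS.isSmooth m).act q w) := fun m w =>
    (Chain.IsSmooth.act_transport _ _ _ _ (hS.isSmooth m) w).trans
      (congrArg (fun w => pullback _ q ((hS.isSmooth m).act q w)) (pullback_id w))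
  have hY : ∀ m w, (hSY.isSmooth m).act q w =
      (hS.isSmooth m).act q (pullback (f.app (op ⦋m⦌)) q w) := fun m w =>
    (Chain.IsSmooth.act_transport _ _ _ _ (hS.isSmooth m) w).trans (pullback_id _)
  obtain ⟨h, hh0, hh1⟩ := hSX.exists_homotopy_act hf (Chain.isChainMap_refl f) q
  obtain ⟨k, hk0, hk1⟩ := hSY.exists_homotopy_act (hasLocalLifts_id Y)
    (Chain.isChainMap_refl (𝟙 Y)) q
  simp only [hX, hY, Chain.act_refl] at hh0 hh1 hk0 hk1
  exact ⟨fun m => (hS.isSmooth m).act q, h, k, hS.simplicialDiff_act, hh0, hh1, hk0, hk1⟩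

end SimplicialMfd
end Rows
end

noncomputable section
-- The Dold–Kan projection onto normalised forms.
section Normalisation
open CategoryTheory Simplicial Opposite AlgebraicTopology DoldKan

namespace SimplicialMfd
open SmoothMfd

variable {X Y : SimplicialMfd.{u}} {q : ℕ}

/-- The simplicial object of the opposite category of vector spaces given by forms of a fixed
degree. -/
abbrev formObject (q : ℕ) : SimplicialMfd.{u} ⥤ SimplicialObject (ModuleCat.{u} ℝ)ᵒᵖ :=
  (SimplicialObject.whiskering _ _).obj (formFunctor q).rightOp

/-- The projection of the forms onto the normalised forms. -/
def normalisation (X : SimplicialMfd.{u}) (p q : ℕ) : (X _⦋p⦌).Form q →ₗ[ℝ] (X _⦋p⦌).Form q :=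
  ((PInfty (X := (formObject q).obj X)).f p).unop.hom

theorem normalisation_mem (p : ℕ) (a : (X _⦋p⦌).Form q) :
    normalisation X p q a ∈ normalised X p q := by
  rcases p with _ | p
  · trivial
  · rw [mem_normalised_succ]
    intro i
    have h := σ_comp_PInfty ((formObject q).obj X) i
    exact congrArg (fun g => g.unop.hom a) h

theorem normalisation_eq_self {p : ℕ} {a : (X _⦋p⦌).Form q} (ha : a ∈ normalised X p q) :
    normalisation X p q a = a := by
  -- In the opposite category the inclusion of the normalised forms becomes a map killing
  -- degeneracies, hence killed by `QInfty`; then `PInfty + QInfty = 1` gives the claim.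
  let ι : ((formObject q).obj X) _⦋p⦌ ⟶ op (ModuleCat.of ℝ (normalised X p q)) :=
    (ModuleCat.ofHom (normalised X p q).subtype).op
  have hι : DegeneraciesVanish ι := by
    rcases p with _ | p
    · trivial
    · intro i
      refine Quiver.Hom.unop_inj (ModuleCat.hom_ext (LinearMap.ext fun b => ?_))
      exact (mem_normalised_succ X).1 b.2 i
  have h1 := (degeneraciesVanish_iff_QInfty_f_comp ι).1 hι
  have h2 : ((QInfty (X := (formObject q).obj X)).f p).unop.hom a = 0 :=
    congrArg (fun g => g.unop.hom ⟨a, ha⟩) h1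
  have h3 : ((PInfty (X := (formObject q).obj X)).f p).unop.hom a +
      ((QInfty (X := (formObject q).obj X)).f p).unop.hom a = a :=
    congrArg (fun g => g.unop.hom a) (PInfty_f_add_QInfty_f (X := (formObject q).obj X) p)
  rw [h2, add_zero] at h3
  exact h3

theorem normalisation_simplicialDiff (p : ℕ) (a : (X _⦋p⦌).Form q) :
    normalisation X (p + 1) q (simplicialDiff X p q a) =
      simplicialDiff X p q (normalisation X p q a) := by
  have h := (PInfty (X := (formObject q).obj X)).comm (p + 1) p
  have h1 : (AlternatingFaceMapComplex.obj ((formObject q).obj X)).d (p + 1) p =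
      (ModuleCat.ofHom (simplicialDiff X p q)).op := by
    rw [AlternatingFaceMapComplex.obj_d_eq]
    refine Quiver.Hom.unop_inj ?_
    ext a
    simp only [unop_sum, unop_zsmul, ModuleCat.hom_sum, ModuleCat.hom_zsmul, simplicialDiff]
    rfl
  rw [h1] at h
  exact congrArg (fun g => g.unop.hom a) h

theorem normalisation_pullback (f : X ⟶ Y) (p : ℕ) (a : (Y _⦋p⦌).Form q) :
    normalisation X p q (pullback (f.app (op ⦋p⦌)) q a) =
      pullback (f.app (op ⦋p⦌)) q (normalisation Y p q a) := by
  have h := PInfty_f_naturality p ((formObject q).map f)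
  exact congrArg (fun g => g.unop.hom a) h.symm

end SimplicialMfd
end Normalisation
end

noncomputable section

/-! ### An elementwise criterion for quasi-isomorphisms. -/

section QuasiIsoCriterion
open CategoryTheory HomologicalComplex

namespace CochainComplex

/-- The canonical surjection from the free module on the elements of `A`. -/
def freeCover (A : ModuleCat.{u} ℝ) : ModuleCat.of ℝ (A →₀ ℝ) ⟶ A :=
  ModuleCat.ofHom (Finsupp.linearCombination ℝ id)

instance (A : ModuleCat.{u} ℝ) : Epi (freeCover A) :=
  (ModuleCat.epi_iff_surjective _).2 (Finsupp.linearCombination_id_surjective ℝ A)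

/-- The map out of the free module on the elements of `A` given by a function on `A`. -/
def freeLift {A B : ModuleCat.{u} ℝ} (g : A → B) : ModuleCat.of ℝ (A →₀ ℝ) ⟶ B :=
  ModuleCat.ofHom (Finsupp.linearCombination ℝ g)

theorem freeCover_comp {A B : ModuleCat.{u} ℝ} (x : A ⟶ B) :
    freeCover A ≫ x = freeLift x.hom :=
  ModuleCat.hom_ext (Finsupp.lhom_ext fun a c => by simp [freeCover, freeLift])

theorem freeLift_comp {A B C : ModuleCat.{u} ℝ} (g : A → B) (x : B ⟶ C) :
    freeLift g ≫ x = freeLift fun a => x.hom (g a) :=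
  ModuleCat.hom_ext (Finsupp.lhom_ext fun a c => by simp [freeLift])

theorem freeLift_zero {A B : ModuleCat.{u} ℝ} : freeLift (fun _ : A => (0 : B)) = 0 :=
  ModuleCat.hom_ext (Finsupp.lhom_ext fun a c => by simp [freeLift])

theorem freeLift_add {A B : ModuleCat.{u} ℝ} (g h : A → B) :
    (freeLift fun a => g a + h a) = freeLift g + freeLift h :=
  ModuleCat.hom_ext (Finsupp.lhom_ext fun a c => by simp [freeLift])

variable {K L : CochainComplex (ModuleCat.{u} ℝ) ℕ} (φ : K ⟶ L)

/-- A cochain map is a quasi-isomorphism when every cocycle of its source with a primitive `y` of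
its image has a primitive whose image is `y` up to a coboundary. -/
theorem quasiIso_of_descent
    (h₀ : ∀ x : K.X 0, (K.d 0 1).hom x = 0 → (φ.f 0).hom x = 0 → x = 0)
    (h₁ : ∀ (x : K.X 1) (y : L.X 0), (K.d 1 2).hom x = 0 → (φ.f 1).hom x = (L.d 0 1).hom y →
      ∃ x' : K.X 0, (K.d 0 1).hom x' = x ∧ y = (φ.f 0).hom x')
    (h : ∀ (n : ℕ) (x : K.X (n + 2)) (y : L.X (n + 1)), (K.d (n + 2) (n + 3)).hom x = 0 →
      (φ.f (n + 2)).hom x = (L.d (n + 1) (n + 2)).hom y →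
      ∃ (x' : K.X (n + 1)) (y' : L.X n), (K.d (n + 1) (n + 2)).hom x' = x ∧
        y = (φ.f (n + 1)).hom x' + (L.d n (n + 1)).hom y') :
    QuasiIso φ := by
  have hmono : ∀ n, Mono (homologyMap φ n) := by
    rintro (_ | n)
    · rw [mono_homologyMap_iff_up_to_refinements φ 0 0 1 (by simp) (by simp)]
      intro A x hx y hxy
      refine ⟨A, 𝟙 A, inferInstance, 0, ?_⟩
      ext a
      have hy : L.d 0 0 = 0 := L.shape _ _ (by simp)
      rw [hy, Limits.comp_zero] at hxy
      simpa using h₀ (x.hom a) (congrArg (fun g => g.hom a) hx) (congrArg (fun g => g.hom a) hxy)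
    · rw [mono_homologyMap_iff_up_to_refinements φ n (n + 1) (n + 2) (by simp) (by simp)]
      intro A x hx y hxy
      have key : ∀ a : A, ∃ x' : K.X n, (K.d n (n + 1)).hom x' = x.hom a := fun a => by
        have e₁ : (K.d (n + 1) (n + 2)).hom (x.hom a) = 0 := congrArg (fun g => g.hom a) hx
        have e₂ : (φ.f (n + 1)).hom (x.hom a) = (L.d n (n + 1)).hom (y.hom a) :=
          congrArg (fun g => g.hom a) hxy
        rcases n with _ | n
        · obtain ⟨x', hx', -⟩ := h₁ _ _ e₁ e₂
          exact ⟨x', hx'⟩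
        · obtain ⟨x', -, hx', -⟩ := h n _ _ e₁ e₂
          exact ⟨x', hx'⟩
      -- The choice `g` need not be linear; passing to the free module on `A` makes it so.
      choose g hg using key
      exact ⟨_, freeCover A, inferInstance, freeLift g, by
        simp only [freeCover_comp, freeLift_comp, hg]⟩
  have hepi : ∀ n, Epi (homologyMap φ n) := by
    rintro (_ | n)
    · rw [epi_homologyMap_iff_up_to_refinements φ 0 0 1 (by simp) (by simp)]
      intro A y hy
      have key : ∀ a : A, ∃ x' : K.X 0, (K.d 0 1).hom x' = 0 ∧ y.hom a = (φ.f 0).hom x' :=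
        fun a => h₁ 0 _ (map_zero _) (by
          rw [map_zero]; exact (congrArg (fun g => g.hom a) hy).symm)
      choose g hg₁ hg₂ using key
      exact ⟨_, freeCover A, inferInstance, freeLift g,
        by simp only [freeLift_comp, hg₁, freeLift_zero], 0,
        by rw [freeCover_comp, freeLift_comp, funext hg₂, Limits.zero_comp, add_zero]⟩
    · rw [epi_homologyMap_iff_up_to_refinements φ n (n + 1) (n + 2) (by simp) (by simp)]
      intro A y hy
      -- Taking `x = 0` in the descent condition turns a cocycle of `L` into a cocycle of `K` plus a
      -- coboundary.
      have key : ∀ a : A, ∃ (x' : K.X (n + 1)) (y' : L.X n), (K.d (n + 1) (n + 2)).hom x' = 0 ∧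
          y.hom a = (φ.f (n + 1)).hom x' + (L.d n (n + 1)).hom y' :=
        fun a => h n 0 _ (map_zero _) (by
          rw [map_zero]; exact (congrArg (fun g => g.hom a) hy).symm)
      choose g g' hg₁ hg₂ using key
      exact ⟨_, freeCover A, inferInstance, freeLift g,
        by simp only [freeLift_comp, hg₁, freeLift_zero], freeLift g',
        by rw [freeCover_comp, freeLift_comp, freeLift_comp, funext hg₂, freeLift_add]⟩
  rw [quasiIso_iff]
  intro n
  rw [quasiIsoAt_iff_isIso_homologyMap]
  have := hmono n
  have := hepi n
  exact isIso_of_mono_of_epi _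

end CochainComplex
end QuasiIsoCriterion
end

noncomputable section

/-! ### From the rows to the total complex. -/

section Descent
open CategoryTheory Simplicial Opposite

namespace SimplicialMfd
open SmoothMfd

variable {X Y : SimplicialMfd.{u}} {f : X ⟶ Y} {k : ℕ}

theorem simplicialDiff_pullback (f : X ⟶ Y) (p q : ℕ) (b : (Y _⦋p⦌).Form q) :
    simplicialDiff X p q (pullback (f.app (op ⦋p⦌)) q b) =
      pullback (f.app (op ⦋p + 1⦌)) q (simplicialDiff Y p q b) := by
  rw [simplicialDiff_apply, simplicialDiff_apply, map_sum]
  refine Finset.sum_congr rfl fun i _ => ?_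
  rw [map_zsmul, ← pullback_comp, ← pullback_comp, SimplicialObject.δ_naturality]

theorem truncated_le_normalised (X : SimplicialMfd.{u}) (k p q : ℕ) :
    truncated X k p q ≤ normalised X p q := by
  unfold truncated
  split_ifs
  exacts [bot_le, le_rfl]

/-- The truncation depends on `q` alone, so a row is either zero or the full normalised row. -/
theorem map_mem_truncated {Z W : SimplicialMfd.{u}} {p p' q : ℕ}
    (T : (Z _⦋p⦌).Form q →ₗ[ℝ] (W _⦋p'⦌).Form q)
    (hT : ∀ w ∈ normalised Z p q, T w ∈ normalised W p' q) {w : (Z _⦋p⦌).Form q}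
    (hw : w ∈ truncated Z k p q) : T w ∈ truncated W k p' q := by
  unfold truncated at hw ⊢
  split_ifs at hw ⊢
  · rw [(Submodule.mem_bot ℝ).1 hw, map_zero]
    exact zero_mem _
  · exact hT w hw

theorem pullback_mem_truncated (f : X ⟶ Y) {p q : ℕ} {w : (Y _⦋p⦌).Form q}
    (hw : w ∈ truncated Y k p q) : pullback (f.app (op ⦋p⦌)) q w ∈ truncated X k p q :=
  map_mem_truncated _ (fun _ h => pullback_mem f h) hw

/-- Pullback along a map with local lifts is a homotopy equivalence between the simplicial
complexes of truncated normalised forms of a fixed degree. -/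
theorem HasLocalLifts.exists_truncated_homotopyInverse (hf : HasLocalLifts f) (k q : ℕ) :
    ∃ (S : ∀ m, (X _⦋m⦌).Form q →ₗ[ℝ] (Y _⦋m⦌).Form q)
      (h : ∀ m, (X _⦋m + 1⦌).Form q →ₗ[ℝ] (X _⦋m⦌).Form q)
      (l : ∀ m, (Y _⦋m + 1⦌).Form q →ₗ[ℝ] (Y _⦋m⦌).Form q),
      (∀ m, ∀ w ∈ truncated X k m q, S m w ∈ truncated Y k m q) ∧
      (∀ m, ∀ w ∈ truncated X k (m + 1) q, h m w ∈ truncated X k m q) ∧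
      (∀ m, ∀ w ∈ truncated Y k (m + 1) q, l m w ∈ truncated Y k m q) ∧
      (∀ m w, simplicialDiff Y m q (S m w) = S (m + 1) (simplicialDiff X m q w)) ∧
      (∀ w ∈ truncated X k 0 q,
        h 0 (simplicialDiff X 0 q w) = pullback (f.app (op ⦋0⦌)) q (S 0 w) - w) ∧
      (∀ m, ∀ w ∈ truncated X k (m + 1) q,
        h (m + 1) (simplicialDiff X (m + 1) q w) + simplicialDiff X m q (h m w) =
          pullback (f.app (op ⦋m + 1⦌)) q (S (m + 1) w) - w) ∧
      (∀ w ∈ truncated Y k 0 q,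
        l 0 (simplicialDiff Y 0 q w) = S 0 (pullback (f.app (op ⦋0⦌)) q w) - w) ∧
      (∀ m, ∀ w ∈ truncated Y k (m + 1) q,
        l (m + 1) (simplicialDiff Y (m + 1) q w) + simplicialDiff Y m q (l m w) =
          S (m + 1) (pullback (f.app (op ⦋m + 1⦌)) q w) - w) := by
  obtain ⟨S, h, l, hS, hh₀, hh, hl₀, hl⟩ := hf.exists_homotopyInverse q
  have hX {m : ℕ} {w : (X _⦋m⦌).Form q} (hw : w ∈ truncated X k m q) :
      normalisation X m q w = w :=
    normalisation_eq_self (truncated_le_normalised _ _ _ _ hw)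
  have hY {m : ℕ} {w : (Y _⦋m⦌).Form q} (hw : w ∈ truncated Y k m q) :
      normalisation Y m q w = w :=
    normalisation_eq_self (truncated_le_normalised _ _ _ _ hw)
  refine ⟨fun m => normalisation Y m q ∘ₗ S m, fun m => normalisation X m q ∘ₗ h m,
    fun m => normalisation Y m q ∘ₗ l m,
    fun m w hw => map_mem_truncated (normalisation Y m q ∘ₗ S m)
      (fun _ _ => normalisation_mem m _) hw,
    fun m w hw => map_mem_truncated (normalisation X m q ∘ₗ h m)
      (fun _ _ => normalisation_mem m _) hw,
    fun m w hw => map_mem_truncated (normalisation Y m q ∘ₗ l m)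
      (fun _ _ => normalisation_mem m _) hw,
    fun m w => ?_, fun w hw => ?_, fun m w hw => ?_, fun w hw => ?_, fun m w hw => ?_⟩ <;>
    simp only [LinearMap.comp_apply]
  · rw [← normalisation_simplicialDiff, hS]
  · rw [hh₀, map_sub, normalisation_pullback, hX hw]
  · rw [← normalisation_simplicialDiff, ← map_add, hh, map_sub, normalisation_pullback, hX hw]
  · rw [hl₀, map_sub, hY hw]
  · rw [← normalisation_simplicialDiff, ← map_add, hl, map_sub, hY hw]

theorem HasLocalLifts.eq_zero_of_pullback_eq_zero (hf : HasLocalLifts f) {q : ℕ}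
    {b : (Y _⦋0⦌).Form q} (hb : b ∈ truncated Y k 0 q) (hδ : simplicialDiff Y 0 q b = 0)
    (hfb : pullback (f.app (op ⦋0⦌)) q b = 0) : b = 0 := by
  obtain ⟨S, h, l, -, -, -, -, -, -, hl, -⟩ := hf.exists_truncated_homotopyInverse k q
  have := hl b hb
  rw [hδ, hfb, map_zero, map_zero, zero_sub] at this
  exact neg_eq_zero.1 this.symm

theorem HasLocalLifts.exists_primitive_zero (hf : HasLocalLifts f) {q : ℕ}
    {a : (X _⦋0⦌).Form q} {b : (Y _⦋1⦌).Form q} (ha : a ∈ truncated X k 0 q)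
    (hb : b ∈ truncated Y k 1 q) (hδ : simplicialDiff Y 1 q b = 0)
    (hab : pullback (f.app (op ⦋1⦌)) q b = simplicialDiff X 0 q a) :
    ∃ b' ∈ truncated Y k 0 q, simplicialDiff Y 0 q b' = b ∧
      a = pullback (f.app (op ⦋0⦌)) q b' := by
  obtain ⟨S, h, l, mS, mh, ml, hS, hh, -, -, hl⟩ := hf.exists_truncated_homotopyInverse k q
  have hb' : l 1 (simplicialDiff Y 1 q b) + simplicialDiff Y 0 q (l 0 b) =
      S 1 (pullback (f.app (op ⦋1⦌)) q b) - b := hl 0 b hb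
  rw [hδ, map_zero, zero_add (simplicialDiff Y 0 q (l 0 b)), hab, ← hS] at hb'
  -- `δ S a = S δ a = S f^* b`, and `δ l b = S f^* b - b` because `b` is closed.
  have h₁ : simplicialDiff Y 0 q (S 0 a - l 0 b) = b := by rw [map_sub, hb']; abel
  have m₁ : S 0 a - l 0 b ∈ truncated Y k 0 q := sub_mem (mS _ _ ha) (ml _ _ hb)
  generalize S 0 a - l 0 b = b₁ at h₁ m₁
  have h₂ : simplicialDiff X 0 q (a - pullback (f.app (op ⦋0⦌)) q b₁) = 0 := by
    rw [map_sub, simplicialDiff_pullback, h₁, hab, sub_self]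
  have m₂ := sub_mem ha (pullback_mem_truncated f m₁)
  have h₃ := hh _ m₂
  rw [h₂, map_zero] at h₃
  -- The defect `a - f^* b₁` is closed, so in degree zero the homotopy identity makes it equal to
  -- `f^*` of its image under `S`.
  refine ⟨b₁ + S 0 (a - pullback (f.app (op ⦋0⦌)) q b₁), add_mem m₁ (mS _ _ m₂), ?_, ?_⟩
  · rw [map_add, h₁, hS, h₂, map_zero, add_zero]
  · rw [map_add, sub_eq_zero.1 h₃.symm]; abel

theorem HasLocalLifts.exists_primitive_succ (hf : HasLocalLifts f) {p q : ℕ}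
    {a : (X _⦋p + 1⦌).Form q} {b : (Y _⦋p + 2⦌).Form q} (ha : a ∈ truncated X k (p + 1) q)
    (hb : b ∈ truncated Y k (p + 2) q) (hδ : simplicialDiff Y (p + 2) q b = 0)
    (hab : pullback (f.app (op ⦋p + 2⦌)) q b = simplicialDiff X (p + 1) q a) :
    ∃ b' ∈ truncated Y k (p + 1) q, ∃ a' ∈ truncated X k p q,
      simplicialDiff Y (p + 1) q b' = b ∧
      a = pullback (f.app (op ⦋p + 1⦌)) q b' + simplicialDiff X p q a' := by
  obtain ⟨S, h, l, mS, mh, ml, hS, -, hh, -, hl⟩ := hf.exists_truncated_homotopyInverse k q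
  have hb' := hl (p + 1) b hb
  rw [hδ, map_zero, zero_add, hab, ← hS] at hb'
  have h₁ : simplicialDiff Y (p + 1) q (S (p + 1) a - l (p + 1) b) = b := by
    rw [map_sub, hb']; abel
  have m₁ : S (p + 1) a - l (p + 1) b ∈ truncated Y k (p + 1) q :=
    sub_mem (mS _ _ ha) (ml _ _ hb)
  generalize S (p + 1) a - l (p + 1) b = b₁ at h₁ m₁
  have h₂ : simplicialDiff X (p + 1) q (a - pullback (f.app (op ⦋p + 1⦌)) q b₁) = 0 := by
    rw [map_sub, simplicialDiff_pullback, h₁, hab, sub_self]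
  have m₂ := sub_mem ha (pullback_mem_truncated f m₁)
  have h₃ := hh _ _ m₂
  rw [h₂, map_zero, zero_add] at h₃
  -- The same correction now leaves a coboundary: a closed defect `c` satisfies `c = f^* S c - δ h
  -- c`.
  refine ⟨b₁ + S (p + 1) (a - pullback (f.app (op ⦋p + 1⦌)) q b₁), add_mem m₁ (mS _ _ m₂),
    -h p (a - pullback (f.app (op ⦋p + 1⦌)) q b₁), neg_mem (mh _ _ m₂), ?_, ?_⟩
  · rw [map_add, h₁, hS, h₂, map_zero, add_zero]
  · rw [map_add, map_neg, h₃]; abel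

section Families
variable (X)

/-- The family of forms concentrated in a single bidegree. -/
def singleFamily (p q : ℕ) (x : (X _⦋p⦌).Form q) : ∀ p q : ℕ, (X _⦋p⦌).Form q :=
  Pi.single p (Pi.single q x)

variable {X}

theorem singleFamily_self {p q : ℕ} (x : (X _⦋p⦌).Form q) : singleFamily X p q x p q = x := by
  simp [singleFamily]

theorem singleFamily_of_ne {p q p' q' : ℕ} (x : (X _⦋p⦌).Form q) (h : ¬(p' = p ∧ q' = q)) :
    singleFamily X p q x p' q' = 0 := by
  unfold singleFamily
  by_cases hp : p' = p
  · subst hp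
    rw [Pi.single_eq_same, Pi.single_eq_of_ne fun hq => h ⟨rfl, hq⟩]
  · rw [Pi.single_eq_of_ne hp]
    rfl

theorem singleFamily_mem {p q : ℕ} {x : (X _⦋p⦌).Form q} (hx : x ∈ truncated X k p q) :
    singleFamily X p q x ∈ total X k (p + q) := by
  intro p' q'
  by_cases h : p' = p ∧ q' = q
  · obtain ⟨rfl, rfl⟩ := h
    exact ⟨by rwa [singleFamily_self], fun h => absurd rfl h⟩
  · rw [singleFamily_of_ne x h]
    exact ⟨zero_mem _, fun _ => rfl⟩

theorem totalDiff_apply_of_lt {γ : ∀ p q : ℕ, (X _⦋p⦌).Form q} {r : ℕ}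
    (hγ : ∀ p q, q < r → γ p q = 0) (p q : ℕ) (hq : q < r) : totalDiff X γ p q = 0 := by
  rcases p with _ | p <;> rcases q with _ | q
  · rw [totalDiff_zero_zero]
  · rw [totalDiff_zero_succ, hγ _ _ (by lia), map_zero]
  · rw [totalDiff_succ_zero, hγ _ _ hq, map_zero]
  · rw [totalDiff_succ_succ, hγ _ _ hq, hγ _ q (by lia), map_zero, map_zero, smul_zero, add_zero]

theorem totalDiff_zero_apply {γ : ∀ p q : ℕ, (X _⦋p⦌).Form q} {r : ℕ}
    (hγ : ∀ p q, q < r → γ p q = 0) : totalDiff X γ 0 r = 0 := by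
  rcases r with _ | r
  · rw [totalDiff_zero_zero]
  · rw [totalDiff_zero_succ, hγ _ _ (by lia), map_zero]

/-- Since `d` raises `q`, nothing enters the lowest row through `d`. -/
theorem totalDiff_succ_apply {γ : ∀ p q : ℕ, (X _⦋p⦌).Form q} {r : ℕ}
    (hγ : ∀ p q, q < r → γ p q = 0) (p : ℕ) :
    totalDiff X γ (p + 1) r = simplicialDiff X p r (γ p r) := by
  rcases r with _ | r
  · rw [totalDiff_succ_zero]
  · rw [totalDiff_succ_succ, hγ _ r (by lia), map_zero, smul_zero, add_zero]

/-- The part of the truncated total complex one degree below `n`. -/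
def totalPred (X : SimplicialMfd.{u}) (k n : ℕ) : Submodule ℝ (∀ p q : ℕ, (X _⦋p⦌).Form q) :=
  match n with
  | 0 => ⊥
  | n + 1 => total X k n

theorem totalDiff_mem_of_mem_totalPred {n : ℕ} {γ : ∀ p q : ℕ, (X _⦋p⦌).Form q}
    (hγ : γ ∈ totalPred X k n) : totalDiff X γ ∈ total X k n := by
  rcases n with _ | n
  · rw [(Submodule.mem_bot ℝ).1 hγ, map_zero]
    exact zero_mem _
  · exact totalDiff_mem X hγ

end Families

/-- The leading terms of a relative cocycle can be removed. -/
theorem HasLocalLifts.exists_leading (hf : HasLocalLifts f) {p r : ℕ}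
    {α : ∀ p q : ℕ, (X _⦋p⦌).Form q} {β : ∀ p q : ℕ, (Y _⦋p⦌).Form q}
    (hα : α ∈ total X k (p + r)) (hβ : β ∈ total Y k (p + r + 1))
    (hα₀ : ∀ p q, q < r → α p q = 0) (hβ₀ : ∀ p q, q < r → β p q = 0)
    (hDβ : totalDiff Y β = 0) (hαβ : pullbackFamily f β = totalDiff X α) :
    ∃ b ∈ truncated Y k p r, ∃ A ∈ totalPred X k (p + r), (∀ p q, q < r → A p q = 0) ∧
      simplicialDiff Y p r b = β (p + 1) r ∧
      α p r = pullback (f.app (op ⦋p⦌)) r b + totalDiff X A p r := by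
  have h₁ : simplicialDiff Y (p + 1) r (β (p + 1) r) = 0 := by
    rw [← totalDiff_succ_apply hβ₀, hDβ]
    rfl
  have h₂ : pullback (f.app (op ⦋p + 1⦌)) r (β (p + 1) r) = simplicialDiff X p r (α p r) := by
    rw [← totalDiff_succ_apply hα₀, ← hαβ]
    rfl
  rcases p with _ | p
  -- In column `0` no `δ` arrives from the left, so no correction `A` is needed.
  · obtain ⟨b, mb, hb, hab⟩ := hf.exists_primitive_zero (hα 0 r).1 (hβ 1 r).1 h₁ h₂
    refine ⟨b, mb, 0, zero_mem _, fun _ _ _ => rfl, hb, ?_⟩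
    rw [map_zero, hab]
    exact (add_zero _).symm
  · obtain ⟨b, mb, a, ma, hb, hab⟩ :=
      hf.exists_primitive_succ (hα (p + 1) r).1 (hβ (p + 2) r).1 h₁ h₂
    have hA : ∀ p' q, q < r → singleFamily X p r a p' q = 0 := fun p' q hq =>
      singleFamily_of_ne a fun h => hq.ne h.2
    refine ⟨b, mb, singleFamily X p r a, ?_, hA, hb, ?_⟩
    · rw [show p + 1 + r = p + r + 1 by lia]
      exact singleFamily_mem ma
    · rw [totalDiff_succ_apply hA, singleFamily_self, hab]

/-- Induction on the number `r` of initial rows that vanish, downwards. It starts at `N + 2`: `α`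
and `β` have total degrees `N` and `N + 1`, so all their entries satisfy `q < N + 2` and both
vanish. -/
theorem HasLocalLifts.exists_total_primitive_of_vanishing (hf : HasLocalLifts f) (N : ℕ) (r : ℕ)
    (hr : r ≤ N + 2) : ∀ (α : ∀ p q : ℕ, (X _⦋p⦌).Form q) (β : ∀ p q : ℕ, (Y _⦋p⦌).Form q),
      α ∈ total X k N → β ∈ total Y k (N + 1) → (∀ p q, q < r → α p q = 0) →
      (∀ p q, q < r → β p q = 0) → totalDiff Y β = 0 → pullbackFamily f β = totalDiff X α →
      ∃ β' ∈ total Y k N, ∃ α' ∈ totalPred X k N, totalDiff Y β' = β ∧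
        α = pullbackFamily f β' + totalDiff X α' := by
  induction hr using Nat.decreasingInduction with
  | self =>
    intro α β hα hβ hα₀ hβ₀ _ _
    have h₁ : α = 0 := by
      funext p q
      by_cases h : q < N + 2
      · exact hα₀ p q h
      · exact (hα p q).2 (by lia)
    have h₂ : β = 0 := by
      funext p q
      by_cases h : q < N + 2
      · exact hβ₀ p q h
      · exact (hβ p q).2 (by lia)
    exact ⟨0, zero_mem _, 0, zero_mem _, by rw [h₂, map_zero],
      by rw [h₁, map_zero, map_zero, add_zero]⟩
  | of_succ r hr ih =>
    intro α β hα hβ hα₀ hβ₀ hDβ hαβ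
    -- For `r = N + 1` only `β 0 (N + 1)` can be nonzero, and injectivity of `f^*` on closed forms
    -- in column `0` kills it. Otherwise row `r` meets `α` in column `N - r` and `β` in the next
    -- column.
    rcases (Nat.lt_succ_iff.1 hr).eq_or_lt with rfl | hr'
    · have h₁ : β 0 (N + 1) = 0 := by
        refine hf.eq_zero_of_pullback_eq_zero (hβ _ _).1 ?_ ?_
        · rw [← totalDiff_succ_apply hβ₀, hDβ]
          rfl
        · exact (congrFun (congrFun hαβ 0) (N + 1)).trans (totalDiff_zero_apply hα₀)
      refine ih α β hα hβ (fun p q hq => ?_) (fun p q hq => ?_) hDβ hαβ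
      · rcases (Nat.lt_succ_iff.1 hq).eq_or_lt with rfl | hq
        · exact (hα p _).2 (by lia)
        · exact hα₀ p q hq
      · rcases (Nat.lt_succ_iff.1 hq).eq_or_lt with rfl | hq
        · rcases p with _ | p
          · exact h₁
          · exact (hβ _ _).2 (by lia)
        · exact hβ₀ p q hq
    · obtain ⟨p, rfl⟩ : ∃ p, N = p + r := ⟨N - r, by lia⟩
      obtain ⟨b, mb, A, mA, hA₀, hb, hab⟩ := hf.exists_leading hα hβ hα₀ hβ₀ hDβ hαβ
      have mB := singleFamily_mem mb
      have hB : singleFamily Y p r b p r = b := singleFamily_self b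
      have hB₀ : ∀ p' q, q < r → singleFamily Y p r b p' q = 0 := fun p' q hq =>
        singleFamily_of_ne b fun h => hq.ne h.2
      generalize singleFamily Y p r b = B at mB hB hB₀
      -- Subtracting the relative coboundary of `(B, A)` clears row `r`: by degree only one bidegree
      -- matters for each of `α` and `β`, and `B`, `A` do not disturb the lower rows.
      have mα := sub_mem (sub_mem hα (pullbackFamily_mem f mB)) (totalDiff_mem_of_mem_totalPred mA)
      have mβ := sub_mem hβ (totalDiff_mem Y mB)
      have h₁ : ∀ p' q, q < r + 1 → (α - pullbackFamily f B - totalDiff X A) p' q = 0 := by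
        intro p' q hq
        rcases (Nat.lt_succ_iff.1 hq).eq_or_lt with rfl | hq
        · by_cases h : p' = p
          · subst h
            simp only [Pi.sub_apply, pullbackFamily_apply, hab, hB]
            abel
          · exact (mα p' q).2 (by lia)
        · simp only [Pi.sub_apply, pullbackFamily_apply, hα₀ _ _ hq, hB₀ _ _ hq, map_zero,
            totalDiff_apply_of_lt hA₀ _ _ hq, sub_zero]
      have h₂ : ∀ p' q, q < r + 1 → (β - totalDiff Y B) p' q = 0 := by
        intro p' q hq
        rcases (Nat.lt_succ_iff.1 hq).eq_or_lt with rfl | hq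
        · by_cases h : p' = p + 1
          · subst h
            simp only [Pi.sub_apply, totalDiff_succ_apply hB₀, hB, hb, sub_self]
          · exact (mβ p' q).2 (by lia)
        · simp only [Pi.sub_apply, hβ₀ _ _ hq, totalDiff_apply_of_lt hB₀ _ _ hq, sub_zero]
      obtain ⟨β', mβ', α', mα', hβ', hα'⟩ := ih _ _ mα mβ h₁ h₂
        (by rw [map_sub, hDβ, totalDiff_totalDiff, sub_zero])
        (by rw [map_sub, map_sub, map_sub, totalDiff_totalDiff, hαβ, totalDiff_pullbackFamily,
          sub_zero])
      refine ⟨β' + B, add_mem mβ' mB, α' + A, add_mem mα' mA, ?_, ?_⟩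
      · rw [map_add, hβ', sub_add_cancel]
      · rw [map_add, map_add, eq_add_of_sub_eq (eq_add_of_sub_eq hα')]
        abel

/-- A relative cocycle of the truncated normalised total complexes is a relative coboundary. -/
theorem HasLocalLifts.exists_total_primitive (hf : HasLocalLifts f) {N : ℕ}
    {α : ∀ p q : ℕ, (X _⦋p⦌).Form q} {β : ∀ p q : ℕ, (Y _⦋p⦌).Form q}
    (hα : α ∈ total X k N) (hβ : β ∈ total Y k (N + 1)) (hDβ : totalDiff Y β = 0)
    (hαβ : pullbackFamily f β = totalDiff X α) :
    ∃ β' ∈ total Y k N, ∃ α' ∈ totalPred X k N, totalDiff Y β' = β ∧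
      α = pullbackFamily f β' + totalDiff X α' :=
  hf.exists_total_primitive_of_vanishing N 0 (Nat.zero_le _) α β hα hβ (fun _ _ h => by lia)
    (fun _ _ h => by lia) hDβ hαβ

theorem HasLocalLifts.eq_zero_of_mem_total_zero (hf : HasLocalLifts f)
    {β : ∀ p q : ℕ, (Y _⦋p⦌).Form q} (hβ : β ∈ total Y k 0) (hDβ : totalDiff Y β = 0)
    (hfβ : pullbackFamily f β = 0) : β = 0 := by
  funext p q
  by_cases h : p + q = 0
  · obtain ⟨rfl, rfl⟩ : p = 0 ∧ q = 0 := by lia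
    refine hf.eq_zero_of_pullback_eq_zero (hβ 0 0).1 ?_ (congrFun (congrFun hfβ 0) 0)
    exact (totalDiff_succ_zero Y β 0).symm.trans (congrFun (congrFun hDβ 1) 0)
  · exact (hβ p q).2 h

theorem totalComplex_d_coe (X : SimplicialMfd.{u}) (k n : ℕ) (x : (totalComplex X k).X n) :
    (((totalComplex X k).d n (n + 1)).hom x : total X k (n + 1)).1 =
      totalDiff X (x : total X k n).1 := by
  have h : (totalComplex X k).d n (n + 1) =
      ModuleCat.ofHom ((totalDiff X).restrict fun _ h => totalDiff_mem X h) := by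
    simp only [totalComplex, CochainComplex.of_d]
  rw [h]
  rfl

theorem HasLocalLifts.quasiIso_totalPullback (hf : HasLocalLifts f) (k : ℕ) :
    QuasiIso (totalPullback f k) := by
  have hd (Z : SimplicialMfd.{u}) {n : ℕ} {x : (totalComplex Z k).X n}
      {y : (totalComplex Z k).X (n + 1)} :
      ((totalComplex Z k).d n (n + 1)).hom x = y ↔
        totalDiff Z (x : total Z k n).1 = (y : total Z k (n + 1)).1 := by
    rw [← totalComplex_d_coe]
    exact Subtype.ext_iff
  refine CochainComplex.quasiIso_of_descent _ (fun x hx hfx => ?_) (fun x y hx hxy => ?_)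
    (fun n x y hx hxy => ?_)
  · exact Subtype.ext (hf.eq_zero_of_mem_total_zero (x : total Y k 0).2 ((hd Y).1 hx)
      (congrArg Subtype.val hfx))
  · obtain ⟨β', mβ', α', mα', h₁, h₂⟩ := hf.exists_total_primitive (y : total X k 0).2
      (x : total Y k 1).2 ((hd Y).1 hx) ((hd X).1 hxy.symm).symm
    -- In degree zero `totalPred` is `⊥`, so there is no coboundary term.
    rw [(Submodule.mem_bot ℝ).1 mα', map_zero, add_zero] at h₂
    exact ⟨⟨β', mβ'⟩, (hd Y).2 h₁, Subtype.ext h₂⟩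
  · obtain ⟨β', mβ', α', mα', h₁, h₂⟩ := hf.exists_total_primitive (y : total X k (n + 1)).2
      (x : total Y k (n + 2)).2 ((hd Y).1 hx) ((hd X).1 hxy.symm).symm
    refine ⟨⟨β', mβ'⟩, ⟨α', mα'⟩, (hd Y).2 h₁, Subtype.ext (h₂.trans ?_)⟩
    exact congrArg (pullbackFamily f β' + ·) (totalComplex_d_coe X k n ⟨α', mα'⟩).symm

end SimplicialMfd
end Descent
end

theorem mainTheorem2 (n : ℕ) {X Y : SimplicialMfd.{u}} (f : X ⟶ Y)
    (hf : SimplicialMfd.IsHypercover n f) (k : ℕ) :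
    QuasiIso (SimplicialMfd.totalPullback f k) :=
  hf.hasLocalLifts.quasiIso_totalPullback k
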